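/- Let $B$ be a unital complex algebra and $(A,\varphi)$ a noncommutative probability space over $B$: $A$ is a unital complex algebra containing $B$ unitally, and $\varphi:A\to B$ is linear with $\varphi(b)=b$ and $\varphi(bab')=b\varphi(a)b'$ for $b,b'\in B$, $a\in A$. The cumulants $c_\varphi^{(n)}$ are determined by $$\varphi(a_1\cdots a_n)=\sum_{\pi\in NC(n)}\widehat{c_\varphi}(\pi)(a_1\otimes\cdots\otimes a_n),$$ where $NC(n)$ is the set of noncrossing partitions and $\widehat{c_\varphi}(\pi)$ is the product of the $c_\varphi^{(|V|)}$ over the blocks $V$ of $\pi$, nested as prescribed by $\pi$. Families of subsets are free over $B$ if the mixed cumulants of the subalgebras that they generate together with $B$ vanish. The R-transform $R_{x_1,\dots,x_s}^{(\varphi)}(z_1,\dots,z_s)$ is the $B$-formal series whose coefficient at $z_{i_1}\cdots z_{i_n}$ ($n\ge1$) is $c_\varphi^{(n)}(x_{i_1}\otimes b_{i_2}x_{i_2}\otimes\cdots\otimes b_{i_n}x_{i_n})$, where the inserted elements $b_{i_2},\dots,b_{i_n}\in B$ are arbitrary (they may be chosen separately for every word $i_1\cdots i_n$); $R^{symm(b_0)}$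 is the case in which all of them are $b_0$, and $R^{t}=R^{symm(1)}$ is the trivial R-transform. Let $X=\{x_1,\dots,x_s\}$ and $Y=\{y_1,\dots,y_s\}$ in $A$ be free over $B$. Let $p=p^2\in A$ commute with $B$, let $\{p\}$ and $X\cup Y$ be free over $B$, and let $b_0=\varphi(p)$ be invertible and central in $B$. Regard $pAp$, with unit $p$, as an algebra containing $B$ through $b\mapsto pbp=bp$, with the $B$-functional $\varphi_p=b_0^{-1}\varphi|_{pAp}$. Then, for all choices of the inserted elements (the same on both sides of each equation, up to the displayed factors $b_0$): (1) $R^{(\varphi_p):t}_{px_1p,\dots,px_sp}=R^{(\varphi):symm(b_0)}_{x_1,\dots,x_s}$, and the coefficient of $R^{(\varphi_p)}_{px_1p,\dots,px_sp}$ at $z_{i_1}\cdots z_{i_n}$ is $c_\varphi^{(n)}(x_{i_1}\otimes b_0b_{i_2}x_{i_2}\otimes\cdots\otimes b_0b_{i_n}x_{i_n})$. (2) $R^{(\varphi_p)}_{px_1p,\dots,px_sp,py_1p,\dots,py_sp}(z_1,\dots,z_{2s})=R^{(\varphi_p)}_{px_1p,\dots,px_sp}(z_1,\dots,z_s)+R^{(\varphi_p)}_{py_1p,\dots,py_sp}(z_{s+1},\dots,z_{2s})$.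 (3) $R^{(\varphi_p)}_{px_1p+py_1p,\dots,px_sp+py_sp}=R^{(\varphi_p)}_{px_1p,\dots,px_sp}+R^{(\varphi_p)}_{py_1p,\dots,py_sp}$. (4) $R^{(\varphi_p)}_{(px_1p)(py_1p),\dots,(px_sp)(py_sp)}=R^{(\varphi_p)}_{px_1p,\dots,px_sp}\,\boxed{*}_B\,R^{(\varphi_p):t}_{py_1p,\dots,py_sp}=R^{(\varphi_p)}_{px_1p,\dots,px_sp}\,\boxed{*}_B\,R^{(\varphi):t}_{y_1,\dots,y_s}$. Here the boxed convolution $\boxed{*}_B$ of two series presented, by families $x,y$ that are free over $B$ in one and the same space $(A,\varphi)$, with coefficients $c_\varphi^{(n)}(x_{i_1}\otimes b_{i_2}x_{i_2}\otimes\cdots)$ and $c_\varphi^{(n)}(y_{i_1}\otimes b'_{i_2}y_{i_2}\otimes\cdots)$ is the series with coefficients $$\sum_{\pi\in NC(n)}\widehat{c_\varphi}(\pi\cup Kr(\pi))\big(x_{i_1}\otimes y_{i_1}\otimes b_{i_2}x_{i_2}\otimes b'_{i_2}y_{i_2}\otimes\cdots\otimes b_{i_n}x_{i_n}\otimes b'_{i_n}y_{i_n}\big),$$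 where $Kr(\pi)$ is the Kreweras complement and $\pi\cup Kr(\pi)$ the alternating union in $NC(2n)$. The first convolution in (4) is taken in $(pAp,\varphi_p)$. In the second one $R^{(\varphi_p)}_{px_1p,\dots,px_sp}$ is presented in $(A,\varphi)$ by $x_1,\dots,x_s$ with inserted elements $b_0b_{i_j}$, as in (1); that is, (4) says that the coefficient of $R^{(\varphi_p)}_{(px_1p)(py_1p),\dots,(px_sp)(py_sp)}$ at $z_{i_1}\cdots z_{i_n}$ is also $$\sum_{\pi\in NC(n)}\widehat{c_\varphi}(\pi\cup Kr(\pi))\big(x_{i_1}\otimes y_{i_1}\otimes b_0b_{i_2}x_{i_2}\otimes y_{i_2}\otimes\cdots\otimes b_0b_{i_n}x_{i_n}\otimes y_{i_n}\big).$$ -/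

import Mathlib

/-! ### Noncrossing partitions -/

/-- A partition of `{0, …, n-1}` is noncrossing if `i < j < k < l`, `i ∼ k` and `j ∼ l` force
`i ∼ j`. -/
def IsNoncrossing {n : ℕ} (π : Finpartition (Finset.univ : Finset (Fin n))) : Prop :=
  ∀ i j k l : Fin n, i < j → j < k → k < l →
    π.part i = π.part k → π.part j = π.part l → π.part i = π.part j

instance {n : ℕ} (π : Finpartition (Finset.univ : Finset (Fin n))) : Decidable (IsNoncrossing π) :=
  inferInstanceAs (Decidable (∀ i j k l : Fin n, i < j → j < k → k < l →
    π.part i = π.part k → π.part j = π.part l → π.part i = π.part j))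

/-- The finite set `NC(n)` of noncrossing partitions of an `n`-element chain. -/
def NC (n : ℕ) : Finset (Finpartition (Finset.univ : Finset (Fin n))) :=
  Finset.univ.filter IsNoncrossing

/-- Points `x₀ < y₀ < x₁ < y₁ < ⋯`, the `x`'s being partitioned by `π`. Two points `y_i`, `y_j`
can be joined without crossing a block of `π` exactly when the set of the `x_u` lying between
them is a union of blocks of `π`. This is an equivalence relation on the `y`'s. -/
def krewerasSetoid {n : ℕ} (π : Finpartition (Finset.univ : Finset (Fin n))) :
    Setoid (Fin n) where
  r i j := ∀ u v : Fin n, π.part u = π.part v →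
    ((min i j < u ∧ u ≤ max i j) ↔ (min i j < v ∧ v ≤ max i j))
  iseqv :=
    { refl := by
        intro i u v _
        simp only [min_self, max_self]
        constructor <;> rintro ⟨h1, h2⟩ <;> exact absurd h1 (not_lt.mpr h2)
      symm := by
        intro i j h u v huv
        simpa only [min_comm, max_comm] using h u v huv
      trans := by
        intro i j k h1 h2 u v huv
        have a := h1 u v huv
        have b := h2 u v huv
        simp only [min_lt_iff, le_max_iff] at a b ⊢
        omega }

instance {n : ℕ} (π : Finpartition (Finset.univ : Finset (Fin n))) :
    DecidableRel (krewerasSetoid π).r :=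
  fun i j => inferInstanceAs (Decidable (∀ u v : Fin n, π.part u = π.part v →
    ((min i j < u ∧ u ≤ max i j) ↔ (min i j < v ∧ v ≤ max i j))))

/-- The Kreweras complement `Kr(π)` of a noncrossing partition `π`: the largest partition `σ` of
the `y`'s such that the alternating union `π ∪ σ` on `x₀ < y₀ < x₁ < y₁ < ⋯` is noncrossing. -/
def kreweras {n : ℕ} (π : Finpartition (Finset.univ : Finset (Fin n))) :
    Finpartition (Finset.univ : Finset (Fin n)) :=
  Finpartition.ofSetoid (krewerasSetoid π)

/-! ### Multiplicative functions -/

theorem length_le_of_mem_splitOnP {α : Type*} (q : α → Bool) (l g : List α)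
    (hg : g ∈ l.splitOnP q) : g.length ≤ l.length := by
  induction l generalizing g with
  | nil => simp at hg; simp [hg]
  | cons a l ih =>
    rw [List.splitOnP_cons_eq_if_modifyHead] at hg
    split at hg
    · rcases List.mem_cons.mp hg with rfl | h
      · simp
      · exact (ih g h).trans (by simp)
    · cases hs : l.splitOnP q with
      | nil => simp [hs] at hg
      | cons h t =>
        rw [hs] at hg
        simp only [List.modifyHead_cons, List.mem_cons] at hg
        rcases hg with rfl | hg
        · simpa using ih h (by simp [hs])
        · exact (ih g (by simp [hs, hg])).trans (by simp)

/-- The value `f̂(π)(a₁ ⊗ ⋯ ⊗ a_n)` of the multiplicative function with components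
`f⁽ᵐ⁾(a₁ ⊗ ⋯ ⊗ a_m) = f [a₁, …, a_m]` at a noncrossing partition `π`. The argument is the word
`[(k₁, a₁), …, (k_n, a_n)]`, where `k_i` is the name of the block of `π` that contains `i`.
If `{v₁ = 1 < v₂ < ⋯ < v_m}` is the first block, then
`f̂(π)(a₁ ⊗ ⋯ ⊗ a_n) = f⁽ᵐ⁾(a_{v₁} β₁ ⊗ ⋯ ⊗ a_{v_m} β_m)`, where `β_j ∈ B` is the value of `f̂` on
the word strictly between `v_j` and `v_{j+1}` (after `v_m` for `j = m`), and is `1` on the empty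
word. For a bimodule map `f⁽ᵐ⁾` the last factor `β_m` may equally be written outside `f⁽ᵐ⁾`. -/
def nestedEval {A B κ : Type*} [Mul A] [One B] [DecidableEq κ] (ι : B → A) (f : List A → B) :
    List (κ × A) → B
  | [] => 1
  | (k, a) :: l =>
      f (List.zipWith (fun c β => c * ι β)
        (a :: (l.filter (fun q => q.1 = k)).map Prod.snd)
        ((l.splitOnP (fun q => q.1 = k)).attach.map (fun g => nestedEval ι f g.1)))
  termination_by w => w.length
  decreasing_by
    exact Nat.lt_succ_of_le (length_le_of_mem_splitOnP _ _ _ g.2)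

/-- The word `[(V(1), a₁), …, (V(n), a_n)]`, where `V(i)` is the block of `π` containing `i`. -/
def blockWord {A : Type*} (l : List A)
    (π : Finpartition (Finset.univ : Finset (Fin l.length))) :
    List (Finset (Fin l.length) × A) :=
  List.ofFn fun i => (π.part i, l.get i)

/-! ### Noncommutative probability spaces over `B` -/

/-- A noncommutative probability space `(A, φ)` over the unital algebra `B`: a unital algebra `A`
containing `B` (through the unital homomorphism `ι`, which is injective because of `φ_ι`) and a
linear `B`-functional (conditional expectation) `φ : A → B`. -/
structure NCPSpace (B A : Type*) [Ring B] [Algebra ℂ B] [Ring A] [Algebra ℂ A] where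
  ι : B →ₐ[ℂ] A
  φ : A →ₗ[ℂ] B
  φ_ι : ∀ b : B, φ (ι b) = b
  φ_bimodule : ∀ (b b' : B) (x : A), φ (ι b * x * ι b') = b * φ x * b'

/-- `B`-formal series without constant term in noncommuting indeterminates indexed by `κ`: the
family of the coefficients of `z_{w 0} ⋯ z_{w n}`, for all `n : ℕ` and all words `w` of
length `n + 1`. -/
abbrev BSeries (B κ : Type*) := (n : ℕ) → (Fin (n + 1) → κ) → B

/-- A choice, for each word `w = (w 0, …, w n)`, of the elements of `B` inserted in front of the
second, third, …, last letter (`b_{i_2}, …, b_{i_n}`). -/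
abbrev Insertion (B κ : Type*) := (n : ℕ) → (Fin (n + 1) → κ) → Fin n → B

/-- The series `f(z_{e 1}, …, z_{e s})` as a series in a larger set of indeterminates. -/
def BSeries.rename {B κ κ' : Type*} [AddCommMonoid B] [Fintype κ] [DecidableEq κ'] (e : κ → κ')
    (f : BSeries B κ) : BSeries B κ' :=
  fun n w' => ∑ w : Fin (n + 1) → κ with (fun j => e (w j)) = w', f n w

namespace NCPSpace

variable {B A : Type*} [Ring B] [Algebra ℂ B] [Ring A] [Algebra ℂ A] (P : NCPSpace B A)

/-- The cumulants of words of length at most `n`, by recursion on the length through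
`φ(a₁ ⋯ a_n) = ∑_{π ∈ NC(n)} ĉ(π)(a₁ ⊗ ⋯ ⊗ a_n)`, solved for the term `π = 1_n`. -/
def cumulantUpTo : ℕ → List A → B
  | 0 => fun _ => 0
  | n + 1 => fun l =>
      if l.length = n + 1 then
        P.φ l.prod - ∑ π ∈ (NC l.length).erase ⊤,
          nestedEval P.ι (cumulantUpTo n) (blockWord l π)
      else cumulantUpTo n l

/-- The cumulant `c⁽ⁿ⁾(a₁ ⊗ ⋯ ⊗ a_n)` of the word `[a₁, …, a_n]` (for `n ≥ 1`): the family
determined by the moment-cumulant formula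
`φ(a₁ ⋯ a_n) = ∑_{π ∈ NC(n)} ĉ(π)(a₁ ⊗ ⋯ ⊗ a_n)`. -/
def cumulant (l : List A) : B := P.cumulantUpTo l.length l

/-- The family of subsets `S i` is free over `B`: the mixed cumulants of the subalgebras
`Alg(S i, B)` vanish. -/
def IsFree {I : Type*} (S : I → Set A) : Prop :=
  ∀ (n : ℕ) (i : Fin n → I) (a : Fin n → A),
    (∀ j, a j ∈ Algebra.adjoin ℂ (S (i j) ∪ Set.range P.ι)) →
    (∃ j k, i j ≠ i k) → P.cumulant (List.ofFn a) = 0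

/-- The letters `x_{w 0}, b_1 x_{w 1}, …, b_n x_{w n}`. -/
def letters {κ : Type*} (x : κ → A) (b : Insertion B κ) (n : ℕ) (w : Fin (n + 1) → κ) :
    Fin (n + 1) → A :=
  Fin.cons (x (w 0)) fun j => P.ι (b n w j) * x (w j.succ)

/-- The R-transform of the family `x`, for the inserted elements `b`: the coefficients are the
cumulants `c(x_{w 0} ⊗ b_1 x_{w 1} ⊗ ⋯ ⊗ b_n x_{w n})`. -/
def rTransform {κ : Type*} (x : κ → A) (b : Insertion B κ) : BSeries B κ :=
  fun n w => P.cumulant (List.ofFn (P.letters x b n w))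

/-- The symmetric R-transform `R^{symm(b₀)}`: the element `b₀` is inserted everywhere. -/
def symmRTransform {κ : Type*} (x : κ → A) (b₀ : B) : BSeries B κ :=
  P.rTransform x fun _ _ _ => b₀

/-- The trivial R-transform `R^t = R^{symm(1)}`. -/
def trivialRTransform {κ : Type*} (x : κ → A) : BSeries B κ :=
  P.symmRTransform x 1

/-- The boxed convolution over `B` of the series with coefficients
`c(x_{w 0} ⊗ b_1 x_{w 1} ⊗ ⋯ ⊗ b_n x_{w n})` and `c(y_{w 0} ⊗ b'_1 y_{w 1} ⊗ ⋯ ⊗ b'_n y_{w n})`,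
`x` and `y` being families that are free over `B` in `(A, φ)`: its coefficients are
`∑_{π ∈ NC(n+1)} ĉ(π ∪ Kr(π))(x_{w 0} ⊗ y_{w 0} ⊗ b_1 x_{w 1} ⊗ b'_1 y_{w 1} ⊗ ⋯)`, where
`π` partitions the odd and `Kr(π)` the even positions of the `2(n+1)` tensor factors. -/
def boxedConv {κ : Type*} (x y : κ → A) (b b' : Insertion B κ) : BSeries B κ :=
  fun n w => ∑ π ∈ NC (n + 1),
    nestedEval P.ι P.cumulant
      (List.ofFn fun j : Fin (n + 1) =>
        [(Sum.inl (π.part j), P.letters x b n w j),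
         (Sum.inr ((kreweras π).part j), P.letters y b' n w j)]).flatten

end NCPSpace

/-! ### Compression by an idempotent -/

section Compression

variable {A : Type*} [Ring A] [Algebra ℂ A] {p : A}

/-- The element `pap` of the algebra `pAp`. -/
def cornerMk (hp : IsIdempotentElem p) (a : A) : hp.Corner := ⟨p * a * p, a, rfl⟩

/-- The inclusion `pAp ⊆ A`. -/
def cornerVal (hp : IsIdempotentElem p) (x : hp.Corner) : A := x.1

/-- The algebra structure of `pAp`, with unit `p`. -/
instance cornerAlgebra (hp : IsIdempotentElem p) : Algebra ℂ hp.Corner where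
  smul c x := ⟨c • cornerVal hp x, by
    obtain ⟨a, ha⟩ := x.2
    exact ⟨c • a, by
      rw [cornerVal, ← ha]
      simp only [mul_smul_comm, smul_mul_assoc]⟩⟩
  algebraMap :=
    { toFun := fun c => ⟨c • p, c • 1, by simp [hp.eq]⟩
      map_one' := Subtype.ext (one_smul ℂ p)
      map_mul' := fun c d => Subtype.ext <| by
        change (c * d) • p = (c • p) * (d • p)
        rw [smul_mul_smul_comm, hp.eq]
      map_zero' := Subtype.ext (zero_smul ℂ p)
      map_add' := fun c d => Subtype.ext (add_smul c d p) }
  commutes' c x := Subtype.ext <| by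
    change (c • p) * cornerVal hp x = cornerVal hp x * (c • p)
    have h := (Subsemigroup.mem_corner_iff hp).mp x.2
    rw [smul_mul_assoc, mul_smul_comm, cornerVal, h.1, h.2]
  smul_def' c x := Subtype.ext <| by
    change c • cornerVal hp x = (c • p) * cornerVal hp x
    have h := (Subsemigroup.mem_corner_iff hp).mp x.2
    rw [smul_mul_assoc, cornerVal, h.1]

variable {B : Type*} [Ring B] [Algebra ℂ B]

/-- The compressed space `(pAp, φ_p)` over `B`, where `φ_p = b₀⁻¹ φ` and `b₀ = φ(p)` is invertible
and central in `B`. The idempotent `p` commutes with `B`, and `B` is embedded in `pAp` by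
`b ↦ pbp = bp`. -/
def NCPSpace.compress (P : NCPSpace B A) (hp : IsIdempotentElem p)
    (hpB : ∀ b : B, P.ι b * p = p * P.ι b) (b₀ : Bˣ) (hb₀ : P.φ p = b₀)
    (hcentral : ∀ b : B, (b₀ : B) * b = b * b₀) : NCPSpace B hp.Corner where
  ι :=
    { toFun := fun b => cornerMk hp (P.ι b)
      map_one' := Subtype.ext <| by
        change p * P.ι 1 * p = p
        rw [map_one, mul_one, hp.eq]
      map_mul' := fun b b' => Subtype.ext <| by
        change p * P.ι (b * b') * p = (p * P.ι b * p) * (p * P.ι b' * p)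
        have e : ∀ c : B, p * P.ι c * p = P.ι c * p := fun c => by rw [← hpB, mul_assoc, hp.eq]
        rw [e, e, e, map_mul, mul_assoc (P.ι b) p, ← mul_assoc p, e, mul_assoc]
      map_zero' := Subtype.ext <| by
        change p * P.ι 0 * p = 0
        simp
      map_add' := fun b b' => Subtype.ext <| by
        change p * P.ι (b + b') * p = p * P.ι b * p + p * P.ι b' * p
        rw [map_add, mul_add, add_mul]
      commutes' := fun c => Subtype.ext <| by
        change p * P.ι (algebraMap ℂ B c) * p = c • p
        rw [AlgHom.commutes, Algebra.algebraMap_eq_smul_one, mul_smul_comm, mul_one,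
          smul_mul_assoc, hp.eq] }
  φ :=
    { toFun := fun x => ((b₀⁻¹ : Bˣ) : B) * P.φ (cornerVal hp x)
      map_add' := fun x y => by
        change _ * P.φ (cornerVal hp x + cornerVal hp y) = _
        rw [map_add, mul_add]
      map_smul' := fun c x => by
        change _ * P.φ (c • cornerVal hp x) = _
        rw [map_smul, mul_smul_comm, RingHom.id_apply] }
  φ_ι := fun b => by
    change ((b₀⁻¹ : Bˣ) : B) * P.φ (p * P.ι b * p) = b
    have h := P.φ_bimodule b 1 p
    rw [map_one, mul_one, mul_one, hb₀] at h
    rw [← hpB, mul_assoc, hp.eq, h, ← hcentral, Units.inv_mul_cancel_left]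
  φ_bimodule := fun b b' x => by
    change ((b₀⁻¹ : Bˣ) : B) *
      P.φ ((p * P.ι b * p) * cornerVal hp x * (p * P.ι b' * p)) =
        b * (((b₀⁻¹ : Bˣ) : B) * P.φ (cornerVal hp x)) * b'
    have hx := (Subsemigroup.mem_corner_iff hp).mp x.2
    have h1 : (p * P.ι b * p) * cornerVal hp x * (p * P.ι b' * p) =
        P.ι b * cornerVal hp x * P.ι b' := by
      have e1 : p * P.ι b * p = P.ι b * p := by rw [← hpB, mul_assoc, hp.eq]
      have e2 : p * P.ι b' * p = p * P.ι b' := by rw [mul_assoc, hpB, ← mul_assoc, hp.eq]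
      have e3 : p * cornerVal hp x = cornerVal hp x := hx.1
      have e4 : cornerVal hp x * p = cornerVal hp x := hx.2
      rw [e1, e2, mul_assoc (P.ι b), e3, ← mul_assoc, mul_assoc (P.ι b), e4]
    have h2 : ((b₀⁻¹ : Bˣ) : B) * b = b * ((b₀⁻¹ : Bˣ) : B) := by
      have := hcentral b
      exact ((show Commute (b₀ : B) b from this).units_inv_left).eq
    rw [h1, P.φ_bimodule, ← mul_assoc, ← mul_assoc, h2, mul_assoc b]

end Compression

/-! ### Sums over the ways of cutting a list -/

/-! The whole argument rests on the expansion by the first block. Fix the block of the first letter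
of a word. The other blocks of a noncrossing partition lie in the gaps behind the letters of this
block, and they sum up to the moments of the gaps. So `φ(a₁ ⋯ a_n)` is the sum, over all chains of
letters beginning with `a₁`, of the cumulant of the chain with each letter multiplied by the moment
of the gap behind it (`NCPSpace.moment_eq_chainSum`). Conversely, chain sums determine the summand:
the chain of all letters contributes its value at the word itself, and all other chains are shorter
(`eq_of_chainSum_eq`). Cumulants are therefore identified by comparing chain sums. The sums over
`NC(n)` in the definitions are turned into chain sums through binary trees, whose left subtree is
the gap behind the first letter and whose right subtree is the continuation of its block.

Compression. Let `a₁, …, a_n` (`n ≥ 1`) be free from `p`. First, `p a₁ p ⋯ a_n p` and `a₁ p ⋯ a_n p`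
have the same moment (`NCPSpace.FreePair.moment_cons_idempotent`). In the second word the block of
`a₁` contains only `a`'s, and the gap behind each of them has the form `p a p ⋯ p`, whose moment is
`b₀` times a moment of `φ_p`. Of the `n` factors `b₀` one cancels against `φ = b₀ φ_p`, and the
others move in front of the next letters of the block. Inverting the chain sum gives `c_{φ_p}(pa₁p ⊗
⋯ ⊗ pa_np) = c_φ(a₁ ⊗ b₀a₂ ⊗ ⋯ ⊗ b₀a_n)` (`NCPSpace.FreePair.ucumulant_compress`). This is (1). It
also carries the vanishing of mixed cumulants of `X` and `Y` over to their compressions, whence (2)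
and (3).

Products. In a partition of `x₁ y₁ ⋯ x_n y_n` that does not mix `x`'s with `y`'s, collect the pairs
`(x_i, y_i)` connected to the first pair once each `x_i` is linked to its `y_i`. On these pairs the
partition has the form `π ∪ Kr(π)`, and the other pairs fill the gaps behind them. Thus the moment
is a chain sum over pairs of the sums over `π ∪ Kr(π)`, and inversion gives the cumulants of the
products `x_i y_i` (`NCPSpace.FreePair.ucumulant_map_mul`). In `pAp` this is the first half of (4).
For the second half, a block of size `m` produces `m - 1` factors `b₀` by the compression formula;
`π ∪ Kr(π)` has `n + 1` blocks on `2n` letters, so there are `n - 1` factors in all, and they can be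
moved in front of `x₂, …, x_n` (`NCPSpace.FreePair.krewerasSum_scale`). -/

section ListSums

variable {α β γ M N : Type*}

section AddCommMonoid

variable [AddCommMonoid M] [AddCommMonoid N]

/-- The sum of `f g r` over all `g ++ r = l`. -/
def splitSum : (List α → List α → M) → List α → M
  | f, [] => f [] []
  | f, a :: l => f [] (a :: l) + splitSum (fun g r => f (a :: g) r) l

/-- The sum of `f g a r` over all `g ++ a :: r = l`. -/
def pivotSum : (List α → α → List α → M) → List α → M
  | _, [] => 0
  | f, a :: l => f [] a l + pivotSum (fun g b r => f (a :: g) b r) l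

/-- The sum of `G g₀ [h v₁ g₁, …, h v_m g_m]` over all `g₀ ++ v₁ :: g₁ ++ ⋯ ++ v_m :: g_m = l`. -/
def gapSum (h : α → List α → β) : (List α → List β → M) → List α → M
  | G, [] => G [] []
  | G, a :: l => gapSum h (fun g L => G (a :: g) L + G [] (h a g :: L)) l

/-- The sum of `F [h v₁ g₁, …, h v_m g_m]` over all `v₁ :: g₁ ++ ⋯ ++ v_m :: g_m = l`. -/
def chainSum (h : α → List α → β) (F : List β → M) : List α → M
  | [] => F []
  | a :: l => gapSum h (fun g L => F (h a g :: L)) l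

theorem splitSum_congr {f f' : List α → List α → M} {l : List α}
    (H : ∀ g r, g ++ r = l → f g r = f' g r) : splitSum f l = splitSum f' l := by
  induction l generalizing f f' with
  | nil => exact H [] [] rfl
  | cons a l ih =>
    simp only [splitSum]
    rw [H [] (a :: l) rfl, ih fun g r e => H (a :: g) r (by simp [e])]

theorem pivotSum_congr {f f' : List α → α → List α → M} {l : List α}
    (H : ∀ g a r, g ++ a :: r = l → f g a r = f' g a r) : pivotSum f l = pivotSum f' l := by
  induction l generalizing f f' with
  | nil => rfl
  | cons a l ih =>
    simp only [pivotSum]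
    rw [H [] a l rfl, ih fun g b r e => H (a :: g) b r (by simp [e])]

theorem splitSum_add (f f' : List α → List α → M) (l : List α) :
    splitSum (fun g r => f g r + f' g r) l = splitSum f l + splitSum f' l := by
  induction l generalizing f f' with
  | nil => rfl
  | cons a l ih => simp only [splitSum, ih]; abel

theorem pivotSum_add (f f' : List α → α → List α → M) (l : List α) :
    pivotSum (fun g a r => f g a r + f' g a r) l = pivotSum f l + pivotSum f' l := by
  induction l generalizing f f' with
  | nil => simp [pivotSum]
  | cons a l ih => simp only [pivotSum, ih]; abel

theorem gapSum_add (h : α → List α → β) (G G' : List α → List β → M) (l : List α) :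
    gapSum h (fun g L => G g L + G' g L) l = gapSum h G l + gapSum h G' l := by
  induction l generalizing G G' with
  | nil => rfl
  | cons a l ih =>
    simp only [gapSum, ← ih]
    congr 1
    funext g L
    abel

theorem map_splitSum (φ : M →+ N) (f : List α → List α → M) (l : List α) :
    φ (splitSum f l) = splitSum (fun g r => φ (f g r)) l := by
  induction l generalizing f with
  | nil => rfl
  | cons a l ih => simp only [splitSum, map_add, ih]

theorem map_gapSum (φ : M →+ N) (h : α → List α → β) (G : List α → List β → M) (l : List α) :
    φ (gapSum h G l) = gapSum h (fun g L => φ (G g L)) l := by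
  induction l generalizing G with
  | nil => rfl
  | cons a l ih => simp only [gapSum, map_add, ih]

theorem map_chainSum (φ : M →+ N) (h : α → List α → β) (F : List β → M) (l : List α) :
    φ (chainSum h F l) = chainSum h (fun L => φ (F L)) l := by
  cases l with
  | nil => rfl
  | cons a l => exact map_gapSum φ h _ l

theorem chainSum_add (h : α → List α → β) (F F' : List β → M) (l : List α) :
    chainSum h (fun L => F L + F' L) l = chainSum h F l + chainSum h F' l := by
  cases l with
  | nil => rfl
  | cons a l => exact gapSum_add h _ _ l

theorem splitSum_eq_zero {f : List α → List α → M} {l : List α}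
    (H : ∀ g r, g ++ r = l → f g r = 0) : splitSum f l = 0 := by
  induction l generalizing f with
  | nil => exact H [] [] rfl
  | cons a l ih =>
    simp only [splitSum]
    rw [H [] (a :: l) rfl, ih fun g r e => H (a :: g) r (by simp [e]), add_zero]

theorem splitSum_assoc (f : List α → List α → List α → M) (l : List α) :
    splitSum (fun g r => splitSum (fun u v => f g u v) r) l =
      splitSum (fun r v => splitSum (fun g u => f g u v) r) l := by
  induction l generalizing f with
  | nil => rfl
  | cons a l ih =>
    simp only [splitSum, ih, splitSum_add]
    abel

theorem splitSum_pivotSum (f : List α → List α → α → List α → M) (l : List α) :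
    splitSum (fun g r => pivotSum (f g) r) l =
      pivotSum (fun u a r => splitSum (fun g v => f g v a r) u) l := by
  induction l generalizing f with
  | nil => rfl
  | cons a l ih =>
    simp only [splitSum, pivotSum, pivotSum_add]
    rw [ih fun g => f (a :: g)]
    abel

theorem splitSum_ite_left (f : List α → List α → M) (l : List α) :
    splitSum (fun g r => if g = [] then 0 else f g r) l + f [] l = splitSum f l := by
  cases l with
  | nil => simp [splitSum]
  | cons a l => simp [splitSum, add_comm]

theorem splitSum_ite_right (f : List α → M) (l : List α) :
    splitSum (fun g r => if r = [] then f g else 0) l = f l := by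
  induction l generalizing f with
  | nil => simp [splitSum]
  | cons a l ih => simpa [splitSum] using ih fun g => f (a :: g)

theorem splitSum_append_singleton (f : List α → List α → M) (l : List α) (z : α) :
    splitSum f (l ++ [z]) = splitSum (fun g r => f g (r ++ [z])) l + f (l ++ [z]) [] := by
  induction l generalizing f with
  | nil => simp [splitSum]
  | cons a l ih => simp only [List.cons_append, splitSum, ih]; abel

theorem gapSum_congr {h : α → List α → β} {G G' : List α → List β → M} {l : List α}
    (p : α → Prop) (q : β → Prop) (hl : ∀ a ∈ l, p a)
    (hpq : ∀ a g, p a → (∀ x ∈ g, p x) → q (h a g))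
    (H : ∀ g L, (∀ a ∈ g, p a) → (∀ b ∈ L, q b) → G g L = G' g L) :
    gapSum h G l = gapSum h G' l := by
  induction l generalizing G G' with
  | nil => exact H [] [] (by simp) (by simp)
  | cons a l ih =>
    simp only [List.forall_mem_cons] at hl
    refine ih hl.2 fun g L hg hL => ?_
    rw [H (a :: g) L (by simpa using ⟨hl.1, hg⟩) hL,
      H [] (h a g :: L) (by simp) (by simpa using ⟨hpq a g hl.1 hg, hL⟩)]

theorem gapSum_map (f : γ → α) (h : α → List α → β) (G : List α → List β → M) (l : List γ) :
    gapSum h G (l.map f) =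
      gapSum (fun a g => h (f a) (g.map f)) (fun g L => G (g.map f) L) l := by
  induction l generalizing G with
  | nil => rfl
  | cons a l ih => simp only [List.map_cons, gapSum, ih]; rfl

theorem chainSum_map (f : γ → α) (h : α → List α → β) (F : List β → M) (l : List γ) :
    chainSum h F (l.map f) = chainSum (fun a g => h (f a) (g.map f)) F l := by
  cases l with
  | nil => rfl
  | cons a l => simp only [List.map_cons, chainSum, gapSum_map]

theorem gapSum_comp (k : β → γ) (h : α → List α → β) (G : List α → List γ → M) (l : List α) :
    gapSum h (fun g L => G g (L.map k)) l = gapSum (fun a g => k (h a g)) G l := by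
  induction l generalizing G with
  | nil => rfl
  | cons a l ih =>
    simp only [gapSum]
    exact ih fun g L => G (a :: g) L + G [] (k (h a g) :: L)

theorem chainSum_comp (k : β → γ) (h : α → List α → β) (F : List γ → M) (l : List α) :
    chainSum h (fun L => F (L.map k)) l = chainSum (fun a g => k (h a g)) F l := by
  cases l with
  | nil => rfl
  | cons a l =>
    simp only [chainSum, List.map_cons]
    exact gapSum_comp k h (fun g L => F (k (h a g) :: L)) l

/-- Fix the first gap: the rest is empty or begins with the first chosen letter, so it carries a
chain. -/
theorem gapSum_eq_splitSum (h : α → List α → β) (G : List α → List β → M) (l : List α) :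
    gapSum h G l = splitSum (fun g r => chainSum h (G g) r) l := by
  induction l generalizing G with
  | nil => rfl
  | cons a l ih =>
    simp only [gapSum, splitSum, gapSum_add, chainSum.eq_2]
    rw [ih, add_comm]

theorem chainSum_cons (h : α → List α → β) (F : List β → M) (a : α) (l : List α) :
    chainSum h F (a :: l) = splitSum (fun g r => chainSum h (fun L => F (h a g :: L)) r) l :=
  gapSum_eq_splitSum h _ l

theorem gapSum_splitSum_gap (h : α → List α → β) (H : List α → List α → List β → M)
    (l : List α) :
    gapSum h (fun g L => splitSum (fun u v => H u v L) g) l =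
      splitSum (fun u v => gapSum h (fun g L => H u g L) v) l := by
  have e : ∀ g r, chainSum h (fun L => splitSum (fun u v => H u v L) g) r =
      splitSum (fun u v => chainSum h (H u v) r) g := by
    intro g r
    induction g generalizing H with
    | nil => rfl
    | cons a g ih => simp only [splitSum, chainSum_add, ih]
  simp only [gapSum_eq_splitSum, e]
  exact (splitSum_assoc (fun u v r => chainSum h (H u v) r) l).symm

/-- A cut of the list of chosen letters lifts to a cut of the word in front of the first chosen
letter of the second piece, or at the end of the word if that piece is empty. -/
theorem gapSum_splitSum (d : α → List α → β) (H : List α → List β → List β → M) (l : List α) :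
    gapSum d (fun g L => splitSum (H g) L) l =
      splitSum (fun g r => gapSum d (fun g' L => chainSum d (H g' L) r) g) l := by
  induction l generalizing H with
  | nil => rfl
  | cons a l ih =>
    simp only [gapSum, splitSum, gapSum_add, splitSum_add]
    rw [ih fun g => H (a :: g), ih fun g L L' => H [] (d a g :: L) L']
    simp only [chainSum]
    abel

theorem chainSum_pivotSum (d : α → List α → β) (H : List β → β → List β → M) (l : List α) :
    chainSum d (pivotSum H) l =
      pivotSum (fun g a r =>
        chainSum d (fun L => gapSum d (fun g' L' => H L (d a g') L') r) g) l := by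
  have key : ∀ (H : List α → List β → β → List β → M) (l : List α),
      gapSum d (fun g L => pivotSum (H g) L) l =
        pivotSum (fun g a r =>
          gapSum d (fun g' L => gapSum d (fun g'' L' => H g' L (d a g'') L') r) g) l := by
    intro H l
    induction l generalizing H with
    | nil => rfl
    | cons a l ih =>
      simp only [gapSum, pivotSum, gapSum_add, pivotSum_add]
      rw [ih fun g => H (a :: g), ih fun g L b L' => H [] (d a g :: L) b L']
      abel
  cases l with
  | nil => rfl
  | cons a l =>
    simp only [chainSum, pivotSum, gapSum_add]
    rw [key fun g L b L' => H (d a g :: L) b L']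

/-- The only chain as long as the word takes every letter and leaves every gap empty. The predicates
`p` and `q` restrict the vanishing hypothesis to the letters that can occur. -/
theorem gapSum_of_short {h : α → List α → β} {G : List α → List β → M} {l : List α}
    (p : α → Prop) (q : β → Prop) (hl : ∀ a ∈ l, p a)
    (hpq : ∀ a g, p a → (∀ x ∈ g, p x) → q (h a g))
    (H : ∀ g L, (∀ a ∈ g, p a) → (∀ b ∈ L, q b) → L.length < l.length → G g L = 0) :
    gapSum h G l = G [] (l.map fun a => h a []) := by
  induction l generalizing G with
  | nil => rfl
  | cons a l ih =>
    simp only [List.forall_mem_cons] at hl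
    simp only [gapSum, List.map_cons]
    rw [ih hl.2, H [a], zero_add]
    · simpa using hl.1
    · simp only [List.mem_map]
      rintro _ ⟨x, hx, rfl⟩
      exact hpq x [] (hl.2 x hx) (by simp)
    · simp
    · intro g L hg hL hlt
      rw [H (a :: g) L (by simpa using ⟨hl.1, hg⟩) hL (hlt.trans (by simp)),
        H [] (h a g :: L) (by simp) (by simpa using ⟨hpq a g hl.1 hg, hL⟩) (by simpa using hlt),
        add_zero]

/-- Every gap is strictly shorter than the word; this makes the first-block expansion a recursion on
the length. -/
theorem chainSum_congr_length {h h' : α → List α → β} (F : List β → M) {l : List α}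
    (H : ∀ a g, g.length < l.length → h a g = h' a g) :
    chainSum h F l = chainSum h' F l := by
  induction hn : l.length using Nat.strong_induction_on generalizing l F with
  | _ n ih =>
    cases l with
    | nil => rfl
    | cons a l =>
      rw [chainSum_cons, chainSum_cons]
      refine splitSum_congr fun g r e => ?_
      have hl : l.length = g.length + r.length := by rw [← e, List.length_append]
      rw [H a g (by simp; omega)]
      exact ih r.length (by simp at hn; omega) _
        (fun b g' hg' => H b g' (by simp; omega)) rfl

theorem chainSum_of_short {h : α → List α → β} {F : List β → M} {l : List α}
    (p : α → Prop) (q : β → Prop) (hl : ∀ a ∈ l, p a)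
    (hpq : ∀ a g, p a → (∀ x ∈ g, p x) → q (h a g))
    (H : ∀ L, L ≠ [] → (∀ b ∈ L, q b) → L.length < l.length → F L = 0) :
    chainSum h F l = F (l.map fun a => h a []) := by
  cases l with
  | nil => rfl
  | cons a l =>
    simp only [List.forall_mem_cons] at hl
    refine gapSum_of_short p q hl.2 hpq fun g L hg hL hlt => ?_
    exact H _ (by simp) (by simpa using ⟨hpq a g hl.1 hg, hL⟩) (by simpa using hlt)

end AddCommMonoid

/-- `F` is additive in each letter. -/
def ListAdditive [AddCommMonoid β] [AddCommMonoid M] (F : List β → M) : Prop :=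
  ∀ u a b v, F (u ++ (a + b) :: v) = F (u ++ a :: v) + F (u ++ b :: v)

theorem ListAdditive.cons [AddCommMonoid β] [AddCommMonoid M] {F : List β → M}
    (hF : ListAdditive F) (a : β) : ListAdditive fun L => F (a :: L) :=
  fun u x y v => hF (a :: u) x y v

theorem ListAdditive.append_right [AddCommMonoid β] [AddCommMonoid M] {F : List β → M}
    (hF : ListAdditive F) (w : List β) : ListAdditive fun L => F (L ++ w) := by
  intro u x y v
  simpa using hF u x y (v ++ w)

/-- The dependence of `F (a :: L)` on `a`. -/
def ListAdditive.headHom [AddCommGroup β] [AddCommGroup M] {F : List β → M}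
    (hF : ListAdditive F) (L : List β) : β →+ M :=
  AddMonoidHom.mk' (fun a => F (a :: L)) fun a b => hF [] a b L

/-- The dependence of the sum of `F (a :: L)` over the chains `L` in `r` on `a`. -/
def ListAdditive.headChainHom [AddCommGroup β] [AddCommGroup M] {F : List β → M}
    (hF : ListAdditive F) (h : α → List α → β) (r : List α) : β →+ M :=
  AddMonoidHom.mk' (fun a => chainSum h (fun L => F (a :: L)) r) fun a b => by
    rw [← chainSum_add]
    congr 1
    funext L
    exact hF [] a b L

/-- Iterated chains: if each gap factor `h₁ a g` is itself a sum over chains inside the gap, then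
the outer and the inner chains together form one finer chain, from which the outer one is recovered
as a subchain. This regroups a sum by a coarser connectivity. -/
theorem chainSum_eq_chainSum_chainSum [AddCommGroup γ] [AddCommGroup M] {F : List γ → M}
    (hF : ListAdditive F) (d : α → List α → β) (h₂ : β → List β → γ) {h₁ : α → List α → γ}
    {l : List α} (p : α → Prop) (hl : ∀ a ∈ l, p a)
    (h₁_eq : ∀ a g, p a → (∀ x ∈ g, p x) → g.length < l.length →
      h₁ a g = gapSum d (fun g' L => h₂ (d a g') L) g) :
    chainSum h₁ F l = chainSum d (chainSum h₂ F) l := by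
  induction hn : l.length using Nat.strong_induction_on generalizing l F with
  | _ n ih =>
    cases l with
    | nil => rfl
    | cons a l =>
      rw [chainSum_cons]
      simp only [chainSum.eq_2 d, chainSum_cons h₂]
      rw [gapSum_splitSum d fun g L r => chainSum h₂ (fun L' => F (h₂ (d a g) L :: L')) r]
      refine splitSum_congr fun g r e => ?_
      have hlen : l.length = g.length + r.length := by rw [← e, List.length_append]
      simp only [List.length_cons] at hn h₁_eq
      rw [List.forall_mem_cons, ← e, List.forall_mem_append] at hl
      have h1 := h₁_eq a g hl.1 hl.2.1 (by omega)
      -- Additivity of `F` in its first letter pulls the sum hidden in `h₁ a g` outside.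
      have h2 := map_gapSum (hF.headChainHom h₁ r) d (fun g' L => h₂ (d a g') L) g
      rw [← h1] at h2
      refine h2.trans ?_
      congr 1
      funext g' L
      exact ih r.length (by omega) (hF.cons _) hl.2.2
        (fun b g'' hb hg'' hg => h₁_eq b g'' hb hg'' (by omega)) rfl

/-- Inversion of the moment-cumulant relation, by induction on the length: in the difference of the
two chain sums all proper chains cancel, and the full chain, with empty gaps, is the word itself. -/
theorem eq_of_chainSum_eq [AddCommGroup M] {h : α → List α → α} {F F' : List α → M}
    (p : α → Prop) (hp : ∀ a g, p a → (∀ x ∈ g, p x) → p (h a g)) (h_nil : ∀ a, p a → h a [] = a)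
    (H : ∀ l, l ≠ [] → (∀ a ∈ l, p a) → chainSum h F l = chainSum h F' l) {l : List α}
    (hl : l ≠ []) (hpl : ∀ a ∈ l, p a) : F l = F' l := by
  induction hn : l.length using Nat.strong_induction_on generalizing l with
  | _ n ih =>
    have e := chainSum_of_short (F := fun L => F L - F' L) p p hpl hp fun L hL hpL hlt =>
      sub_eq_zero.mpr (ih _ (hn ▸ hlt) hL hpL rfl)
    have e1 : l.map (fun a => h a []) = l := by
      conv_rhs => rw [← List.map_id l]
      exact List.map_congr_left fun a ha => h_nil a (hpl a ha)
    have e2 := chainSum_add h (fun L => F L - F' L) F' l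
    simp only [sub_add_cancel] at e2
    rw [H l hl hpl, right_eq_add] at e2
    rw [e1, e2] at e
    exact (sub_eq_zero.mp e.symm)

theorem mul_chainSum {R : Type*} [NonUnitalNonAssocSemiring R] (b : R) (h : α → List α → β)
    (F : List β → R) (l : List α) :
    b * chainSum h F l = chainSum h (fun L => b * F L) l :=
  map_chainSum (AddMonoidHom.mulLeft b) h F l

theorem sum_antidiagonal_take_drop [AddCommMonoid M] (f : List α → List α → M) (l : List α) :
    ∑ q ∈ Finset.HasAntidiagonal.antidiagonal l.length, f (l.take q.1) (l.drop q.1) =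
      splitSum f l := by
  induction l generalizing f with
  | nil => simp [splitSum]
  | cons a l ih =>
    rw [List.length_cons, Finset.Nat.sum_antidiagonal_succ]
    simp only [List.take_zero, List.drop_zero, List.take_succ_cons, List.drop_succ_cons, splitSum]
    rw [ih fun g r => f (a :: g) r]

end ListSums

/-! ### Noncrossing partitions as binary trees -/

section TreeSums

open BinaryTree Finset.HasAntidiagonal

theorem sum_treesOfNumNodesEq_succ {M : Type*} [AddCommMonoid M] (n : ℕ)
    (f : BinaryTree Unit → M) :
    ∑ t ∈ treesOfNumNodesEq (n + 1), f t =
      ∑ q ∈ antidiagonal n, ∑ t₁ ∈ treesOfNumNodesEq q.1, ∑ t₂ ∈ treesOfNumNodesEq q.2,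
        f (node () t₁ t₂) := by
  rw [treesOfNumNodesEq_succ, Finset.sum_biUnion]
  · refine Finset.sum_congr rfl fun q _ => ?_
    rw [← Finset.sum_product', BinaryTree.pairwiseNode, Finset.sum_map]
    rfl
  · intro q _ q' _ hqq'
    simp only [Function.onFun]
    rw [Finset.disjoint_left]
    rintro t h h'
    simp only [pairwiseNode, Finset.mem_map, Finset.mem_product, mem_treesOfNumNodesEq] at h h'
    obtain ⟨a, ⟨ha1, ha2⟩, rfl⟩ := h
    obtain ⟨b, ⟨hb1, hb2⟩, hb⟩ := h'
    have hb' : node () b.1 b.2 = node () a.1 a.2 := hb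
    simp only [node.injEq, true_and] at hb'
    exact hqq' (Prod.ext (by rw [← ha1, ← hb1, hb'.1]) (by rw [← ha2, ← hb2, hb'.2]))

/-- The cut at the end of the word does not occur because `q.1 ≤ n`, so the right piece always has a
head. -/
theorem sum_antidiagonal_pivot {α M : Type*} [AddCommMonoid M] (f : List α → List α → M)
    {n : ℕ} {l : List α} (hl : l.length = n + 1) :
    ∑ q ∈ antidiagonal n, f (l.take q.1) (l.drop q.1) =
      pivotSum (fun u a r => f u (a :: r)) l := by
  induction n generalizing f l with
  | zero =>
    obtain ⟨a, rfl⟩ := List.length_eq_one_iff.mp hl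
    simp [pivotSum]
  | succ n ih =>
    cases l with
    | nil => simp at hl
    | cons a l =>
      rw [Finset.Nat.sum_antidiagonal_succ]
      simp only [List.take_zero, List.drop_zero, List.take_succ_cons, List.drop_succ_cons,
        pivotSum]
      rw [ih (fun g r => f (a :: g) r) (by simpa using hl)]

variable {A B : Type*} [Ring A] [Algebra ℂ A] [Ring B] [Algebra ℂ B]

/-- The arguments of the outermost block: for the partition described by the tree `t`, each letter
of the first block is multiplied by the value of `g` on the gap that follows it, and the list
continues with the arguments of the outer block of the last gap. -/
def outerLetters (ι : B → A) (g : List A → B) : BinaryTree Unit → List A → List A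
  | nil, _ => []
  | node _ _ _, [] => []
  | node _ t₁ t₂, a :: l =>
      a * ι (g (outerLetters ι g t₁ (l.take t₁.numNodes))) ::
        outerLetters ι g t₂ (l.drop t₁.numNodes)

/-- The sum of `g` over all noncrossing partitions of a word. -/
def treeSum (ι : B → A) (g F : List A → B) (l : List A) : B :=
  ∑ t ∈ treesOfNumNodesEq l.length, F (outerLetters ι g t l)

/-- A node separates the partition of the first gap from that of the rest, and these vary
independently. Additivity of `F` lets the sum over the first subtree enter the letter in front of
the gap. -/
theorem treeSum_eq_chainSum (ι : B →ₐ[ℂ] A) (g : List A → B) {F : List A → B}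
    (hF : ListAdditive F) (l : List A) :
    treeSum ι g F l = chainSum (fun a w => a * ι (treeSum ι g g w)) F l := by
  induction hn : l.length using Nat.strong_induction_on generalizing l F with
  | _ n ih =>
    cases l with
    | nil => simp [treeSum, chainSum, outerLetters]
    | cons a l =>
      rw [chainSum_cons, ← sum_antidiagonal_take_drop, treeSum, List.length_cons,
        sum_treesOfNumNodesEq_succ]
      refine Finset.sum_congr rfl fun q hq => ?_
      rw [Finset.HasAntidiagonal.mem_antidiagonal] at hq
      have h1 : (l.take q.1).length = q.1 := by simp; omega
      have h2 : (l.drop q.1).length = q.2 := by simp; omega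
      simp only [List.length_cons] at hn
      rw [← ih q.2 (by omega) (hF.cons _) (l.drop q.1) h2]
      rw [Finset.sum_comm]
      simp only [treeSum, h1, h2]
      refine Finset.sum_congr rfl fun t₂ _ => ?_
      rw [map_sum, Finset.mul_sum]
      refine Eq.trans ?_ (map_sum (hF.headHom _) _ _).symm
      refine Finset.sum_congr rfl fun t₁ ht₁ => ?_
      rw [mem_treesOfNumNodesEq] at ht₁
      simp only [outerLetters, ht₁]
      rfl

/-- The tree of the word `y₀ x₁ y₁ ⋯ x_n y_n` when the `x`'s and the `y`'s are partitioned by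
complementary noncrossing partitions and the first and the last letter lie in one block. -/
def doubledTree : BinaryTree Unit → BinaryTree Unit
  | nil => node () nil nil
  | node _ t₁ t₂ => node () (doubledTree t₁) (doubledTree t₂)

/-- The trees of the words `x₁ y₁ ⋯ x_n y_n` when the `x`'s and the `y`'s are partitioned by
complementary noncrossing partitions. -/
def krewerasTree : BinaryTree Unit → BinaryTree Unit
  | nil => nil
  | node _ t₁ t₂ => node () (doubledTree t₁) (krewerasTree t₂)

theorem numNodes_doubledTree (t : BinaryTree Unit) :
    (doubledTree t).numNodes = 2 * t.numNodes + 1 := by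
  induction t with
  | nil => rfl
  | node _ t₁ t₂ h₁ h₂ => simp only [doubledTree, numNodes, h₁, h₂]; ring

theorem numNodes_krewerasTree (t : BinaryTree Unit) :
    (krewerasTree t).numNodes = 2 * t.numNodes := by
  induction t with
  | nil => rfl
  | node _ t₁ t₂ h₁ h₂ => simp only [krewerasTree, numNodes, h₂, numNodes_doubledTree]; ring

/-- The word `x₁ y₁ ⋯ x_n y_n`. -/
def interleave {α : Type*} (w : List (α × α)) : List α := w.flatMap fun q => [q.1, q.2]

@[simp] theorem interleave_nil {α : Type*} : interleave ([] : List (α × α)) = [] := rfl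

@[simp] theorem interleave_cons {α : Type*} (v : α × α) (w : List (α × α)) :
    interleave (v :: w) = v.1 :: v.2 :: interleave w := rfl

@[simp] theorem interleave_append {α : Type*} (u w : List (α × α)) :
    interleave (u ++ w) = interleave u ++ interleave w := by simp [interleave]

@[simp] theorem length_interleave {α : Type*} (w : List (α × α)) :
    (interleave w).length = 2 * w.length := by
  induction w with
  | nil => rfl
  | cons v w ih => simp [ih]; ring

/-- The sum over the complementary partitions of `y x₁ y₁ ⋯ x_n y_n` with `y` and `y_n` in one
block. -/
def doubledSumLeft (ι : B → A) (g F : List A → B) (y : A) (w : List (A × A)) : B :=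
  ∑ t ∈ treesOfNumNodesEq w.length, F (outerLetters ι g (doubledTree t) (y :: interleave w))

/-- The sum over the complementary partitions of `x₁ y₁ ⋯ x_n y_n x` with `x₁` and `x` in one
block. -/
def doubledSumRight (ι : B → A) (g F : List A → B) (w : List (A × A)) (x : A) : B :=
  ∑ t ∈ treesOfNumNodesEq w.length, F (outerLetters ι g (doubledTree t) (interleave w ++ [x]))

/-- The sum over the complementary partitions of `x₁ y₁ ⋯ x_n y_n`. -/
def krewerasSum (ι : B → A) (g F : List A → B) (w : List (A × A)) : B :=
  ∑ t ∈ treesOfNumNodesEq w.length, F (outerLetters ι g (krewerasTree t) (interleave w))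

theorem doubledSumLeft_nil (ι : B →ₐ[ℂ] A) {g : List A → B} (hg : g [] = 1) (F : List A → B)
    (y : A) : doubledSumLeft ι g F y [] = F [y] := by
  simp [doubledSumLeft, doubledTree, outerLetters, hg]

/-- Since `w` is nonempty, the block of `y` has a next letter `v.2`. The gap before it is a word
from an `x` to an `x` with both ends in one block, which is what `doubledSumRight` sums over. -/
theorem doubledSumLeft_cons (ι : B →ₐ[ℂ] A) (g : List A → B) {F : List A → B}
    (hF : ListAdditive F) (y : A) {w : List (A × A)} (hw : w ≠ []) :
    doubledSumLeft ι g F y w =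
      pivotSum (fun u v r =>
        doubledSumLeft ι g (fun L => F (y * ι (doubledSumRight ι g g u v.1) :: L)) v.2 r) w := by
  obtain ⟨n, hn⟩ := Nat.exists_eq_succ_of_ne_zero (mt List.length_eq_zero_iff.mp hw)
  have key := sum_antidiagonal_pivot (fun u s => match s with
    | [] => 0
    | v :: r => doubledSumLeft ι g (fun L => F (y * ι (doubledSumRight ι g g u v.1) :: L)) v.2 r)
    hn
  rw [← key, doubledSumLeft, hn, sum_treesOfNumNodesEq_succ]
  refine Finset.sum_congr rfl fun q hq => ?_
  rw [Finset.HasAntidiagonal.mem_antidiagonal] at hq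
  have h1 : (w.take q.1).length = q.1 := by simp; omega
  have h2 : (w.drop q.1).length = q.2 + 1 := by simp; omega
  obtain ⟨u, hu⟩ : ∃ u, w.take q.1 = u := ⟨_, rfl⟩
  obtain ⟨s, hs⟩ : ∃ s, w.drop q.1 = s := ⟨_, rfl⟩
  have e : w = u ++ s := by rw [← hu, ← hs, List.take_append_drop]
  rw [hu] at h1
  rw [hs] at h2
  rw [hu, hs]
  cases s with
  | nil => simp at h2
  | cons v r =>
    simp only [List.length_cons, add_left_inj] at h2
    simp only [doubledSumLeft, doubledSumRight, h1, h2]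
    rw [Finset.sum_comm]
    refine Finset.sum_congr rfl fun t₂ _ => ?_
    rw [map_sum, Finset.mul_sum]
    refine Eq.trans ?_ (map_sum (hF.headHom _) _ _).symm
    refine Finset.sum_congr rfl fun t₁ ht₁ => ?_
    rw [mem_treesOfNumNodesEq] at ht₁
    have e1 : (interleave w).take (doubledTree t₁).numNodes = interleave u ++ [v.1] := by
      rw [e, numNodes_doubledTree, ht₁, interleave_append, interleave_cons, ← h1,
        ← length_interleave, List.take_length_add_append]
      rfl
    have e2 : (interleave w).drop (doubledTree t₁).numNodes = v.2 :: interleave r := by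
      rw [e, numNodes_doubledTree, ht₁, interleave_append, interleave_cons, ← h1,
        ← length_interleave, List.drop_length_add_append]
      rfl
    simp only [doubledTree, outerLetters, e1, e2]
    rfl

/-- One induction for `doubledTree` with `z = [x]` and for `krewerasTree` with `z = []`. It runs
along the block of the first `x`; each gap between pairs begins and ends with a `y`, and `hz` treats
the end of the word. -/
theorem sum_outerLetters_pairs (ι : B →ₐ[ℂ] A) (g : List A → B) {F : List A → B}
    (hF : ListAdditive F) (K : BinaryTree Unit → BinaryTree Unit)
    (hK : ∀ t₁ t₂, K (node () t₁ t₂) = node () (doubledTree t₁) (K t₂)) (z : List A)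
    (hz : ∀ F : List A → B, F (outerLetters ι g (K nil) z) = F z) (w : List (A × A)) :
    ∑ t ∈ treesOfNumNodesEq w.length, F (outerLetters ι g (K t) (interleave w ++ z)) =
      chainSum (fun v u => v.1 * ι (doubledSumLeft ι g g v.2 u)) (fun L => F (L ++ z)) w := by
  induction hn : w.length using Nat.strong_induction_on generalizing w F with
  | _ n ih =>
    cases w with
    | nil => simp [← hn, chainSum, hz]
    | cons v w =>
      rw [List.length_cons] at hn
      rw [chainSum_cons, ← sum_antidiagonal_take_drop, ← hn, sum_treesOfNumNodesEq_succ]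
      refine Finset.sum_congr rfl fun q hq => ?_
      rw [Finset.HasAntidiagonal.mem_antidiagonal] at hq
      have h1 : (w.take q.1).length = q.1 := by simp; omega
      have h2 : (w.drop q.1).length = q.2 := by simp; omega
      obtain ⟨u, hu⟩ : ∃ u, w.take q.1 = u := ⟨_, rfl⟩
      obtain ⟨s, hs⟩ : ∃ s, w.drop q.1 = s := ⟨_, rfl⟩
      have e : w = u ++ s := by rw [← hu, ← hs, List.take_append_drop]
      rw [hu] at h1
      rw [hs] at h2
      rw [hu, hs]
      refine Eq.trans ?_ (ih q.2 (by omega) (hF.cons _) s h2)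
      rw [Finset.sum_comm]
      refine Finset.sum_congr rfl fun t₂ _ => ?_
      rw [doubledSumLeft, h1, map_sum, Finset.mul_sum]
      refine Eq.trans ?_ (map_sum (hF.headHom _) _ _).symm
      refine Finset.sum_congr rfl fun t₁ ht₁ => ?_
      rw [mem_treesOfNumNodesEq] at ht₁
      have e0 : v.2 :: interleave w ++ z = (v.2 :: interleave u) ++ (interleave s ++ z) := by
        simp [e]
      have e3 : (doubledTree t₁).numNodes = (v.2 :: interleave u).length := by
        simp [numNodes_doubledTree, ht₁, h1]
      have e1 : (v.2 :: interleave w ++ z).take (doubledTree t₁).numNodes =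
          v.2 :: interleave u := by rw [e0, e3, List.take_left]
      have e2 : (v.2 :: interleave w ++ z).drop (doubledTree t₁).numNodes =
          interleave s ++ z := by rw [e0, e3, List.drop_left]
      rw [hK, interleave_cons]
      simp only [List.cons_append] at e1 e2 ⊢
      simp only [outerLetters, e1, e2]
      rfl

theorem doubledSumRight_eq_chainSum (ι : B →ₐ[ℂ] A) {g : List A → B} (hg : g [] = 1)
    {F : List A → B} (hF : ListAdditive F) (w : List (A × A)) (x : A) :
    doubledSumRight ι g F w x =
      chainSum (fun v u => v.1 * ι (doubledSumLeft ι g g v.2 u)) (fun L => F (L ++ [x])) w :=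
  sum_outerLetters_pairs ι g hF doubledTree (fun _ _ => rfl) [x]
    (fun F => by simp [doubledTree, outerLetters, hg]) w

theorem krewerasSum_eq_chainSum (ι : B →ₐ[ℂ] A) (g : List A → B) {F : List A → B}
    (hF : ListAdditive F) (w : List (A × A)) :
    krewerasSum ι g F w =
      chainSum (fun v u => v.1 * ι (doubledSumLeft ι g g v.2 u)) F w := by
  have := sum_outerLetters_pairs ι g hF krewerasTree (fun _ _ => rfl) []
    (fun F => by simp [krewerasTree, outerLetters]) w
  simpa [krewerasSum] using this

end TreeSums

/-! ### Trees of words of block names -/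

section LabelTree

open BinaryTree

/-- The binary tree of a word of block names: the left subtree describes the gap between the first
letter and the next letter of its block, the right one the rest of the word. -/
def labelTree {κ : Type*} [DecidableEq κ] : List κ → BinaryTree Unit
  | [] => nil
  | k :: l => node () (labelTree (l.takeWhile (· ≠ k))) (labelTree (l.dropWhile (· ≠ k)))
  termination_by l => l.length
  decreasing_by
    · exact Nat.lt_succ_of_le (List.takeWhile_prefix _).length_le
    · exact Nat.lt_succ_of_le (List.dropWhile_suffix _).length_le

section

variable {κ : Type*}

/-- No two different names occur in the crossing pattern `a b a b`. -/
def NoncrossingList (l : List κ) : Prop := ∀ a b, [a, b, a, b].Sublist l → a = b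

theorem NoncrossingList.sublist {l l' : List κ} (h : NoncrossingList l) (hl : l'.Sublist l) :
    NoncrossingList l' := fun a b hab => h a b (hab.trans hl)

theorem NoncrossingList.disjoint {k : κ} {g r : List κ} (h : NoncrossingList (k :: (g ++ k :: r)))
    (hg : k ∉ g) {x : κ} (hx : x ∈ g) : x ∉ k :: r := by
  intro hx'
  rcases List.mem_cons.mp hx' with rfl | hx'
  · exact hg hx
  · have : [k, x, k, x].Sublist (k :: (g ++ k :: r)) := by
      refine List.Sublist.cons_cons k ?_
      exact List.Sublist.append (List.singleton_sublist.mpr hx)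
        (List.Sublist.cons_cons k (List.singleton_sublist.mpr hx'))
    exact hg (h k x this ▸ hx)

theorem noncrossingList_ofFn {n : ℕ} (c : Fin n → κ) :
    NoncrossingList (List.ofFn c) ↔ ∀ i j k l : Fin n, i < j → j < k → k < l →
      c i = c k → c j = c l → c i = c j := by
  constructor
  · intro h i j k l hij hjk hkl hik hjl
    refine h _ _ ?_
    have e : [c i, c j, c i, c j] = [i, j, k, l].map c := by simp [hik, hjl]
    rw [e, List.ofFn_eq_map]
    refine List.Sublist.map c (List.sublist_of_subperm_of_sortedLE (List.subperm_of_subset ?_ ?_)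
      ?_ (List.sortedLT_finRange n).sortedLE)
    · simp [hij.ne, hjk.ne, hkl.ne, (hij.trans hjk).ne, (hjk.trans hkl).ne,
        (hij.trans (hjk.trans hkl)).ne]
    · intro x _
      exact List.mem_finRange x
    · refine List.Pairwise.sortedLE ?_
      simp [hij.le, hjk.le, hkl.le, (hij.trans hjk).le, (hjk.trans hkl).le,
        (hij.trans (hjk.trans hkl)).le]
  · intro h a b hab
    obtain ⟨f, hf⟩ := List.sublist_iff_exists_fin_orderEmbedding_get_eq.mp hab
    have hlt : ∀ i j, i < j → f i < f j := fun i j hij => f.lt_iff_lt.mpr hij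
    simp only [List.get_ofFn] at hf
    have h0 := hf ⟨0, by simp⟩
    have h1 := hf ⟨1, by simp⟩
    have h2 := hf ⟨2, by simp⟩
    have h3 := hf ⟨3, by simp⟩
    simp only [List.get_eq_getElem, List.getElem_cons_zero, List.getElem_cons_succ] at h0 h1 h2 h3
    rw [h0, h1]
    refine h _ _ _ _ (hlt ⟨0, by simp⟩ ⟨1, by simp⟩ (by simp))
      (hlt ⟨1, by simp⟩ ⟨2, by simp⟩ (by simp))
      (hlt ⟨2, by simp⟩ ⟨3, by simp⟩ (by simp)) (h0.symm.trans h2) (h1.symm.trans h3)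

end

section

variable {κ κ' : Type*} [DecidableEq κ] [DecidableEq κ']

theorem labelTree_nil : labelTree ([] : List κ) = nil := by rw [labelTree]

theorem labelTree_cons_of_not_mem {k : κ} {l : List κ} (h : k ∉ l) :
    labelTree (k :: l) = node () (labelTree l) nil := by
  have h1 : l.takeWhile (· ≠ k) = l :=
    List.takeWhile_eq_self_iff.mpr fun x hx => by simpa using fun e : x = k => h (e ▸ hx)
  have h2 : l.dropWhile (· ≠ k) = [] :=
    List.dropWhile_eq_nil_iff.mpr fun x hx => by simpa using fun e : x = k => h (e ▸ hx)
  rw [labelTree, h1, h2, labelTree_nil]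

theorem labelTree_cons_append {k : κ} {g : List κ} (r : List κ) (h : k ∉ g) :
    labelTree (k :: (g ++ k :: r)) = node () (labelTree g) (labelTree (k :: r)) := by
  have h1 : (g ++ k :: r).takeWhile (· ≠ k) = g := by
    rw [List.takeWhile_append_of_pos fun x hx => by simpa using fun e : x = k => h (e ▸ hx)]
    simp
  have h2 : (g ++ k :: r).dropWhile (· ≠ k) = k :: r := by
    rw [List.dropWhile_append_of_pos fun x hx => by simpa using fun e : x = k => h (e ▸ hx)]
    simp
  rw [labelTree, h1, h2]

theorem numNodes_labelTree (l : List κ) : (labelTree l).numNodes = l.length := by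
  induction hn : l.length using Nat.strong_induction_on generalizing l with
  | _ n ih =>
    cases l with
    | nil => simpa [labelTree_nil] using hn
    | cons k l =>
      rw [List.length_cons] at hn
      by_cases h : k ∈ l
      · obtain ⟨g, r, rfl, hg⟩ := List.eq_append_cons_of_mem h
        simp only [List.length_append, List.length_cons] at hn
        rw [labelTree_cons_append r hg, numNodes, ih _ (by omega) g rfl,
          ih _ (by rw [List.length_cons]; omega) (k :: r) rfl, List.length_cons]
        omega
      · rw [labelTree_cons_of_not_mem h, numNodes, ih _ (by omega) l rfl]
        simpa using hn

theorem exists_first_label {α : Type*} (k : κ) (l : List (κ × α)) (h : k ∈ l.map Prod.fst) :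
    ∃ g a r, l = g ++ (k, a) :: r ∧ k ∉ g.map Prod.fst := by
  induction l with
  | nil => simp at h
  | cons x l ih =>
    by_cases hx : k = x.1
    · exact ⟨[], x.2, l, by simp [hx], by simp⟩
    · obtain ⟨g, a, r, rfl, hg⟩ := ih (by simpa [hx] using h)
      exact ⟨x :: g, a, r, rfl, by simpa [hx] using hg⟩

theorem labelTree_congr (w : List (κ × κ')) (h : ∀ p ∈ w, ∀ q ∈ w, p.1 = q.1 ↔ p.2 = q.2) :
    labelTree (w.map Prod.fst) = labelTree (w.map Prod.snd) := by
  induction hn : w.length using Nat.strong_induction_on generalizing w with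
  | _ n ih =>
    cases w with
    | nil => simp [labelTree_nil]
    | cons p w =>
      rw [List.length_cons] at hn
      simp only [List.map_cons]
      by_cases hp : p.1 ∈ w.map Prod.fst
      · obtain ⟨g, a, r, rfl, hg⟩ := exists_first_label _ _ hp
        have ha : p.2 = a := (h p (by simp) (p.1, a) (by simp)).mp rfl
        have hg' : p.2 ∉ g.map Prod.snd := by
          simp only [List.mem_map, not_exists, not_and] at hg ⊢
          intro q hq e
          exact hg q hq ((h q (by simp [hq]) p (by simp)).mpr e)
        simp only [List.length_append, List.length_cons] at hn
        have h1 := ih _ (by omega) g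
          (fun q hq q' hq' => h q (by simp [hq]) q' (by simp [hq'])) rfl
        have h2 := ih _ (by rw [List.length_cons]; omega) ((p.1, a) :: r)
          (fun q hq q' hq' => h q (List.mem_cons_of_mem _ (List.mem_append_right _ hq)) q'
            (List.mem_cons_of_mem _ (List.mem_append_right _ hq'))) rfl
        simp only [List.map_append, List.map_cons] at h2 ⊢
        rw [← ha] at h2 ⊢
        rw [labelTree_cons_append _ hg, labelTree_cons_append _ hg', h1, h2]
      · have hp' : p.2 ∉ w.map Prod.snd := by
          simp only [List.mem_map, not_exists, not_and] at hp ⊢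
          intro q hq e
          exact hp q hq ((h q (by simp [hq]) p (by simp)).mpr e)
        rw [labelTree_cons_of_not_mem hp, labelTree_cons_of_not_mem hp',
          ih _ (by omega) w (fun q hq q' hq' => h q (by simp [hq]) q' (by simp [hq'])) rfl]

theorem labelTree_map {f : κ → κ'} (hf : Function.Injective f) (l : List κ) :
    labelTree (l.map f) = labelTree l := by
  have := labelTree_congr (l.map fun x => (x, f x)) (by
    simp only [List.mem_map]
    rintro _ ⟨x, -, rfl⟩ _ ⟨y, -, rfl⟩
    exact hf.eq_iff.symm)
  simpa [Function.comp_def] using this.symm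

/-- The tree records the first gap and the rest separately and forgets whether they share a name.
Noncrossing words never do (`NoncrossingList.disjoint`), so for them the tree determines which
letters have equal names. -/
theorem eq_iff_of_labelTree_eq (w : List (κ × κ')) (h₁ : NoncrossingList (w.map Prod.fst))
    (h₂ : NoncrossingList (w.map Prod.snd))
    (h : labelTree (w.map Prod.fst) = labelTree (w.map Prod.snd)) :
    ∀ p ∈ w, ∀ q ∈ w, p.1 = q.1 ↔ p.2 = q.2 := by
  induction hn : w.length using Nat.strong_induction_on generalizing w with
  | _ n ih =>
    cases w with
    | nil => simp
    | cons p w =>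
      rw [List.length_cons] at hn
      simp only [List.map_cons] at h h₁ h₂
      by_cases hp : p.1 ∈ w.map Prod.fst
      · obtain ⟨g, a, r, rfl, hg⟩ := exists_first_label _ _ hp
        by_cases hp' : p.2 ∈ ((g ++ (p.1, a) :: r).map Prod.swap).map Prod.fst
        · obtain ⟨g', a', r', e, hg'⟩ := exists_first_label _ _ hp'
          have e' : g ++ (p.1, a) :: r = g'.map Prod.swap ++ (a', p.2) :: r'.map Prod.swap := by
            have := congrArg (List.map Prod.swap) e
            simpa using this
          have hg'' : p.2 ∉ (g'.map Prod.swap).map Prod.snd := by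
            simpa [Function.comp_def] using hg'
          -- The left subtree has as many nodes as the gap has letters, so the two first gaps end at
          -- the same position.
          have hlen : g.length = (g'.map Prod.swap).length := by
            have h3 := h
            conv_rhs at h3 => rw [e']
            simp only [List.map_append, List.map_cons] at h3
            rw [labelTree_cons_append _ hg, labelTree_cons_append _ hg''] at h3
            have h4 := congrArg numNodes (node.inj h3).2.1
            simpa [numNodes_labelTree] using h4
          obtain ⟨e1, e2⟩ := List.append_inj e' hlen
          obtain ⟨e2, -⟩ := List.cons_eq_cons.mp e2
          obtain rfl : a = p.2 := (Prod.mk.inj e2).2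
          rw [← e1] at hg''
          simp only [List.map_append, List.map_cons] at h h₁ h₂
          rw [labelTree_cons_append _ hg, labelTree_cons_append _ hg''] at h
          simp only [List.length_append, List.length_cons] at hn
          have i1 := ih _ (by omega) g
            (h₁.sublist ((List.sublist_append_left _ _).trans (List.sublist_cons_self _ _)))
            (h₂.sublist ((List.sublist_append_left _ _).trans (List.sublist_cons_self _ _)))
            (node.inj h).2.1 rfl
          have i2 := ih _ (by rw [List.length_cons]; omega) ((p.1, p.2) :: r)
            (h₁.sublist ((List.sublist_append_right _ _).trans (List.sublist_cons_self _ _)))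
            (h₂.sublist ((List.sublist_append_right _ _).trans (List.sublist_cons_self _ _)))
            (node.inj h).2.2 rfl
          have d1 : ∀ x ∈ g, ∀ y ∈ (p.1, p.2) :: r, x.1 ≠ y.1 := by
            intro x hx y hy exy
            refine h₁.disjoint hg (List.mem_map_of_mem hx) ?_
            have := List.mem_map_of_mem (f := Prod.fst) hy
            rw [exy]
            simpa using this
          have d2 : ∀ x ∈ g, ∀ y ∈ (p.1, p.2) :: r, x.2 ≠ y.2 := by
            intro x hx y hy exy
            refine h₂.disjoint hg'' (List.mem_map_of_mem hx) ?_
            have := List.mem_map_of_mem (f := Prod.snd) hy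
            rw [exy]
            simpa using this
          have hmem : ∀ x ∈ p :: (g ++ (p.1, p.2) :: r), x ∈ g ∨ x ∈ (p.1, p.2) :: r := by
            intro x hx
            simp only [List.mem_cons, List.mem_append] at hx ⊢
            tauto
          intro x hx y hy
          rcases hmem x hx with hx | hx <;> rcases hmem y hy with hy | hy
          · exact i1 x hx y hy
          · exact iff_of_false (d1 x hx y hy) (d2 x hx y hy)
          · exact iff_of_false (d1 y hy x hx).symm (d2 y hy x hx).symm
          · exact i2 x hx y hy
        · have hp'' : p.2 ∉ (g ++ (p.1, a) :: r).map Prod.snd := by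
            simpa [Function.comp_def] using hp'
          rw [labelTree_cons_of_not_mem hp''] at h
          simp only [List.map_append, List.map_cons] at h
          rw [labelTree_cons_append _ hg, labelTree] at h
          simp at h
      · by_cases hp' : p.2 ∈ w.map Prod.snd
        · obtain ⟨g, r, e, hg⟩ := List.eq_append_cons_of_mem hp'
          rw [e, labelTree_cons_of_not_mem hp, labelTree_cons_append _ hg,
            labelTree.eq_2 p.2] at h
          simp at h
        · rw [labelTree_cons_of_not_mem hp, labelTree_cons_of_not_mem hp'] at h
          have i1 := ih _ (by omega) w (h₁.sublist (List.sublist_cons_self _ _))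
            (h₂.sublist (List.sublist_cons_self _ _)) (node.inj h).2.1 rfl
          simp only [List.mem_map, not_exists, not_and] at hp hp'
          intro x hx y hy
          rcases List.mem_cons.mp hx with rfl | hx' <;> rcases List.mem_cons.mp hy with rfl | hy'
          · simp
          · exact iff_of_false (fun e => hp y hy' e.symm) (fun e => hp' y hy' e.symm)
          · exact iff_of_false (hp x hx') (hp' x hx')
          · exact i1 x hx' y hy'

end

end LabelTree

/-! ### The bijection between noncrossing partitions and binary trees -/

section NCTrees

open BinaryTree

/-- A word of block names of the noncrossing partition described by a binary tree. -/
def treeLabels : BinaryTree Unit → List ℕ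
  | nil => []
  | node _ t₁ t₂ =>
      -- Odd names are fresh for the gap, while doubling fixes `0`, so that the right part continues
      -- block `0`.
      0 :: ((treeLabels t₁).map (fun x => 2 * x + 1) ++ (treeLabels t₂).map fun x => 2 * x)

theorem length_treeLabels (t : BinaryTree Unit) : (treeLabels t).length = t.numNodes := by
  induction t with
  | nil => rfl
  | node _ t₁ t₂ h₁ h₂ => simp [treeLabels, numNodes, h₁, h₂]

theorem treeLabels_eq_cons {t : BinaryTree Unit} (ht : t ≠ nil) :
    ∃ r, treeLabels t = 0 :: r := by
  cases t with
  | nil => exact absurd rfl ht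
  | node _ t₁ t₂ => exact ⟨_, rfl⟩

theorem labelTree_treeLabels (t : BinaryTree Unit) : labelTree (treeLabels t) = t := by
  induction t with
  | nil => exact labelTree_nil
  | node _ t₁ t₂ h₁ h₂ =>
    have i1 : Function.Injective fun x : ℕ => 2 * x + 1 := fun x y h => by simpa using h
    have i2 : Function.Injective fun x : ℕ => 2 * x := fun x y h => by simpa using h
    have h0 : 0 ∉ (treeLabels t₁).map fun x => 2 * x + 1 := by simp
    by_cases ht : t₂ = nil
    · subst ht
      rw [treeLabels, treeLabels.eq_1, List.map_nil, List.append_nil,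
        labelTree_cons_of_not_mem h0, labelTree_map i1, h₁]
    · obtain ⟨r, hr⟩ := treeLabels_eq_cons ht
      have e := labelTree_map i2 (treeLabels t₂)
      rw [h₂, hr, List.map_cons, mul_zero] at e
      rw [treeLabels, hr, List.map_cons, mul_zero, labelTree_cons_append _ h0, labelTree_map i1,
        h₁, e]

theorem NoncrossingList.map {κ κ' : Type*} {f : κ → κ'} (hf : Function.Injective f) {l : List κ}
    (h : NoncrossingList l) : NoncrossingList (l.map f) := by
  intro a b hab
  obtain ⟨l', hl', e⟩ := List.sublist_map_iff.mp hab
  rcases l' with _ | ⟨x, _ | ⟨y, _ | ⟨z, _ | ⟨w, _ | _⟩⟩⟩⟩ <;>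
    simp only [List.map_cons, List.map_nil, List.cons.injEq, and_true, reduceCtorEq,
      and_false] at e
  obtain ⟨rfl, rfl, h3, h4⟩ := e
  rw [← hf h3, ← hf h4] at hl'
  rw [h _ _ hl']

theorem NoncrossingList.cons_append {κ : Type*} {k : κ} {g r : List κ} (hg : NoncrossingList g)
    (hr : NoncrossingList r) (hk : k ∉ g) (hkr : r = [] ∨ ∃ r', r = k :: r')
    (hd : ∀ x ∈ g, x ∉ r) : NoncrossingList (k :: (g ++ r)) := by
  have key : ∀ a b, [a, b, a, b].Sublist (g ++ r) → a = b := by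
    intro a b h
    obtain ⟨u, v, e, hu, hv⟩ := List.sublist_append_iff.mp h
    have hmem : ∀ x, x ∈ u → x ∈ v → False := fun x h1 h2 => hd x (hu.subset h1) (hv.subset h2)
    match u, e with
    | [], e => exact hr a b (by simpa [e] using hv)
    | [x], e =>
      simp only [List.cons_append, List.nil_append, List.cons.injEq] at e
      obtain ⟨rfl, rfl⟩ := e
      exact (hmem a (by simp) (by simp)).elim
    | [x, y], e =>
      simp only [List.cons_append, List.nil_append, List.cons.injEq] at e
      obtain ⟨rfl, rfl, rfl⟩ := e
      exact (hmem a (by simp) (by simp)).elim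
    | [x, y, z], e =>
      simp only [List.cons_append, List.nil_append, List.cons.injEq] at e
      obtain ⟨rfl, rfl, rfl, rfl⟩ := e
      exact (hmem b (by simp) (by simp)).elim
    | x :: y :: z :: w :: u, e =>
      simp only [List.cons_append, List.cons.injEq, List.nil_eq, List.append_eq_nil_iff] at e
      obtain ⟨rfl, rfl, rfl, rfl, rfl, rfl⟩ := e
      exact hg _ _ hu
  intro a b h
  rcases List.sublist_cons_iff.mp h with h | ⟨s, e, h⟩
  · exact key a b h
  · simp only [List.cons.injEq] at e
    obtain ⟨rfl, rfl⟩ := e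
    by_contra hab
    rcases hkr with rfl | ⟨r', rfl⟩
    · rw [List.append_nil] at h
      exact hk (h.subset (by simp))
    · obtain ⟨u, v, e, hu, hv⟩ := List.sublist_append_iff.mp h
      match u, e with
      | [], e =>
        simp only [List.nil_append] at e
        rw [← e] at hv
        rcases List.sublist_cons_iff.mp hv with hv | ⟨s, e', hv⟩
        · exact hab (hr a b (List.Sublist.cons_cons a hv))
        · simp only [List.cons.injEq] at e'
          exact hab e'.1.symm
      | [x], e =>
        simp only [List.cons_append, List.nil_append, List.cons.injEq] at e
        obtain ⟨rfl, rfl⟩ := e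
        exact hd b (hu.subset (by simp)) (hv.subset (by simp))
      | x :: y :: u, e =>
        simp only [List.cons_append, List.cons.injEq] at e
        obtain ⟨rfl, rfl, e⟩ := e
        exact hk (hu.subset (by simp))

theorem noncrossingList_treeLabels (t : BinaryTree Unit) : NoncrossingList (treeLabels t) := by
  induction t with
  | nil => intro a b h; simp [treeLabels] at h
  | node _ t₁ t₂ h₁ h₂ =>
    have i1 : Function.Injective fun x : ℕ => 2 * x + 1 := fun x y h => by simpa using h
    have i2 : Function.Injective fun x : ℕ => 2 * x := fun x y h => by simpa using h
    refine (h₁.map i1).cons_append (h₂.map i2) (by simp) ?_ ?_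
    · by_cases ht : t₂ = nil
      · exact Or.inl (by rw [ht]; rfl)
      · obtain ⟨r, hr⟩ := treeLabels_eq_cons ht
        exact Or.inr ⟨r.map fun x => 2 * x, by rw [hr, List.map_cons, mul_zero]⟩
    · simp only [List.mem_map]
      rintro _ ⟨x, -, rfl⟩ ⟨y, -, h⟩
      omega

theorem Finpartition.eq_of_part_eq_iff {n : ℕ}
    {π σ : Finpartition (Finset.univ : Finset (Fin n))}
    (h : ∀ i j, π.part i = π.part j ↔ σ.part i = σ.part j) : π = σ := by
  have hp : ∀ i, π.part i = σ.part i := by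
    intro i
    ext j
    rw [π.mem_part_iff_part_eq_part (Finset.mem_univ _) (Finset.mem_univ _),
      σ.mem_part_iff_part_eq_part (Finset.mem_univ _) (Finset.mem_univ _)]
    exact h j i
  have hsub : ∀ {π σ : Finpartition (Finset.univ : Finset (Fin n))},
      (∀ i, π.part i = σ.part i) → π.parts ⊆ σ.parts := by
    intro π σ h s hs
    obtain ⟨i, hi⟩ := π.nonempty_of_mem_parts hs
    rw [← π.part_eq_of_mem hs hi, h i]
    exact σ.part_mem.mpr (Finset.mem_univ i)
  exact Finpartition.ext (Finset.Subset.antisymm (hsub hp) (hsub fun i => (hp i).symm))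

/-- The tree of a partition. -/
def partitionTree {n : ℕ} (π : Finpartition (Finset.univ : Finset (Fin n))) : BinaryTree Unit :=
  labelTree (List.ofFn π.part)

theorem mem_NC {n : ℕ} {π : Finpartition (Finset.univ : Finset (Fin n))} :
    π ∈ NC n ↔ NoncrossingList (List.ofFn π.part) := by
  rw [noncrossingList_ofFn, NC, Finset.mem_filter]
  simp [IsNoncrossing]

theorem partitionTree_mem {n : ℕ} (π : Finpartition (Finset.univ : Finset (Fin n))) :
    partitionTree π ∈ treesOfNumNodesEq n := by
  simp [partitionTree, numNodes_labelTree]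

theorem partitionTree_injOn (n : ℕ) :
    Set.InjOn (partitionTree (n := n)) (NC n : Set (Finpartition Finset.univ)) := by
  intro π hπ σ hσ h
  rw [Finset.mem_coe, mem_NC] at hπ hσ
  refine Finpartition.eq_of_part_eq_iff fun i j => ?_
  have := eq_iff_of_labelTree_eq (List.ofFn fun i => (π.part i, σ.part i))
    (by simpa [List.map_ofFn, Function.comp_def] using hπ)
    (by simpa [List.map_ofFn, Function.comp_def] using hσ)
    (by simpa [List.map_ofFn, Function.comp_def, partitionTree] using h)
  exact this _ (List.mem_ofFn.mpr ⟨i, rfl⟩) _ (List.mem_ofFn.mpr ⟨j, rfl⟩)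

theorem partitionTree_surjOn {n : ℕ} {t : BinaryTree Unit} (ht : t ∈ treesOfNumNodesEq n) :
    ∃ π ∈ NC n, partitionTree π = t := by
  rw [mem_treesOfNumNodesEq] at ht
  subst ht
  have hn := length_treeLabels t
  obtain ⟨c, hc⟩ : ∃ c : Fin t.numNodes → ℕ, List.ofFn c = treeLabels t := by
    rw [← hn]
    exact ⟨_, List.ofFn_get _⟩
  have : DecidableRel ⇑(Setoid.ker c) := fun _ _ => Classical.dec _
  let π : Finpartition (Finset.univ : Finset (Fin t.numNodes)) :=
    Finpartition.ofSetoid (Setoid.ker c)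
  have hπ : ∀ i j, π.part i = π.part j ↔ c i = c j := by
    intro i j
    rw [← π.mem_part_iff_part_eq_part (Finset.mem_univ _) (Finset.mem_univ _),
      Finpartition.mem_part_ofSetoid_iff_rel]
    exact ⟨fun h => Eq.symm h, fun h => Eq.symm h⟩
  refine ⟨π, ?_, ?_⟩
  · rw [mem_NC, noncrossingList_ofFn]
    simp only [hπ]
    rw [← noncrossingList_ofFn, hc]
    exact noncrossingList_treeLabels t
  · have := labelTree_congr (List.ofFn fun i => (π.part i, c i)) (by
      intro p hp q hq
      obtain ⟨i, rfl⟩ := List.mem_ofFn.mp hp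
      obtain ⟨j, rfl⟩ := List.mem_ofFn.mp hq
      exact hπ i j)
    simp only [List.map_ofFn, Function.comp_def] at this
    rw [partitionTree, this]
    exact (congrArg labelTree hc).trans (labelTree_treeLabels t)

theorem sum_NC_eq_sum_trees {M : Type*} [AddCommMonoid M] (n : ℕ) (f : BinaryTree Unit → M) :
    ∑ π ∈ NC n, f (partitionTree π) = ∑ t ∈ treesOfNumNodesEq n, f t :=
  Finset.sum_bij (fun π _ => partitionTree π) (fun π _ => partitionTree_mem π)
    (fun _ h _ h' e => partitionTree_injOn n h h' e)
    (fun _ ht => let ⟨π, hπ, e⟩ := partitionTree_surjOn ht; ⟨π, hπ, e⟩) fun _ _ => rfl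

theorem card_NC (n : ℕ) : (NC n).card = (treesOfNumNodesEq n).card := by
  rw [Finset.card_eq_sum_ones, Finset.card_eq_sum_ones]
  exact sum_NC_eq_sum_trees n fun _ => 1

/-! ### Multiplicative functions evaluated along trees -/

section NestedEval

/-- The function `f` with the value at the empty word replaced by `1`. -/
def withUnit {A B : Type*} [One B] (f : List A → B) (l : List A) : B := if l = [] then 1 else f l

theorem withUnit_nil {A B : Type*} [One B] (f : List A → B) : withUnit f [] = 1 := if_pos rfl

theorem withUnit_of_ne_nil {A B : Type*} [One B] (f : List A → B) {l : List A} (hl : l ≠ []) :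
    withUnit f l = f l :=
  if_neg hl

variable {A B κ : Type*} [Ring A] [Ring B] [DecidableEq κ]

/-- Splitting a word at the name of its first letter is the recursion of `labelTree`. The correction
`withUnit` is needed because `nestedEval` is `1` on the empty word, whatever `f []` is. -/
theorem nestedEval_eq (ι : B → A) (f : List A → B) (l : List (κ × A)) :
    nestedEval ι f l = withUnit f (outerLetters ι (withUnit f) (labelTree (l.map Prod.fst))
      (l.map Prod.snd)) := by
  induction hn : l.length using Nat.strong_induction_on generalizing l with
  | _ n ih =>
    cases l with
    | nil => simp [nestedEval, labelTree_nil, outerLetters, withUnit]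
    | cons p l =>
      obtain ⟨k, a⟩ := p
      rw [List.length_cons] at hn
      -- Two inductions: the inner one walks along the block of `k`, the outer one evaluates the
      -- gaps.
      have key : ∀ (l : List (κ × A)) (a : A), l.length < n →
          List.zipWith (fun c β => c * ι β)
            (a :: (l.filter (fun q => q.1 = k)).map Prod.snd)
            ((l.splitOnP (fun q => q.1 = k)).map (nestedEval ι f)) =
          outerLetters ι (withUnit f) (labelTree (k :: l.map Prod.fst))
            (a :: l.map Prod.snd) := by
        intro l
        induction hm : l.length using Nat.strong_induction_on generalizing l with
        | _ m ihm =>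
          intro a hl
          by_cases h : k ∈ l.map Prod.fst
          · obtain ⟨g, b, r, rfl, hg⟩ := exists_first_label _ _ h
            have hg' : ∀ x ∈ g, ¬ x.1 = k := fun x hx e => hg (e ▸ List.mem_map_of_mem hx)
            rw [List.splitOnP_append_cons_of_forall_mem (by simpa using hg') _ (by simp),
              List.filter_append, List.filter_eq_nil_iff.mpr (by simpa using hg')]
            rw [List.length_append, List.length_cons] at hm
            simp only [List.nil_append, List.map_cons, List.filter_cons, decide_true, if_true,
              List.zipWith_cons_cons, List.map_append]
            rw [labelTree_cons_append _ hg, outerLetters, numNodes_labelTree, List.length_map]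
            have e1 : (g.map Prod.snd ++ b :: r.map Prod.snd).take g.length =
                g.map Prod.snd := by simp
            have e2 : (g.map Prod.snd ++ b :: r.map Prod.snd).drop g.length =
                b :: r.map Prod.snd := by simp
            rw [e1, e2, ih _ (by omega) g rfl,
              ← ihm r.length (by omega) r rfl b (by omega)]
          · have hg' : ∀ x ∈ l, ¬ x.1 = k := fun x hx e => h (e ▸ List.mem_map_of_mem hx)
            rw [List.splitOnP_eq_singleton (by simpa using hg'),
              List.filter_eq_nil_iff.mpr (by simpa using hg'), labelTree_cons_of_not_mem h,
              outerLetters, numNodes_labelTree, List.length_map]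
            have e1 : (l.map Prod.snd).take l.length = l.map Prod.snd := by simp
            simp only [List.map_cons, List.map_nil, List.zipWith_cons_cons, List.zipWith_nil_left,
              e1, outerLetters]
            rw [ih m hl l hm]
      rw [nestedEval]
      simp only [List.map_cons]
      rw [← key l a (by omega)]
      rw [withUnit_of_ne_nil]
      · congr 2
        exact List.attach_map_val
      · cases hs : l.splitOnP (fun q => q.1 = k) with
        | nil => exact absurd hs (List.splitOnP_ne_nil _ _)
        | cons u v => simp

theorem sum_nestedEval_blockWord (ι : B → A) (f : List A → B) (l : List A) :
    ∑ π ∈ NC l.length, nestedEval ι f (blockWord l π) =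
      treeSum ι (withUnit f) (withUnit f) l := by
  rw [treeSum, ← sum_NC_eq_sum_trees]
  refine Finset.sum_congr rfl fun π _ => ?_
  rw [nestedEval_eq, blockWord, List.map_ofFn, List.map_ofFn]
  simp only [Function.comp_def, List.ofFn_get]
  rfl

end NestedEval

end NCTrees

/-! ### Trees of the alternating unions `π ∪ Kr(π)` -/

section Kreweras

open BinaryTree

/-- A segment of a word of block names between two letters of one block is described by a doubled
tree if in every gap of a block the first and the last letter lie in one block. -/
theorem exists_doubledTree {κ : Type*} [DecidableEq κ] (c : ℕ → κ) {N : ℕ}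
    (h : ∀ i j, i < j → j ≤ N → c i = c j → (∀ m, i < m → m < j → c m ≠ c i) →
      i + 1 ≤ j - 1 ∧ c (i + 1) = c (j - 1))
    {i j : ℕ} (hij : i ≤ j) (hj : j ≤ N) (hc : c i = c j) :
    ∃ t, labelTree ((List.range' i (j - i + 1)).map c) = doubledTree t := by
  induction hn : j - i using Nat.strong_induction_on generalizing i j with
  | _ n ih =>
    subst hn
    rcases hij.eq_or_lt with rfl | hij
    · refine ⟨nil, ?_⟩
      simp only [Nat.sub_self, Nat.zero_add, List.range'_one, List.map_cons, List.map_nil]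
      rw [labelTree_cons_of_not_mem (by simp), labelTree_nil, doubledTree]
    · have hex : ∃ m, i < m ∧ c m = c i := ⟨j, hij, hc.symm⟩
      classical
      obtain ⟨him, hm⟩ := Nat.find_spec hex
      have hmj : Nat.find hex ≤ j := Nat.find_min' hex ⟨hij, hc.symm⟩
      have hmin : ∀ m, i < m → m < Nat.find hex → c m ≠ c i :=
        fun m h1 h2 h3 => Nat.find_min hex h2 ⟨h1, h3⟩
      generalize Nat.find hex = m at him hm hmj hmin
      obtain ⟨h1, h2⟩ := h i m him (hmj.trans hj) hm.symm hmin
      obtain ⟨t₁, ht₁⟩ := ih (m - 1 - (i + 1)) (by omega) h1 (by omega) h2 rfl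
      obtain ⟨t₂, ht₂⟩ := ih (j - m) (by omega) hmj hj (hm.trans hc) rfl
      refine ⟨node () t₁ t₂, ?_⟩
      have e : List.range' i (j - i + 1) =
          i :: (List.range' (i + 1) (m - 1 - (i + 1) + 1) ++ List.range' m (j - m + 1)) := by
        have e1 := List.range'_append_1 (s := i + 1) (m := m - 1 - (i + 1) + 1) (n := j - m + 1)
        rw [show i + 1 + (m - 1 - (i + 1) + 1) = m by omega] at e1
        rw [e1, List.range'_succ]
        congr 2
        omega
      rw [e, List.map_cons, List.map_append, List.range'_succ (s := m), List.map_cons, hm,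
        labelTree_cons_append, doubledTree, ← ht₁, ← ht₂, List.range'_succ (s := m),
        List.map_cons, hm]
      simp only [List.mem_map, List.mem_range'_1, not_exists, not_and]
      intro x hx
      exact hmin x (by omega) (by omega)

/-- The block of the first letter need not reach the end of the word; `h'` is the gap condition
behind its last letter. -/
theorem exists_krewerasTree {κ : Type*} [DecidableEq κ] (c : ℕ → κ) {N : ℕ}
    (h : ∀ i j, i < j → j ≤ N → c i = c j → (∀ m, i < m → m < j → c m ≠ c i) →
      i + 1 ≤ j - 1 ∧ c (i + 1) = c (j - 1))
    (h' : ∀ i, i ≤ N → c i = c 0 → (∀ m, i < m → m ≤ N → c m ≠ c 0) →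
      i + 1 ≤ N ∧ c (i + 1) = c N)
    {i : ℕ} (hi : i ≤ N) (hc : c i = c 0) :
    ∃ t, labelTree ((List.range' i (N - i + 1)).map c) = krewerasTree t := by
  induction hn : N - i using Nat.strong_induction_on generalizing i with
  | _ n ih =>
    subst hn
    by_cases hex : ∃ m, i < m ∧ m ≤ N ∧ c m = c 0
    · classical
      obtain ⟨him, hmN, hm⟩ := Nat.find_spec hex
      have hmin : ∀ m, i < m → m < Nat.find hex → c m ≠ c i := fun m h1 h2 h3 =>
        Nat.find_min hex h2 ⟨h1, h2.le.trans hmN, h3.trans hc⟩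
      generalize Nat.find hex = m at him hm hmN hmin
      obtain ⟨h1, h2⟩ := h i m him hmN (hc.trans hm.symm) hmin
      obtain ⟨t₁, ht₁⟩ := exists_doubledTree c h h1 (by omega) h2
      obtain ⟨t₂, ht₂⟩ := ih (N - m) (by omega) hmN hm rfl
      refine ⟨node () t₁ t₂, ?_⟩
      have e : List.range' i (N - i + 1) =
          i :: (List.range' (i + 1) (m - 1 - (i + 1) + 1) ++ List.range' m (N - m + 1)) := by
        have e1 := List.range'_append_1 (s := i + 1) (m := m - 1 - (i + 1) + 1) (n := N - m + 1)
        rw [show i + 1 + (m - 1 - (i + 1) + 1) = m by omega] at e1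
        rw [e1, List.range'_succ]
        congr 2
        omega
      have hm' : c m = c i := hm.trans hc.symm
      rw [e, List.map_cons, List.map_append, List.range'_succ (s := m), List.map_cons, hm',
        labelTree_cons_append, krewerasTree, ← ht₁, ← ht₂, List.range'_succ (s := m),
        List.map_cons, hm']
      simp only [List.mem_map, List.mem_range'_1, not_exists, not_and]
      intro x hx
      exact hmin x (by omega) (by omega)
    · push Not at hex
      obtain ⟨h1, h2⟩ := h' i hi hc hex
      obtain ⟨t₁, ht₁⟩ := exists_doubledTree c h h1 le_rfl h2
      refine ⟨node () t₁ nil, ?_⟩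
      rw [show N - i = N - (i + 1) + 1 by omega, List.range'_succ, List.map_cons,
        labelTree_cons_of_not_mem, ht₁, krewerasTree, krewerasTree]
      simp only [List.mem_map, List.mem_range'_1, not_exists, not_and]
      intro x hx
      rw [hc]
      exact hex x (by omega) (by omega)

variable {n : ℕ}

theorem part_kreweras_eq_iff (π : Finpartition (Finset.univ : Finset (Fin n))) (i j : Fin n) :
    (kreweras π).part i = (kreweras π).part j ↔
      ∀ u v : Fin n, π.part u = π.part v →
        ((min i j < u ∧ u ≤ max i j) ↔ (min i j < v ∧ v ≤ max i j)) := by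
  rw [← (kreweras π).mem_part_iff_part_eq_part (Finset.mem_univ _) (Finset.mem_univ _), kreweras,
    Finpartition.mem_part_ofSetoid_iff_rel]
  exact ⟨fun h => (krewerasSetoid π).symm' h, fun h => (krewerasSetoid π).symm' h⟩

theorem part_kreweras_eq_iff_of_le (π : Finpartition (Finset.univ : Finset (Fin n)))
    {i j : Fin n} (hij : i ≤ j) :
    (kreweras π).part i = (kreweras π).part j ↔
      ∀ u v : Fin n, π.part u = π.part v → i < u → u ≤ j → i < v ∧ v ≤ j := by
  rw [part_kreweras_eq_iff, min_eq_left hij, max_eq_right hij]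
  exact ⟨fun h u v e h1 h2 => (h u v e).mp ⟨h1, h2⟩,
    fun h u v e => ⟨fun hu => h u v e hu.1 hu.2, fun hv => h v u e.symm hv.1 hv.2⟩⟩

/-- The block names of the alternating union of `π` and its Kreweras complement. -/
def unionLabel (π : Finpartition (Finset.univ : Finset (Fin n))) (m : ℕ) :
    Finset (Fin n) ⊕ Finset (Fin n) :=
  if h : m / 2 < n then
    if m % 2 = 0 then Sum.inl (π.part ⟨m / 2, h⟩) else Sum.inr ((kreweras π).part ⟨m / 2, h⟩)
  else Sum.inl ∅

theorem unionLabel_even (π : Finpartition (Finset.univ : Finset (Fin n))) (i : Fin n) :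
    unionLabel π (2 * i) = Sum.inl (π.part i) := by
  have : 2 * (i : ℕ) / 2 = i := by omega
  simp [unionLabel]

theorem unionLabel_odd (π : Finpartition (Finset.univ : Finset (Fin n))) (i : Fin n) :
    unionLabel π (2 * i + 1) = Sum.inr ((kreweras π).part i) := by
  have h1 : (2 * (i : ℕ) + 1) / 2 = i := by omega
  have h2 : (2 * (i : ℕ) + 1) % 2 = 1 := by omega
  simp [unionLabel, h1, h2]

theorem exists_position {m : ℕ} (hm : m < 2 * n) :
    ∃ i : Fin n, m = 2 * i ∨ m = 2 * i + 1 :=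
  ⟨⟨m / 2, by omega⟩, by simp only; omega⟩

/-- The local characterization of `π ∪ Kr(π)`. For consecutive `x_a, x_b` of a block, the `x`'s
strictly between them form a union of blocks of `π`, which joins `y_a` to `y_{b-1}`. For consecutive
`y_a, y_b`, maximality of `Kr(π)` forces `x_{a+1}` and `x_b` into one block. -/
theorem unionLabel_gap {π : Finpartition (Finset.univ : Finset (Fin n))} (hπ : IsNoncrossing π)
    {i j : ℕ} (hij : i < j) (hj : j < 2 * n) (hc : unionLabel π i = unionLabel π j)
    (hm : ∀ m, i < m → m < j → unionLabel π m ≠ unionLabel π i) :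
    i + 1 ≤ j - 1 ∧ unionLabel π (i + 1) = unionLabel π (j - 1) := by
  obtain ⟨a, rfl | rfl⟩ := exists_position (hij.trans hj) <;>
    obtain ⟨b, rfl | rfl⟩ := exists_position hj
  · simp only [unionLabel_even, Sum.inl.injEq] at hc hm
    have hab : a < b := by rw [Fin.lt_def]; omega
    have hm' : ∀ c : Fin n, a < c → c < b → π.part c ≠ π.part a := by
      intro c h1 h2
      have := hm (2 * c) (by omega) (by omega)
      rw [unionLabel_even] at this
      simpa using this
    refine ⟨by omega, ?_⟩
    have e : 2 * (b : ℕ) - 1 = 2 * ((⟨b - 1, by omega⟩ : Fin n) : ℕ) + 1 := by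
      simp only
      omega
    rw [e, unionLabel_odd, unionLabel_odd, Sum.inr.injEq,
      part_kreweras_eq_iff_of_le _ (Fin.le_def.mpr (by simp only; omega))]
    intro u v huv h1 h2
    have hub : u < b := by
      rw [Fin.lt_def]
      rw [Fin.le_def] at h2
      simp only at h2
      omega
    have hua := hm' u h1 hub
    have hv : a < v ∧ v < b := by
      constructor
      · by_contra hva
        rcases (not_lt.mp hva).eq_or_lt with rfl | hva
        · exact hua huv
        · exact hua (huv.trans (hπ v a u b hva h1 hub huv.symm hc))
      · by_contra hvb
        rcases (not_lt.mp hvb).eq_or_lt with rfl | hvb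
        · exact hua (huv.trans hc.symm)
        · exact hua (hπ a u b v h1 hub hvb hc huv).symm
    refine ⟨hv.1, ?_⟩
    rw [Fin.le_def]
    simp only
    omega
  · rw [unionLabel_even, unionLabel_odd] at hc
    simp at hc
  · rw [unionLabel_even, unionLabel_odd] at hc
    simp at hc
  · simp only [unionLabel_odd, Sum.inr.injEq] at hc hm
    have hab : a < b := by rw [Fin.lt_def]; omega
    rw [part_kreweras_eq_iff_of_le _ hab.le] at hc
    have hm' : ∀ c : Fin n, a < c → c < b → (kreweras π).part c ≠ (kreweras π).part a := by
      intro c h1 h2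
      have := hm (2 * c + 1) (by omega) (by omega)
      rw [unionLabel_odd] at this
      simpa using this
    refine ⟨by omega, ?_⟩
    have ha' : (a : ℕ) + 1 < n := by omega
    obtain ⟨a', haa⟩ : ∃ a' : Fin n, (a' : ℕ) = a + 1 := ⟨⟨a + 1, ha'⟩, rfl⟩
    rw [show 2 * (a : ℕ) + 1 + 1 = 2 * (a' : ℕ) by omega, Nat.add_sub_cancel, unionLabel_even,
      unionLabel_even, Sum.inl.injEq]
    have hne : (Finset.univ.filter fun x : Fin n => π.part x = π.part a').Nonempty :=
      ⟨a', by simp⟩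
    -- `c` is the last element of the block of `x_{a+1}`. It is at most `b` because `y_a ∼ y_b`;
    -- were it smaller, `y_c` would be joined to `y_a` although no element of their block lies
    -- strictly between `y_a` and `y_b`.
    obtain ⟨c, hc1, hc2⟩ := Finset.exists_max_image _ (fun x => x) hne
    simp only [Finset.mem_filter, Finset.mem_univ, true_and] at hc1 hc2
    have hac := hc2 a' rfl
    have haa' : a < a' := by rw [Fin.lt_def]; omega
    have hcb := (hc a' c hc1.symm haa' (by rw [Fin.le_def]; omega)).2
    rcases hcb.eq_or_lt with rfl | hcb
    · exact hc1.symm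
    · refine absurd ?_ (hm' c (haa'.trans_le hac) hcb)
      refine Eq.symm ?_
      rw [part_kreweras_eq_iff_of_le _ (haa'.trans_le hac).le]
      intro u v huv h1 h2
      refine ⟨(hc u v huv h1 (h2.trans hcb.le)).1, ?_⟩
      by_contra hvc
      push Not at hvc
      by_cases hu : π.part u = π.part a'
      · exact absurd (hc2 v (huv.symm.trans hu)) (not_le.mpr hvc)
      · have h3 : a' < u := by
          rcases lt_or_eq_of_le (show a' ≤ u by rw [Fin.le_def]; omega) with h | h
          · exact h
          · exact absurd (by rw [h]) hu
        have h4 : u < c := by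
          rcases h2.lt_or_eq with h | h
          · exact h
          · exact absurd (by rw [h, hc1]) hu
        exact hu (hπ a' u c v h3 h4 hvc hc1.symm huv).symm

theorem unionLabel_last_gap {π : Finpartition (Finset.univ : Finset (Fin n))}
    (hπ : IsNoncrossing π) {i : ℕ} (hi : i < 2 * n) (hc : unionLabel π i = unionLabel π 0)
    (hm : ∀ m, i < m → m < 2 * n → unionLabel π m ≠ unionLabel π 0) :
    i + 1 < 2 * n ∧ unionLabel π (i + 1) = unionLabel π (2 * n - 1) := by
  have h0 : unionLabel π 0 = Sum.inl (π.part ⟨0, by omega⟩) :=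
    unionLabel_even π ⟨0, by omega⟩
  obtain ⟨a, rfl | rfl⟩ := exists_position hi
  · rw [h0] at hc hm
    rw [unionLabel_even, Sum.inl.injEq] at hc
    have hm' : ∀ c : Fin n, a < c → π.part c ≠ π.part a := by
      intro c h1
      have := hm (2 * c) (by omega) (by omega)
      rw [unionLabel_even, ← hc] at this
      simpa using this
    refine ⟨by omega, ?_⟩
    have e : 2 * n - 1 = 2 * ((⟨n - 1, by omega⟩ : Fin n) : ℕ) + 1 := by
      simp only
      omega
    rw [e, unionLabel_odd, unionLabel_odd, Sum.inr.injEq,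
      part_kreweras_eq_iff_of_le _ (Fin.le_def.mpr (by simp only; omega))]
    intro u v huv h1 _
    refine ⟨?_, Fin.le_def.mpr (by simp only; omega)⟩
    by_contra hva
    rcases (not_lt.mp hva).eq_or_lt with rfl | hva
    · exact hm' u h1 huv
    · rcases (Fin.le_def.mpr (Nat.zero_le _) : (⟨0, by omega⟩ : Fin n) ≤ v).eq_or_lt with h | h
      · exact hm' u h1 (huv.trans (by rw [← h, hc]))
      · exact hm' u h1 (huv.trans ((hπ _ v a u h hva h1 hc.symm huv.symm).symm.trans hc.symm))
  · rw [unionLabel_odd, h0] at hc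
    simp at hc

theorem unionLabel_noncrossing {π : Finpartition (Finset.univ : Finset (Fin n))}
    (hπ : IsNoncrossing π) {i j k l : ℕ} (hij : i < j) (hjk : j < k) (hkl : k < l)
    (hl : l < 2 * n) (hik : unionLabel π i = unionLabel π k)
    (hjl : unionLabel π j = unionLabel π l) : unionLabel π i = unionLabel π j := by
  obtain ⟨a, rfl | rfl⟩ := exists_position (n := n) (m := i) (by omega) <;>
    obtain ⟨b, rfl | rfl⟩ := exists_position (n := n) (m := j) (by omega) <;>
    obtain ⟨c, rfl | rfl⟩ := exists_position (n := n) (m := k) (by omega) <;>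
    obtain ⟨d, rfl | rfl⟩ := exists_position (n := n) (m := l) (by omega) <;>
    simp only [unionLabel_even, unionLabel_odd, Sum.inl.injEq, Sum.inr.injEq, reduceCtorEq]
      at hik hjl ⊢
  · exact hπ a b c d (by omega) (by omega) (by omega) hik hjl
  · rw [part_kreweras_eq_iff_of_le _ (by omega)] at hjl
    have := hjl c a hik.symm (by omega) (by omega)
    omega
  · rw [part_kreweras_eq_iff_of_le _ (by omega)] at hik
    have := hik b d hjl (by omega) (by omega)
    omega
  · rw [part_kreweras_eq_iff_of_le _ (by omega)] at hik hjl ⊢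
    intro u v huv h1 h2
    have h3 := hik u v huv h1 (by omega)
    refine ⟨h3.1, ?_⟩
    by_contra hv
    have := hjl v u huv.symm (by omega) (by omega)
    omega

/-- The tree of the alternating union of `π` and its Kreweras complement. -/
def unionTree (π : Finpartition (Finset.univ : Finset (Fin n))) : BinaryTree Unit :=
  labelTree ((List.range (2 * n)).map (unionLabel π))

theorem exists_unionTree_eq {π : Finpartition (Finset.univ : Finset (Fin n))}
    (hπ : IsNoncrossing π) : ∃ t ∈ treesOfNumNodesEq n, krewerasTree t = unionTree π := by
  rcases Nat.eq_zero_or_pos n with rfl | hn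
  · exact ⟨nil, by simp, by simp [unionTree, labelTree_nil, krewerasTree]⟩
  · obtain ⟨t, ht⟩ := exists_krewerasTree (unionLabel π) (N := 2 * n - 1)
      (fun i j hij hj hc hm => unionLabel_gap hπ hij (by omega) hc hm)
      (fun i hi hc hm => by
        have := unionLabel_last_gap hπ (i := i) (by omega) hc
          (fun m h1 h2 => hm m h1 (by omega))
        exact ⟨by omega, this.2⟩)
      (Nat.zero_le _) rfl
    have e : unionTree π = krewerasTree t := by
      rw [← ht, unionTree, List.range_eq_range']
      congr 3
      omega
    refine ⟨t, ?_, e.symm⟩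
    have h1 := congrArg numNodes e
    rw [unionTree, numNodes_labelTree, numNodes_krewerasTree] at h1
    rw [mem_treesOfNumNodesEq]
    simpa using h1.symm

/-- The union is noncrossing, hence determined by its tree, and its even positions give back `π`. -/
theorem unionTree_injOn (n : ℕ) :
    Set.InjOn (unionTree (n := n)) (NC n : Set (Finpartition Finset.univ)) := by
  have hnc : ∀ π : Finpartition (Finset.univ : Finset (Fin n)), IsNoncrossing π →
      NoncrossingList ((List.range (2 * n)).map (unionLabel π)) := by
    intro π hπ
    have e : (List.range (2 * n)).map (unionLabel π) =
        List.ofFn fun i : Fin (2 * n) => unionLabel π i :=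
      List.ext_getElem (by simp) (by simp)
    rw [e, noncrossingList_ofFn]
    intro i j k l hij hjk hkl
    exact unionLabel_noncrossing hπ hij hjk hkl l.2
  intro π hπ σ hσ h
  have hπ' := hnc π (Finset.mem_filter.mp hπ).2
  have hσ' := hnc σ (Finset.mem_filter.mp hσ).2
  refine Finpartition.eq_of_part_eq_iff fun i j => ?_
  have := eq_iff_of_labelTree_eq
    ((List.range (2 * n)).map fun m => (unionLabel π m, unionLabel σ m))
    (by simpa [Function.comp_def] using hπ') (by simpa [Function.comp_def] using hσ')
    (by simpa [Function.comp_def, unionTree] using h)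
    _ (List.mem_map.mpr ⟨2 * i, List.mem_range.mpr (by omega), rfl⟩)
    _ (List.mem_map.mpr ⟨2 * j, List.mem_range.mpr (by omega), rfl⟩)
  simpa [unionLabel_even] using this

theorem doubledTree_injective : Function.Injective doubledTree := by
  intro t
  induction t with
  | nil =>
    intro t' h
    match t' with
    | nil => rfl
    | node _ nil _ => simp [doubledTree] at h
    | node _ (node _ _ _) _ => simp [doubledTree] at h
  | node _ t₁ t₂ h₁ h₂ =>
    intro t' h
    match t' with
    | nil =>
      simp only [doubledTree, node.injEq] at h
      have := congrArg numNodes h.2.1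
      simp [numNodes_doubledTree] at this
    | node _ s₁ s₂ =>
      simp only [doubledTree, node.injEq, true_and] at h
      rw [h₁ h.1, h₂ h.2]

theorem krewerasTree_injective : Function.Injective krewerasTree := by
  intro t
  induction t with
  | nil =>
    intro t' h
    match t' with
    | nil => rfl
    | node _ _ _ => simp [krewerasTree] at h
  | node _ t₁ t₂ h₁ h₂ =>
    intro t' h
    match t' with
    | nil => simp [krewerasTree] at h
    | node _ s₁ s₂ =>
      simp only [krewerasTree, node.injEq, true_and] at h
      rw [doubledTree_injective h.1, h₂ h.2]

/-- Only one inclusion between the two sets of trees is checked; equality follows by counting, as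
both parametrizations are injective and `NC n` has as many elements as there are trees with `n`
nodes. -/
theorem sum_NC_unionTree {M : Type*} [AddCommMonoid M] (n : ℕ) (f : BinaryTree Unit → M) :
    ∑ π ∈ NC n, f (unionTree π) = ∑ t ∈ treesOfNumNodesEq n, f (krewerasTree t) := by
  have h : (NC n).image unionTree = (treesOfNumNodesEq n).image krewerasTree := by
    refine Finset.eq_of_subset_of_card_le ?_ ?_
    · intro t ht
      obtain ⟨π, hπ, rfl⟩ := Finset.mem_image.mp ht
      obtain ⟨t, ht, e⟩ := exists_unionTree_eq (Finset.mem_filter.mp hπ).2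
      exact Finset.mem_image.mpr ⟨t, ht, e⟩
    · rw [Finset.card_image_of_injOn (unionTree_injOn n), card_NC]
      exact Finset.card_image_le
  rw [← Finset.sum_image (f := f) (unionTree_injOn n), h,
    Finset.sum_image fun _ _ _ _ e => krewerasTree_injective e]

theorem flatten_ofFn_pairs {α : Type*} (c : ℕ → α) (n : ℕ) :
    (List.ofFn fun j : Fin n => [c (2 * j), c (2 * j + 1)]).flatten =
      (List.range (2 * n)).map c := by
  induction n with
  | zero => simp
  | succ n ih =>
    rw [List.ofFn_succ_last]
    simp only [Fin.val_castSucc, Fin.val_last, List.flatten_append, ih, mul_add, mul_one,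
      List.range_succ]
    simp

theorem NCPSpace.boxedConv_eq_krewerasSum {B A κ : Type*} [Ring B] [Algebra ℂ B] [Ring A]
    [Algebra ℂ A] (P : NCPSpace B A) (x y : κ → A) (b b' : Insertion B κ) (n : ℕ)
    (w : Fin (n + 1) → κ) :
    P.boxedConv x y b b' n w =
      krewerasSum P.ι (withUnit P.cumulant) (withUnit P.cumulant)
        (List.ofFn fun j => (P.letters x b n w j, P.letters y b' n w j)) := by
  rw [boxedConv, krewerasSum, List.length_ofFn]
  refine Eq.trans ?_ (sum_NC_unionTree (n + 1) fun t => withUnit P.cumulant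
    (outerLetters P.ι (withUnit P.cumulant) t
      (interleave (List.ofFn fun j => (P.letters x b n w j, P.letters y b' n w j)))))
  refine Finset.sum_congr rfl fun π _ => ?_
  rw [nestedEval_eq]
  have h1 : ((List.ofFn fun j : Fin (n + 1) =>
        [(Sum.inl (π.part j), P.letters x b n w j),
         (Sum.inr ((kreweras π).part j), P.letters y b' n w j)]).flatten.map Prod.fst :
           List (Finset (Fin (n + 1)) ⊕ Finset (Fin (n + 1)))) =
      (List.range (2 * (n + 1))).map (unionLabel π) := by
    rw [List.map_flatten, List.map_ofFn, ← flatten_ofFn_pairs]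
    simp only [Function.comp_def, List.map_cons, List.map_nil, unionLabel_even, unionLabel_odd]
  have h2 : (List.ofFn fun j : Fin (n + 1) =>
        [((Sum.inl (π.part j) : Finset (Fin (n + 1)) ⊕ Finset (Fin (n + 1))),
            P.letters x b n w j),
         (Sum.inr ((kreweras π).part j), P.letters y b' n w j)]).flatten.map Prod.snd =
      interleave (List.ofFn fun j => (P.letters x b n w j, P.letters y b' n w j)) := by
    rw [List.map_flatten, List.map_ofFn, interleave, List.flatMap_def, List.map_ofFn]
    rfl
  rw [h1, h2]
  rfl

end Kreweras

/-! ### Cumulants and the moment-cumulant formula -/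

section TopPartition

open BinaryTree

theorem outerLetters_labelTree_replicate {A B κ : Type*} [Ring A] [Algebra ℂ A] [Ring B]
    [Algebra ℂ B] [DecidableEq κ] (ι : B →ₐ[ℂ] A) {g : List A → B} (hg : g [] = 1) (k : κ)
    (l : List A) : outerLetters ι g (labelTree (List.replicate l.length k)) l = l := by
  induction l with
  | nil => simp [labelTree_nil, outerLetters]
  | cons a l ih =>
    rw [List.length_cons, List.replicate_succ]
    cases l with
    | nil =>
      rw [List.length_nil, List.replicate_zero, labelTree_cons_of_not_mem (by simp), labelTree_nil]
      simp [outerLetters, hg]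
    | cons b l =>
      rw [List.length_cons, List.replicate_succ] at ih ⊢
      have := labelTree_cons_append (k := k) (g := []) (List.replicate l.length k) (by simp)
      rw [List.nil_append, labelTree_nil] at this
      rw [this, outerLetters, BinaryTree.numNodes, List.drop_zero, ih]
      simp [outerLetters, hg]

theorem nestedEval_blockWord_top {A B : Type*} [Ring A] [Algebra ℂ A] [Ring B] [Algebra ℂ B]
    (ι : B →ₐ[ℂ] A) (f : List A → B) {l : List A} (hl : l ≠ []) :
    nestedEval ι f (blockWord l ⊤) = f l := by
  have e : (blockWord l ⊤).map Prod.fst = List.replicate l.length Finset.univ := by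
    rw [blockWord, List.map_ofFn, ← List.ofFn_const]
    congr 1
    funext i
    have h := (⊤ : Finpartition (Finset.univ : Finset (Fin l.length))).part_mem.mpr
      (Finset.mem_univ i)
    exact Finset.mem_singleton.mp (Finpartition.parts_top_subset _ h)
  have e' : (blockWord l ⊤).map Prod.snd = l := by
    rw [blockWord, List.map_ofFn]
    exact List.ofFn_get l
  rw [nestedEval_eq, e, e', outerLetters_labelTree_replicate ι (withUnit_nil f),
    withUnit_of_ne_nil f hl]

end TopPartition

namespace NCPSpace

variable {B A : Type*} [Ring B] [Algebra ℂ B] [Ring A] [Algebra ℂ A] (P : NCPSpace B A)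

/-- The moments `φ(a₁ ⋯ a_n)`. -/
def moment (l : List A) : B := P.φ l.prod

/-- The letter `a` multiplied by the moment of the gap `g` that follows it. -/
def absorb (a : A) (g : List A) : A := a * P.ι (P.moment g)

/-- The properties shared by the moments and the cumulants: multilinearity, and compatibility with
the `B`-bimodule structure of `A`. -/
structure Balanced (F : List A → B) : Prop where
  add : ListAdditive F
  left : ∀ b a l, F (P.ι b * a :: l) = b * F (a :: l)
  right : ∀ l a b, F (l ++ [a * P.ι b]) = F (l ++ [a]) * b
  mid : ∀ u a b a' v, F (u ++ a * P.ι b :: a' :: v) = F (u ++ a :: P.ι b * a' :: v)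

theorem φ_left (b : B) (a : A) : P.φ (P.ι b * a) = b * P.φ a := by
  have := P.φ_bimodule b 1 a
  simpa using this

theorem φ_right (b : B) (a : A) : P.φ (a * P.ι b) = P.φ a * b := by
  have := P.φ_bimodule 1 b a
  simpa using this

@[simp] theorem moment_nil : P.moment [] = 1 := by
  have := P.φ_ι 1
  simpa [moment] using this

@[simp] theorem absorb_nil (a : A) : P.absorb a [] = a := by simp [absorb]

theorem moment_balanced : P.Balanced P.moment where
  add u a b v := by simp [moment, mul_add, add_mul]
  left b a l := by simp [moment, mul_assoc, P.φ_left]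
  right l a b := by simp [moment, ← mul_assoc, P.φ_right]
  mid u a b a' v := by simp [moment, mul_assoc]

variable {P}

theorem ListAdditive.absorb_left (a b : A) (g : List A) :
    P.absorb (a + b) g = P.absorb a g + P.absorb b g := add_mul _ _ _

/-- A letter is either chosen or lies in a gap, where it acts through a moment; both dependences are
additive. The summand `G` is arbitrary so that the induction can absorb the letters in front. -/
theorem gapSum_additive {G : List A → List A → B} (h₁ : ∀ L, ListAdditive fun g => G g L)
    (h₂ : ∀ g, ListAdditive (G g)) : ListAdditive (gapSum P.absorb G) := by
  intro u a b v
  induction u generalizing G with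
  | nil =>
    simp only [List.nil_append, gapSum, ← gapSum_add]
    congr 1
    funext g L
    have e1 := h₁ L [] a b g
    have e2 := h₂ [] [] (P.absorb a g) (P.absorb b g) L
    simp only [List.nil_append] at e1 e2
    rw [ListAdditive.absorb_left, e1, e2]
    abel
  | cons c u ih =>
    refine ih (fun L u' a' b' v' => ?_) (fun g u' a' b' v' => ?_)
    · have e1 := h₁ L (c :: u') a' b' v'
      have e2 := h₂ [] [] (P.absorb c (u' ++ a' :: v')) (P.absorb c (u' ++ b' :: v')) L
      have e3 : P.absorb c (u' ++ (a' + b') :: v') =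
          P.absorb c (u' ++ a' :: v') + P.absorb c (u' ++ b' :: v') := by
        rw [absorb, P.moment_balanced.add, map_add, mul_add, absorb, absorb]
      simp only [List.nil_append, List.cons_append] at e1 e2
      simp only [e1, e2, e3]
      abel
    · have e1 := h₂ (c :: g) u' a' b' v'
      have e2 := h₂ [] (P.absorb c g :: u') a' b' v'
      simp only [List.cons_append] at e2
      simp only [e1, e2]
      abel

theorem gapSum_right {G : List A → List A → B}
    (h₁ : ∀ g a b, G (g ++ [a * P.ι b]) [] = G (g ++ [a]) [] * b)
    (h₂ : ∀ g L a b, G g (L ++ [a * P.ι b]) = G g (L ++ [a]) * b) (u : List A) (a : A) (b : B) :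
    gapSum P.absorb G (u ++ [a * P.ι b]) = gapSum P.absorb G (u ++ [a]) * b := by
  induction u generalizing G with
  | nil =>
    have e1 := h₁ [] a b
    have e2 := h₂ [] [] a b
    simp only [List.nil_append] at e1 e2
    simp [gapSum, e1, e2, add_mul]
  | cons c u ih =>
    refine ih (fun g a b => ?_) (fun g L a b => ?_)
    · have e1 := h₁ (c :: g) a b
      have e2 := h₂ [] [] (P.absorb c (g ++ [a])) b
      have e3 : P.absorb c (g ++ [a * P.ι b]) = P.absorb c (g ++ [a]) * P.ι b := by
        rw [absorb, P.moment_balanced.right, map_mul, absorb, mul_assoc]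
      simp only [List.nil_append, List.cons_append] at e1 e2
      rw [e1, e3, e2, add_mul]
    · have e2 := h₂ [] (P.absorb c g :: L) a b
      simp only [List.cons_append] at e2
      rw [h₂, e2, add_mul]

/-- `h₃` is the boundary case in which `a` closes the first gap and `a'` is the first chosen letter.
At later boundaries the factor leaves the moment of a gap on its right and is passed on to the next
chosen letter. -/
theorem gapSum_mid {G : List A → List A → B}
    (h₁ : ∀ L u a b a' v, G (u ++ a * P.ι b :: a' :: v) L = G (u ++ a :: P.ι b * a' :: v) L)
    (h₂ : ∀ g u a b a' v, G g (u ++ a * P.ι b :: a' :: v) = G g (u ++ a :: P.ι b * a' :: v))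
    (h₃ : ∀ g a b a' L, G (g ++ [a * P.ι b]) (a' :: L) = G (g ++ [a]) (P.ι b * a' :: L))
    (u : List A) (a : A) (b : B) (a' : A) (v : List A) :
    gapSum P.absorb G (u ++ a * P.ι b :: a' :: v) =
      gapSum P.absorb G (u ++ a :: P.ι b * a' :: v) := by
  have e0 : ∀ b a g, P.absorb (P.ι b * a) g = P.ι b * P.absorb a g := fun b a g => by
    rw [absorb, absorb, mul_assoc]
  induction u generalizing G with
  | nil =>
    simp only [List.nil_append, gapSum]
    congr 1
    funext g L
    have e1 := h₁ L [] a b a' g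
    have e2 := h₂ [] [] a b (P.absorb a' g) L
    have e3 := h₃ [] a b (P.absorb a' g) L
    have e4 : P.absorb (a * P.ι b) (a' :: g) = P.absorb a (P.ι b * a' :: g) := by
      rw [absorb, absorb, P.moment_balanced.left, map_mul, mul_assoc]
    simp only [List.nil_append] at e1 e2 e3
    simp only [absorb_nil, e0, e1, e2, e3, e4]
  | cons c u ih =>
    refine ih (fun L u' a b a' v' => ?_) (fun g u' a b a' v' => ?_) (fun g a b a' L => ?_)
    · have e1 := h₁ L (c :: u') a b a' v'
      simp only [List.cons_append] at e1
      rw [e1, absorb, P.moment_balanced.mid, absorb]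
    · have e2 := h₂ [] (P.absorb c g :: u') a b a' v'
      simp only [List.cons_append] at e2
      rw [h₂, e2]
    · have e1 := h₃ (c :: g) a b a' L
      have e2 := h₂ [] [] (P.absorb c (g ++ [a])) b a' L
      have e3 : P.absorb c (g ++ [a * P.ι b]) = P.absorb c (g ++ [a]) * P.ι b := by
        rw [absorb, P.moment_balanced.right, map_mul, absorb, mul_assoc]
      simp only [List.nil_append, List.cons_append] at e1 e2
      rw [e1, e3, e2]

theorem Balanced.chainSum {F : List A → B} (hF : P.Balanced F) :
    P.Balanced (chainSum P.absorb F) where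
  add := by
    intro u a b v
    cases u with
    | nil =>
      simp only [List.nil_append, _root_.chainSum, ← gapSum_add]
      congr 1
      funext g L
      rw [ListAdditive.absorb_left]
      exact hF.add [] _ _ L
    | cons c u =>
      refine gapSum_additive (fun L u' a' b' v' => ?_) (fun g => hF.add.cons _) u a b v
      have e3 : P.absorb c (u' ++ (a' + b') :: v') =
          P.absorb c (u' ++ a' :: v') + P.absorb c (u' ++ b' :: v') := by
        rw [absorb, P.moment_balanced.add, map_add, mul_add, absorb, absorb]
      beta_reduce
      rw [e3]
      exact hF.add [] _ _ L
  left b a l := by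
    simp only [_root_.chainSum]
    refine Eq.trans ?_ (map_gapSum (AddMonoidHom.mulLeft b) P.absorb _ l).symm
    congr 1
    funext g L
    rw [absorb, mul_assoc, hF.left]
    rfl
  right l a b := by
    cases l with
    | nil => simpa [_root_.chainSum, gapSum] using hF.right [] a b
    | cons c l =>
      refine gapSum_right (fun g a b => ?_) (fun g L a b => ?_) l a b
      · rw [absorb, P.moment_balanced.right, map_mul, ← mul_assoc]
        exact hF.right [] _ b
      · exact hF.right (P.absorb c g :: L) a b
  mid u a b a' v := by
    cases u with
    | nil =>
      simp only [List.nil_append, _root_.chainSum, gapSum]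
      congr 1
      funext g L
      have e1 : P.absorb (a * P.ι b) (a' :: g) = P.absorb a (P.ι b * a' :: g) := by
        rw [absorb, absorb, P.moment_balanced.left, map_mul, mul_assoc]
      have e2 := hF.mid [] a b (P.absorb a' g) L
      have e3 : P.absorb (P.ι b * a') g = P.ι b * P.absorb a' g := by
        rw [absorb, absorb, mul_assoc]
      simp only [List.nil_append] at e2
      rw [e1, absorb_nil, absorb_nil, e2, e3]
    | cons c u =>
      refine gapSum_mid (fun L u' a b a' v' => ?_) (fun g u' a b a' v' => ?_)
        (fun g a b a' L => ?_) u a b a' v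
      · rw [absorb, P.moment_balanced.mid, absorb]
      · exact hF.mid (P.absorb c g :: u') a b a' v'
      · rw [absorb, P.moment_balanced.right, map_mul, ← mul_assoc]
        exact hF.mid [] _ b a' L

theorem Balanced.sub {F F' : List A → B} (hF : P.Balanced F) (hF' : P.Balanced F') :
    P.Balanced fun l => F l - F' l where
  add u a b v := by simp only [hF.add u a b v, hF'.add u a b v]; abel
  left b a l := by rw [hF.left, hF'.left, mul_sub]
  right l a b := by rw [hF.right, hF'.right, sub_mul]
  mid u a b a' v := by rw [hF.mid, hF'.mid]

/-- Every condition compares words of one and the same length, so the cumulants can be treated one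
length at a time. -/
theorem balanced_of_length {F : List A → B}
    (h : ∀ n : ℕ, ∃ F', P.Balanced F' ∧ ∀ l, l.length = n + 1 → F l = F' l) : P.Balanced F where
  add u a b v := by
    obtain ⟨F', hF', e⟩ := h (u.length + v.length)
    have := hF'.add u a b v
    rwa [← e, ← e, ← e] at this <;> simp <;> omega
  left b a l := by
    obtain ⟨F', hF', e⟩ := h l.length
    rw [e _ (by simp), e _ (by simp), hF'.left]
  right l a b := by
    obtain ⟨F', hF', e⟩ := h l.length
    rw [e _ (by simp), e _ (by simp), hF'.right]
  mid u a b a' v := by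
    obtain ⟨F', hF', e⟩ := h (u.length + v.length + 1)
    rw [e _ (by simp; omega), e _ (by simp; omega), hF'.mid]

variable (P)

theorem cumulantUpTo_succ_of_ne {n : ℕ} {l : List A} (hl : l.length ≠ n + 1) :
    P.cumulantUpTo (n + 1) l = P.cumulantUpTo n l := by
  simp only [cumulantUpTo, if_neg hl]

theorem cumulantUpTo_of_lt {n : ℕ} {l : List A} (hl : n < l.length) : P.cumulantUpTo n l = 0 := by
  induction n with
  | zero => rfl
  | succ n ih => rw [P.cumulantUpTo_succ_of_ne hl.ne', ih (by omega)]

theorem cumulantUpTo_of_le {n : ℕ} {l : List A} (hl : l.length ≤ n) :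
    P.cumulantUpTo n l = P.cumulant l := by
  induction n, hl using Nat.le_induction with
  | base => rfl
  | succ n hn ih => rw [P.cumulantUpTo_succ_of_ne (by omega), ih]

/-- The cumulants of words of length at most `n`, with the value `1` at the empty word. -/
def truncated (n : ℕ) : List A → B := withUnit (P.cumulantUpTo n)

/-- The cumulants, with the value `1` at the empty word. -/
def ucumulant : List A → B := withUnit P.cumulant

theorem truncated_nil (n : ℕ) : P.truncated n [] = 1 := withUnit_nil _

@[simp] theorem ucumulant_nil : P.ucumulant [] = 1 := withUnit_nil _

theorem truncated_of_le {n : ℕ} {l : List A} (hl : l.length ≤ n) :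
    P.truncated n l = P.ucumulant l := by
  rw [truncated, ucumulant, withUnit, withUnit, P.cumulantUpTo_of_le hl]

theorem truncated_of_lt {n : ℕ} {l : List A} (hl : n < l.length) : P.truncated n l = 0 := by
  rw [truncated, withUnit_of_ne_nil _ (by rintro rfl; simp at hl), P.cumulantUpTo_of_lt hl]

theorem ucumulant_eq_sub {n : ℕ} {l : List A} (hl : l.length = n + 1) :
    P.ucumulant l = P.moment l - treeSum P.ι (P.truncated n) (P.truncated n) l := by
  have hne : l ≠ [] := by rintro rfl; simp at hl
  rw [ucumulant, withUnit_of_ne_nil _ hne, cumulant, hl]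
  simp only [cumulantUpTo, if_pos hl]
  -- The one-block term may be put back: `cumulantUpTo n` vanishes on words of length `n + 1`.
  rw [Finset.sum_erase, sum_nestedEval_blockWord]
  · rfl
  · rw [nestedEval_blockWord_top _ _ hne, P.cumulantUpTo_of_lt (by omega)]

/-- Both functions agree on words of length at most `n`, so only the full chain can tell them apart.
-/
theorem chainSum_ucumulant_eq {n : ℕ} {l : List A} (hl : l.length ≤ n + 1) :
    chainSum P.absorb P.ucumulant l =
      chainSum P.absorb (P.truncated n) l + (P.ucumulant l - P.truncated n l) := by
  have h := chainSum_of_short (h := P.absorb) (l := l)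
    (F := fun L => P.ucumulant L - P.truncated n L)
    (fun _ => True) (fun _ => True) (fun _ _ => trivial) (fun _ _ _ _ => trivial)
    (fun L _ _ hL => by rw [P.truncated_of_le (by omega), sub_self])
  simp only [absorb_nil, List.map_id'] at h
  rw [← h, ← chainSum_add]
  simp

/-- The two claims need each other. Rewriting the sum over partitions as a chain sum requires
additivity of the shorter cumulants, and the cumulant of the next length is balanced because it is
the moment minus that chain sum. -/
theorem truncated_balanced_and (n : ℕ) : P.Balanced (P.truncated n) ∧
    ∀ l, l.length ≤ n → treeSum P.ι (P.truncated n) (P.truncated n) l = P.moment l := by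
  induction n with
  | zero =>
    have h : ∀ l : List A, l ≠ [] → P.truncated 0 l = 0 := fun l hl =>
      P.truncated_of_lt (List.length_pos_iff.mpr hl)
    refine ⟨⟨fun u a b v => ?_, fun b a l => ?_, fun l a b => ?_, fun u a b a' v => ?_⟩, ?_⟩
    · rw [h _ (by simp), h _ (by simp), h _ (by simp), add_zero]
    · rw [h _ (by simp), h _ (by simp), mul_zero]
    · rw [h _ (by simp), h _ (by simp), zero_mul]
    · rw [h _ (by simp), h _ (by simp)]
    · intro l hl
      obtain rfl : l = [] := by simpa using hl
      simp [treeSum, outerLetters, truncated_nil]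
  | succ n ih =>
    obtain ⟨hb, hm⟩ := ih
    have hchain : ∀ l : List A, l.length ≤ n + 1 →
        treeSum P.ι (P.truncated n) (P.truncated n) l =
          chainSum P.absorb (P.truncated n) l := by
      intro l hl
      rw [treeSum_eq_chainSum P.ι _ hb.add]
      refine chainSum_congr_length _ fun a g hg => ?_
      rw [hm g (by omega), absorb]
    have hbal : P.Balanced (P.truncated (n + 1)) := by
      refine balanced_of_length fun m => ?_
      by_cases hmn : m = n
      · subst hmn
        refine ⟨_, P.moment_balanced.sub hb.chainSum, fun l hl => ?_⟩
        rw [P.truncated_of_le hl.le, P.ucumulant_eq_sub hl, hchain l hl.le]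
      · refine ⟨_, hb, fun l hl => ?_⟩
        rw [truncated, truncated, withUnit, withUnit, P.cumulantUpTo_succ_of_ne (by omega)]
    refine ⟨hbal, fun l => ?_⟩
    induction hk : l.length using Nat.strong_induction_on generalizing l with
    | _ k ihk =>
      intro hl
      subst hk
      rw [treeSum_eq_chainSum P.ι _ hbal.add]
      have e1 : chainSum (fun a w => a * P.ι (treeSum P.ι (P.truncated (n + 1))
          (P.truncated (n + 1)) w)) (P.truncated (n + 1)) l =
          chainSum P.absorb (P.truncated (n + 1)) l :=
        chainSum_congr_length _ fun a g hg => by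
          rw [ihk g.length hg g rfl (by omega), absorb]
      have e2 := P.chainSum_ucumulant_eq (n := n + 1) (l := l) (by omega)
      rw [P.truncated_of_le hl, sub_self, add_zero] at e2
      rw [e1, ← e2, P.chainSum_ucumulant_eq hl, ← hchain l hl]
      rcases hl.eq_or_lt with hl | hl
      · rw [P.ucumulant_eq_sub hl, P.truncated_of_lt (by omega)]
        abel
      · rw [P.truncated_of_le (by omega), sub_self, add_zero, hm l (by omega)]

theorem ucumulant_balanced : P.Balanced P.ucumulant :=
  balanced_of_length fun n =>
    ⟨_, (P.truncated_balanced_and (n + 1)).1, fun _ hl => (P.truncated_of_le hl.le).symm⟩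

/-- The moment-cumulant formula. -/
theorem moment_eq_chainSum (l : List A) : P.moment l = chainSum P.absorb P.ucumulant l := by
  obtain ⟨hb, hm⟩ := P.truncated_balanced_and l.length
  have e := P.chainSum_ucumulant_eq (n := l.length) (l := l) (by omega)
  rw [P.truncated_of_le le_rfl, sub_self, add_zero] at e
  rw [e, ← hm l le_rfl, treeSum_eq_chainSum P.ι _ hb.add]
  exact chainSum_congr_length _ fun a g hg => by rw [hm g hg.le, absorb]

end NCPSpace

namespace NCPSpace

variable {B A : Type*} [Ring B] [Algebra ℂ B] [Ring A] [Algebra ℂ A] (P : NCPSpace B A)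

/-! ### Expansion of a moment with respect to the first and to the last block -/

/-- The part of the moment of `l ++ [z]` in which `z` is in the block of the first letter. -/
def lastBlock (l : List A) (z : A) : B := chainSum P.absorb (fun L => P.ucumulant (L ++ [z])) l

/-- Either `z` belongs to the chain, or it lies in the last gap. In the second case the moment of
that gap is split at the start of the block of `z`, and right `B`-linearity of `F` releases the
factor containing `z`. -/
theorem chainSum_append_singleton {F : List A → B}
    (hF : ∀ l a b, F (l ++ [a * P.ι b]) = F (l ++ [a]) * b) {l : List A} {z : A}
    (H : ∀ g, g.length < l.length →
      P.moment (g ++ [z]) = splitSum (fun u r => P.moment u * P.lastBlock r z) g) :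
    chainSum P.absorb F (l ++ [z]) = chainSum P.absorb (fun L => F (L ++ [z])) l +
      splitSum (fun u r => if u = [] then 0 else chainSum P.absorb F u * P.lastBlock r z) l := by
  induction hn : l.length using Nat.strong_induction_on generalizing l F with
  | _ n ih =>
    cases l with
    | nil => simp [chainSum, gapSum, splitSum]
    | cons a l =>
      rw [List.length_cons] at hn H
      have e1 : F [P.absorb a (l ++ [z])] =
          splitSum (fun u r => F [P.absorb a u] * P.lastBlock r z) l := by
        have h1 : ∀ g, F [P.absorb a g] = F [a] * P.moment g := fun g => by
          simpa [absorb] using hF [] a (P.moment g)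
        rw [h1, H l (by omega)]
        refine (map_splitSum (AddMonoidHom.mulLeft (F [a])) _ l).trans ?_
        refine splitSum_congr fun u r _ => ?_
        rw [h1, mul_assoc]
        rfl
      have e2 : ∀ g r, g ++ r = l →
          chainSum P.absorb (fun L => F (P.absorb a g :: L)) (r ++ [z]) =
            chainSum P.absorb (fun L => F (P.absorb a g :: (L ++ [z]))) r +
            splitSum (fun u r' => if u = [] then 0 else
              chainSum P.absorb (fun L => F (P.absorb a g :: L)) u * P.lastBlock r' z) r := by
        intro g r e
        have hl : l.length = g.length + r.length := by rw [← e, List.length_append]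
        exact ih r.length (by omega) (fun L => hF (_ :: L)) (fun g' hg' => H g' (by omega)) rfl
      have e3 : splitSum (fun u r => chainSum P.absorb F (a :: u) * P.lastBlock r z) l =
          splitSum (fun g r => splitSum (fun u r' =>
            chainSum P.absorb (fun L => F (P.absorb a g :: L)) u * P.lastBlock r' z) r) l := by
        rw [splitSum_assoc]
        refine splitSum_congr fun u r _ => ?_
        rw [chainSum_cons]
        exact map_splitSum (AddMonoidHom.mulRight _) _ u
      rw [List.cons_append, chainSum_cons, splitSum_append_singleton, splitSum_congr e2,
        splitSum_add, chainSum_cons]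
      simp only [chainSum.eq_1, e1, splitSum, List.cons_append, if_true, zero_add, reduceCtorEq,
        if_false, e3]
      rw [add_assoc, ← splitSum_add]
      congr 1
      refine splitSum_congr fun g r _ => ?_
      exact splitSum_ite_left (fun u r' =>
        chainSum P.absorb (fun L => F (P.absorb a g :: L)) u * P.lastBlock r' z) r

/-- Here `r` starts where the block of `z` starts. No block crosses it, so the letters before it
contribute an independent moment. -/
theorem moment_append_singleton (l : List A) (z : A) :
    P.moment (l ++ [z]) = splitSum (fun u r => P.moment u * P.lastBlock r z) l := by
  induction hn : l.length using Nat.strong_induction_on generalizing l with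
  | _ n ih =>
    rw [P.moment_eq_chainSum, P.chainSum_append_singleton P.ucumulant_balanced.right
      fun g hg => ih _ (hn ▸ hg) g rfl]
    rw [← splitSum_ite_left (fun u r => P.moment u * P.lastBlock r z) l, add_comm]
    simp only [← P.moment_eq_chainSum, moment_nil, one_mul]
    rfl

/-- The part of the moment of `l` in which the last letter is in the block of the first one. -/
def irreducible (l : List A) : B :=
  match l.reverse with
  | [] => 0
  | z :: r => P.lastBlock r.reverse z

@[simp] theorem irreducible_nil : P.irreducible [] = 0 := rfl

theorem irreducible_append_singleton (l : List A) (z : A) :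
    P.irreducible (l ++ [z]) = P.lastBlock l z := by
  simp [irreducible]

theorem moment_eq_splitSum_last {l : List A} (hl : l ≠ []) :
    P.moment l = splitSum (fun u r => P.moment u * P.irreducible r) l := by
  obtain ⟨l, z, rfl⟩ := List.eq_nil_or_concat' l |>.resolve_left hl
  rw [splitSum_append_singleton, moment_append_singleton]
  simp [irreducible_append_singleton]

/-- Under convolution over cuts the moments form the geometric series of the irreducible parts, so
the irreducible factor may be split off on either side. -/
theorem moment_eq_splitSum_first {l : List A} (hl : l ≠ []) :
    P.moment l = splitSum (fun u r => P.irreducible u * P.moment r) l := by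
  induction hn : l.length using Nat.strong_induction_on generalizing l with
  | _ n ih =>
    have e1 : ∀ u r, u ++ r = l → P.moment u * P.irreducible r =
        (if u = [] then P.irreducible r else 0) +
          splitSum (fun u₁ u₂ => P.irreducible u₁ * (P.moment u₂ * P.irreducible r)) u := by
      intro u r e
      by_cases hr : r = []
      · simp only [hr, irreducible_nil, mul_zero, ite_self, zero_add]
        exact (splitSum_eq_zero fun _ _ _ => rfl).symm
      by_cases hu : u = []
      · simp [hu, splitSum]
      · rw [if_neg hu, zero_add, ih u.length _ hu rfl]
        · refine (map_splitSum (AddMonoidHom.mulRight (P.irreducible r)) _ u).trans ?_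
          exact splitSum_congr fun _ _ _ => mul_assoc _ _ _
        · rw [← hn, ← e, List.length_append]
          have := List.length_pos_iff.mpr hr
          omega
    have e2 : ∀ u r, u ++ r = l → P.irreducible u * P.moment r =
        (if r = [] then P.irreducible u else 0) +
          splitSum (fun u₂ r' => P.irreducible u * (P.moment u₂ * P.irreducible r')) r := by
      intro u r _
      by_cases hr : r = []
      · simp [hr, splitSum]
      · rw [if_neg hr, zero_add, P.moment_eq_splitSum_last hr]
        exact map_splitSum (AddMonoidHom.mulLeft (P.irreducible u)) _ r
    rw [P.moment_eq_splitSum_last hl, splitSum_congr e1, splitSum_congr e2, splitSum_add,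
      splitSum_add, splitSum_ite_right, splitSum_assoc]
    congr 1
    have := splitSum_ite_left (fun u r : List A => if u = [] then P.irreducible r else 0) l
    rw [if_pos rfl] at this
    rw [← this, splitSum_eq_zero, zero_add]
    intro g r _
    simp +contextual

/-! ### Alternating words in two free sets of letters -/

/-- The cumulants of words in letters satisfying `p` or `q` vanish if both kinds of letters occur;
both kinds of letters are stable under right multiplication by `B`. -/
structure FreePair (p q : A → Prop) : Prop where
  left_mul : ∀ a b, p a → p (a * P.ι b)
  right_mul : ∀ a b, q a → q (a * P.ι b)
  mixed : ∀ l a b, (∀ c ∈ l, p c ∨ q c) → [a, b].Sublist l → p a → q b → P.ucumulant l = 0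
  mixed' : ∀ l a b, (∀ c ∈ l, p c ∨ q c) → [a, b].Sublist l → q a → p b → P.ucumulant l = 0

variable {P} {p q : A → Prop}

theorem FreePair.absorb_left (h : P.FreePair p q) {a : A} (ha : p a) (g : List A) :
    p (P.absorb a g) := h.left_mul _ _ ha

theorem FreePair.absorb_right (h : P.FreePair p q) {a : A} (ha : q a) (g : List A) :
    q (P.absorb a g) := h.right_mul _ _ ha

theorem FreePair.absorb_or (h : P.FreePair p q) (a : A) (g : List A) (ha : p a ∨ q a)
    (_ : ∀ x ∈ g, p x ∨ q x) : p (P.absorb a g) ∨ q (P.absorb a g) :=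
  ha.imp (fun h' => h.absorb_left h' g) fun h' => h.absorb_right h' g

theorem interleave_mem {α : Type*} {p q : α → Prop} {w : List (α × α)}
    (hw : ∀ v ∈ w, p v.1 ∧ q v.2) : ∀ c ∈ interleave w, p c ∨ q c := by
  intro c hc
  simp only [interleave, List.mem_flatMap, List.mem_cons, List.not_mem_nil, or_false] at hc
  obtain ⟨v, hv, rfl | rfl⟩ := hc
  · exact Or.inl (hw v hv).1
  · exact Or.inr (hw v hv).2

/-- Only chains of `x`'s survive, so every `y` lies in a gap, right behind its own `x` if that `x`
is chosen. The sum over letters becomes a sum over pairs. -/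
theorem FreePair.gapSum_interleave (h : P.FreePair p q) {G : List A → List A → B}
    (hG : ∀ g L, (∀ c ∈ L, p c ∨ q c) → (∃ c ∈ L, q c) → G g L = 0) {w : List (A × A)}
    (hw : ∀ v ∈ w, p v.1 ∧ q v.2) :
    gapSum P.absorb G (interleave w) =
      gapSum (fun v u => P.absorb v.1 (v.2 :: interleave u))
        (fun u L => G (interleave u) L) w := by
  induction w generalizing G with
  | nil => rfl
  | cons v w ih =>
    simp only [List.forall_mem_cons] at hw
    simp only [interleave_cons, interleave_nil, gapSum]
    rw [← ih (G := fun g L => G (v.1 :: v.2 :: g) L + G [] (P.absorb v.1 (v.2 :: g) :: L)) ?_ hw.2]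
    · refine gapSum_congr (fun c => p c ∨ q c) (fun c => p c ∨ q c) (interleave_mem hw.2)
        h.absorb_or fun g L _ hL => ?_
      rw [hG [v.1], hG [] (P.absorb v.1 [] :: P.absorb v.2 g :: L)]
      · abel
      · simpa using ⟨Or.inl hw.1.1, Or.inr (h.absorb_right hw.1.2 g), hL⟩
      · exact ⟨_, by simp, h.absorb_right hw.1.2 g⟩
      · simpa using ⟨Or.inr (h.absorb_right hw.1.2 g), hL⟩
      · exact ⟨_, by simp, h.absorb_right hw.1.2 g⟩
    · rintro g L hL ⟨c, hc, hqc⟩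
      rw [hG _ L hL ⟨c, hc, hqc⟩, hG, add_zero]
      · simpa using ⟨Or.inl (h.absorb_left hw.1.1 _), hL⟩
      · exact ⟨c, by simp [hc], hqc⟩

theorem FreePair.moment_interleave (h : P.FreePair p q) {w : List (A × A)}
    (hw : ∀ v ∈ w, p v.1 ∧ q v.2) :
    P.moment (interleave w) =
      chainSum (fun v u => P.absorb v.1 (v.2 :: interleave u)) P.ucumulant w := by
  cases w with
  | nil => simp [chainSum]
  | cons v w =>
    simp only [List.forall_mem_cons] at hw
    have hv := fun g => h.absorb_left hw.1.1 g
    rw [moment_eq_chainSum]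
    simp only [interleave_cons, chainSum, gapSum]
    rw [← h.gapSum_interleave (G := fun g L => P.ucumulant (P.absorb v.1 (v.2 :: g) :: L)) ?_ hw.2]
    · refine gapSum_congr (fun c => p c ∨ q c) (fun c => p c ∨ q c) (interleave_mem hw.2)
        h.absorb_or fun g L _ hL => ?_
      rw [h.mixed (P.absorb v.1 [] :: P.absorb v.2 g :: L) _ _ _ (by simp) (hv [])
        (h.absorb_right hw.1.2 g), add_zero]
      exact List.forall_mem_cons.mpr ⟨Or.inl (hv []),
        List.forall_mem_cons.mpr ⟨Or.inr (h.absorb_right hw.1.2 g), hL⟩⟩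
    · rintro g L hL ⟨c, hc, hqc⟩
      exact h.mixed _ _ c (by simpa using ⟨Or.inl (hv _), hL⟩)
        (List.Sublist.cons_cons _ (List.singleton_sublist.mpr hc)) (hv _) hqc

theorem FreePair.moment_interleave_append (h : P.FreePair p q) {w : List (A × A)}
    (hw : ∀ v ∈ w, p v.1 ∧ q v.2) {x : A} (hx : p x) :
    P.moment (interleave w ++ [x]) =
      splitSum (fun u r => P.moment (interleave u) *
        chainSum (fun v u => P.absorb v.1 (v.2 :: interleave u))
          (fun L => P.ucumulant (L ++ [x])) r) w := by
  rw [moment_append_singleton]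
  simp only [lastBlock, mul_chainSum]
  rw [← gapSum_eq_splitSum _ fun g L => P.moment g * P.ucumulant (L ++ [x]),
    ← gapSum_eq_splitSum _ fun u L => P.moment (interleave u) * P.ucumulant (L ++ [x])]
  refine h.gapSum_interleave ?_ hw
  rintro g L hL ⟨c, hc, hqc⟩
  rw [h.mixed' _ c x _ (List.Sublist.append (List.singleton_sublist.mpr hc) (List.Sublist.refl [x]))
    hqc hx, mul_zero]
  intro c hc
  rcases List.mem_append.mp hc with hc | hc
  · exact hL c hc
  · exact Or.inl (by simpa [List.mem_singleton.mp hc] using hx)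

/-- A cut falls at the end, before an `x`, or between an `x` and its `y`. -/
theorem splitSum_interleave {α M : Type*} [AddCommMonoid M] (f : List α → List α → M)
    (w : List (α × α)) :
    splitSum f (interleave w) = f (interleave w) [] +
      pivotSum (fun u v r => f (interleave u) (v.1 :: v.2 :: interleave r) +
        f (interleave u ++ [v.1]) (v.2 :: interleave r)) w := by
  induction w generalizing f with
  | nil => simp [splitSum, pivotSum]
  | cons v w ih =>
    simp only [interleave_cons, splitSum, pivotSum, ih, interleave_nil, List.nil_append,
      List.cons_append]
    abel

/-- The next chosen letter after `y` must again be a `y`, so the first gap is the whole rest or ends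
with an `x`. -/
theorem FreePair.chainSum_cons_interleave (h : P.FreePair p q) {F : List A → B}
    (hF : ∀ y L, q y → (∀ c ∈ L, p c ∨ q c) → (∃ c ∈ L, p c) → F (y :: L) = 0)
    {y : A} (hy : q y) {w : List (A × A)} (hw : ∀ v ∈ w, p v.1 ∧ q v.2) :
    chainSum P.absorb F (y :: interleave w) = F [P.absorb y (interleave w)] +
      pivotSum (fun u v r => chainSum P.absorb
        (fun L => F (P.absorb y (interleave u ++ [v.1]) :: L)) (v.2 :: interleave r)) w := by
  rw [chainSum_cons, splitSum_interleave]
  congr 1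
  refine pivotSum_congr fun u v r e => ?_
  simp only [← e, List.forall_mem_append, List.forall_mem_cons] at hw
  rw [add_eq_right]
  simp only [chainSum]
  have h0 : gapSum P.absorb (fun _ _ => (0 : B)) (v.2 :: interleave r) = 0 :=
    (map_gapSum (0 : B →+ B) P.absorb (fun _ _ => 0) _).symm
  rw [← h0]
  refine gapSum_congr (fun c => p c ∨ q c) (fun c => p c ∨ q c) ?_ h.absorb_or fun g L _ hL => ?_
  · exact List.forall_mem_cons.mpr ⟨Or.inr hw.2.1.2, interleave_mem hw.2.2⟩
  · refine hF _ _ (h.absorb_right hy _) ?_ ⟨_, List.mem_cons_self, h.absorb_left hw.2.1.1 g⟩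
    exact List.forall_mem_cons.mpr ⟨Or.inl (h.absorb_left hw.2.1.1 g), hL⟩

/-! ### Cumulants of products of free elements -/

variable (P) in
/-- The pair `(x, y)`, with `y` multiplied by the moment of the gap that follows it. -/
def absorbPair (v : A × A) (g : List (A × A)) : A × A :=
  (v.1, P.absorb v.2 (interleave g))

theorem chainSum_absorb_pair {F : List A → B}
    (hF : ListAdditive F) {w : List (A × A)} (hw : ∀ v ∈ w, p v.1 ∧ q v.2)
    (hY : ∀ y g, q y → (∀ v ∈ g, p v.1 ∧ q v.2) → g.length < w.length →
      P.moment (y :: interleave g) = gapSum P.absorbPair (fun g L =>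
        doubledSumLeft P.ι P.ucumulant P.ucumulant (P.absorb y (interleave g)) L) g) :
    chainSum (fun v u => P.absorb v.1 (v.2 :: interleave u)) F w =
      chainSum P.absorbPair (chainSum (fun v u =>
        v.1 * P.ι (doubledSumLeft P.ι P.ucumulant P.ucumulant v.2 u)) F) w := by
  refine chainSum_eq_chainSum_chainSum hF P.absorbPair _ _ hw fun v g hv hg hlt => ?_
  rw [absorb, hY v.2 g hv.2 hg hlt]
  exact map_gapSum ((AddMonoidHom.mulLeft v.1).comp (P.ι : B →+ A)) P.absorbPair _ g

/-- The pairs before the block of `x` contribute a moment; the gaps in this block are shorter words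
from a `y` to a `y`, which `hY` resolves. -/
theorem FreePair.moment_interleave_append_eq (h : P.FreePair p q) {w : List (A × A)}
    (hw : ∀ v ∈ w, p v.1 ∧ q v.2)
    (hY : ∀ y g, q y → (∀ v ∈ g, p v.1 ∧ q v.2) → g.length < w.length →
      P.moment (y :: interleave g) = gapSum P.absorbPair (fun g L =>
        doubledSumLeft P.ι P.ucumulant P.ucumulant (P.absorb y (interleave g)) L) g)
    {x : A} (hx : p x) :
    P.moment (interleave w ++ [x]) = gapSum P.absorbPair (fun g L =>
      P.moment (interleave g) * doubledSumRight P.ι P.ucumulant P.ucumulant L x) w := by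
  rw [h.moment_interleave_append hw hx, gapSum_eq_splitSum]
  refine splitSum_congr fun u r e => ?_
  have hl : w.length = u.length + r.length := by rw [← e, List.length_append]
  simp only [← e, List.forall_mem_append] at hw
  rw [chainSum_absorb_pair (P.ucumulant_balanced.add.append_right [x]) hw.2
    fun y g hy hg hlt => hY y g hy hg (by omega)]
  refine (map_chainSum (AddMonoidHom.mulLeft _) _ _ r).trans ?_
  congr 1
  funext L
  rw [doubledSumRight_eq_chainSum P.ι P.ucumulant_nil P.ucumulant_balanced.add]
  rfl

/-- The core of the product formula: the partitions are regrouped by the pairs connected to `y`. The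
gaps in the block of `y` are words from an `x` to an `x`, those in the blocks of `x`'s are words
from a `y` to a `y`, so the two kinds of words feed each other in one induction on the length. `F`
is arbitrary so that letters of the block of `y` can be peeled off one by one. -/
theorem FreePair.chainSum_cons_interleave_eq (h : P.FreePair p q) {F : List A → B}
    (hadd : ListAdditive F)
    (hF : ∀ y L, q y → (∀ c ∈ L, p c ∨ q c) → (∃ c ∈ L, p c) → F (y :: L) = 0)
    {y : A} (hy : q y) {w : List (A × A)} (hw : ∀ v ∈ w, p v.1 ∧ q v.2) :
    chainSum P.absorb F (y :: interleave w) = gapSum P.absorbPair (fun g L =>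
      doubledSumLeft P.ι P.ucumulant F (P.absorb y (interleave g)) L) w := by
  induction hn : w.length using Nat.strong_induction_on generalizing w F y with
  | _ n ih =>
    have hκ : ∀ y L, q y → (∀ c ∈ L, p c ∨ q c) → (∃ c ∈ L, p c) →
        P.ucumulant (y :: L) = 0 := by
      rintro y L hy hL ⟨c, hc, hpc⟩
      exact h.mixed' _ y c (List.forall_mem_cons.mpr ⟨Or.inr hy, hL⟩)
        (List.Sublist.cons_cons _ (List.singleton_sublist.mpr hc)) hy hpc
    -- Splits off the terms in which no pair is connected to `y`; otherwise the next letter of the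
    -- block of `y` is selected as a pivot.
    have hcons : ∀ g, chainSum P.absorbPair (fun L =>
        doubledSumLeft P.ι P.ucumulant F (P.absorb y (interleave g)) L) = fun r =>
        (if r = [] then F [P.absorb y (interleave g)] else 0) +
        chainSum P.absorbPair (pivotSum fun u v r => doubledSumLeft P.ι P.ucumulant
          (fun L => F (P.absorb y (interleave g) *
            P.ι (doubledSumRight P.ι P.ucumulant P.ucumulant u v.1) :: L)) v.2 r) r := by
      intro g
      funext r
      cases r with
      | nil => simp [chainSum, pivotSum, doubledSumLeft_nil P.ι P.ucumulant_nil]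
      | cons v r =>
        rw [if_neg (by simp), zero_add]
        simp only [chainSum]
        congr 1
        funext g' L
        exact doubledSumLeft_cons P.ι _ hadd _ (by simp)
    rw [h.chainSum_cons_interleave hF hy hw, gapSum_eq_splitSum]
    simp only [hcons, splitSum_add, chainSum_pivotSum]
    rw [splitSum_ite_right fun g => F [P.absorb y (interleave g)], splitSum_pivotSum]
    congr 1
    refine pivotSum_congr fun u v r e => ?_
    have hl : w.length = u.length + (r.length + 1) := by
      rw [← e, List.length_append, List.length_cons]
    simp only [← e, List.forall_mem_append, List.forall_mem_cons] at hw
    rw [ih r.length (by omega) (hadd.cons _) ?_ hw.2.1.2 hw.2.2 rfl]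
    · have hX := h.moment_interleave_append_eq hw.1 (fun y g hy hg hlt => by
        rw [moment_eq_chainSum]
        exact ih g.length (by omega) P.ucumulant_balanced.add hκ hy hg rfl) hw.2.1.1
      -- The dependence on the leading letter is additive, so the sum expressing the moment of the
      -- first gap can be taken out of that letter.
      let Φ : A →+ B := AddMonoidHom.mk' (fun a => gapSum P.absorbPair (fun g L =>
          doubledSumLeft P.ι P.ucumulant (fun L => F (a :: L))
            (P.absorb v.2 (interleave g)) L) r) (fun a b => by
        rw [← gapSum_add]
        congr 1
        funext g L
        simp only [doubledSumLeft, ← Finset.sum_add_distrib]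
        exact Finset.sum_congr rfl fun t _ => hadd [] a b _)
      have e1 := map_gapSum (Φ.comp ((AddMonoidHom.mulLeft y).comp (P.ι : B →+ A)))
        P.absorbPair (fun g L => P.moment (interleave g) *
          doubledSumRight P.ι P.ucumulant P.ucumulant L v.1) u
      rw [← hX, gapSum_eq_splitSum] at e1
      refine e1.trans ?_
      refine splitSum_congr fun g r' _ => ?_
      congr 1
      funext L
      have e2 : y * P.ι (P.moment (interleave g) *
          doubledSumRight P.ι P.ucumulant P.ucumulant L v.1) =
          P.absorb y (interleave g) * P.ι (doubledSumRight P.ι P.ucumulant P.ucumulant L v.1) := by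
        rw [map_mul, absorb, mul_assoc]
      change gapSum P.absorbPair (fun g' L' => doubledSumLeft P.ι P.ucumulant (fun L'' =>
        F (y * P.ι (P.moment (interleave g) *
          doubledSumRight P.ι P.ucumulant P.ucumulant L v.1) :: L''))
            (P.absorb v.2 (interleave g')) L') r = _
      rw [e2]
      rfl
    · rintro y' L hy' hL ⟨c, hc, hpc⟩
      exact hF _ _ (h.absorb_right hy _) (List.forall_mem_cons.mpr ⟨Or.inr hy', hL⟩)
        ⟨c, List.mem_cons_of_mem _ hc, hpc⟩

theorem FreePair.moment_interleave_eq (h : P.FreePair p q) {w : List (A × A)}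
    (hw : ∀ v ∈ w, p v.1 ∧ q v.2) :
    P.moment (interleave w) =
      chainSum P.absorbPair (krewerasSum P.ι P.ucumulant P.ucumulant) w := by
  rw [h.moment_interleave hw, chainSum_absorb_pair P.ucumulant_balanced.add hw]
  · congr 1
    funext L
    rw [krewerasSum_eq_chainSum P.ι _ P.ucumulant_balanced.add]
  · intro y g hy hg _
    rw [moment_eq_chainSum]
    refine h.chainSum_cons_interleave_eq P.ucumulant_balanced.add ?_ hy hg
    rintro y L hy hL ⟨c, hc, hpc⟩
    exact h.mixed' _ y c (List.forall_mem_cons.mpr ⟨Or.inr hy, hL⟩)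
      (List.Sublist.cons_cons _ (List.singleton_sublist.mpr hc)) hy hpc

/-- Both sides have the same chain sums over pairs: for the products this is the moment-cumulant
formula, as a gap of products has the moment of the interleaved word, and for the sums over `π ∪
Kr(π)` it is `FreePair.moment_interleave_eq`. -/
theorem FreePair.ucumulant_map_mul (h : P.FreePair p q) {w : List (A × A)} (hw0 : w ≠ [])
    (hw : ∀ v ∈ w, p v.1 ∧ q v.2) :
    P.ucumulant (w.map fun v => v.1 * v.2) = krewerasSum P.ι P.ucumulant P.ucumulant w := by
  refine eq_of_chainSum_eq (h := P.absorbPair)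
    (F := fun w => P.ucumulant (w.map fun v => v.1 * v.2)) (fun v => p v.1 ∧ q v.2)
    (fun v g hv _ => ⟨hv.1, h.absorb_right hv.2 _⟩) (fun v _ => by simp [absorbPair])
    (fun l _ hl => ?_) hw0 hw
  rw [← h.moment_interleave_eq hl, chainSum_comp (fun v : A × A => v.1 * v.2)]
  have e : ∀ g : List (A × A), P.moment (g.map fun v => v.1 * v.2) = P.moment (interleave g) := by
    intro g
    rw [moment, moment]
    congr 1
    induction g with
    | nil => rfl
    | cons v g ih => simp [ih, mul_assoc]
  rw [← e, moment_eq_chainSum, chainSum_map]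
  simp only [absorbPair, absorb, e, mul_assoc]

end NCPSpace

/-! ### Free compressions -/

namespace NCPSpace

variable {B A : Type*} [Ring B] [Algebra ℂ B] [Ring A] [Algebra ℂ A] {P : NCPSpace B A}

theorem IsFree.ucumulant_eq_zero {S T : Set A} (h : P.IsFree ![S, T]) {l : List A} {i j : Fin 2}
    (hij : i ≠ j) {a b : A}
    (hl : ∀ c ∈ l, ∃ k, c ∈ Algebra.adjoin ℂ ((![S, T] : Fin 2 → Set A) k ∪ Set.range P.ι))
    (hab : [a, b].Sublist l)
    (ha : a ∈ Algebra.adjoin ℂ ((![S, T] : Fin 2 → Set A) i ∪ Set.range P.ι))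
    (hb : b ∈ Algebra.adjoin ℂ ((![S, T] : Fin 2 → Set A) j ∪ Set.range P.ι)) :
    P.ucumulant l = 0 := by
  have hne : l ≠ [] := by
    rintro rfl
    simp at hab
  obtain ⟨f, hf⟩ := List.sublist_iff_exists_fin_orderEmbedding_get_eq.mp hab
  have h0 : a = l.get (f ⟨0, by simp⟩) := hf ⟨0, by simp⟩
  have h1 : b = l.get (f ⟨1, by simp⟩) := hf ⟨1, by simp⟩
  have hne' : f ⟨0, by simp⟩ ≠ f ⟨1, by simp⟩ := by simp
  generalize f ⟨0, by simp⟩ = m at h0 hne'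
  generalize f ⟨1, by simp⟩ = m' at h1 hne'
  choose k hk using fun n : Fin l.length => hl (l.get n) (List.get_mem l n)
  rw [ucumulant, withUnit_of_ne_nil _ hne, ← List.ofFn_get l]
  -- Elements of `B` lie in both algebras, so the chosen indices need not differ; they are
  -- prescribed at the positions of `a` and `b`.
  refine h l.length (Function.update (Function.update k m i) m' j) l.get (fun n => ?_)
    ⟨m, m', ?_⟩
  · by_cases hn : n = m'
    · subst hn
      rw [Function.update_self, ← h1]
      exact hb
    · rw [Function.update_of_ne hn]
      by_cases hn' : n = m
      · subst hn'
        rw [Function.update_self, ← h0]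
        exact ha
      · rw [Function.update_of_ne hn']
        exact hk n
  · rw [Function.update_self, Function.update_of_ne hne', Function.update_self]
    exact hij

theorem ι_mem_adjoin (S : Set A) (b : B) : P.ι b ∈ Algebra.adjoin ℂ (S ∪ Set.range P.ι) :=
  Algebra.subset_adjoin (Or.inr ⟨b, rfl⟩)

theorem IsFree.freePair {S T : Set A} (h : P.IsFree ![S, T]) :
    P.FreePair (· ∈ Algebra.adjoin ℂ (S ∪ Set.range P.ι))
      (· ∈ Algebra.adjoin ℂ (T ∪ Set.range P.ι)) where
  left_mul _ b ha := mul_mem ha (ι_mem_adjoin S b)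
  right_mul _ b ha := mul_mem ha (ι_mem_adjoin T b)
  mixed _ _ _ hl hab ha hb := h.ucumulant_eq_zero (i := 0) (j := 1) (by decide)
    (fun c hc => (hl c hc).elim (fun h => ⟨0, h⟩) fun h => ⟨1, h⟩) hab ha hb
  mixed' _ _ _ hl hab ha hb := h.ucumulant_eq_zero (i := 1) (j := 0) (by decide)
    (fun c hc => (hl c hc).elim (fun h => ⟨0, h⟩) fun h => ⟨1, h⟩) hab ha hb

theorem FreePair.symm {p q : A → Prop} (h : P.FreePair p q) : P.FreePair q p where
  left_mul := h.right_mul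
  right_mul := h.left_mul
  mixed l a b hl := h.mixed' l a b fun c hc => (hl c hc).symm
  mixed' l a b hl := h.mixed l a b fun c hc => (hl c hc).symm

/-- The first and the last letter are of different kinds and cannot share a block. -/
theorem FreePair.irreducible_interleave {r q : A → Prop} (h : P.FreePair r q) {w : List (A × A)}
    (hw : ∀ v ∈ w, r v.1 ∧ q v.2) : P.irreducible (interleave w) = 0 := by
  rcases List.eq_nil_or_concat' w with rfl | ⟨w, v, rfl⟩
  · rfl
  · simp only [List.forall_mem_append, List.forall_mem_singleton] at hw
    have e : interleave (w ++ [v]) = (interleave w ++ [v.1]) ++ [v.2] := by simp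
    rw [e, irreducible_append_singleton, lastBlock]
    obtain ⟨c, t, ht, hc⟩ : ∃ c t, interleave w ++ [v.1] = c :: t ∧ r c := by
      cases w with
      | nil => exact ⟨v.1, [], rfl, hw.2.1⟩
      | cons v' w => exact ⟨v'.1, _, rfl, (hw.1 v' (by simp)).1⟩
    have hl : ∀ x ∈ c :: t, r x ∨ q x := by
      rw [← ht]
      exact List.forall_mem_append.mpr
        ⟨interleave_mem hw.1, List.forall_mem_singleton.mpr (Or.inl hw.2.1)⟩
    rw [ht]
    rw [List.forall_mem_cons] at hl
    have h0 : gapSum P.absorb (fun _ _ => (0 : B)) t = 0 :=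
      (map_gapSum (0 : B →+ B) P.absorb (fun _ _ => 0) _).symm
    rw [chainSum, ← h0]
    refine gapSum_congr (fun c => r c ∨ q c) (fun c => r c ∨ q c) hl.2 h.absorb_or
      fun g L _ hL => ?_
    refine h.mixed _ (P.absorb c g) v.2 ?_ ?_ (h.absorb_left hc g) hw.2.2
    · exact List.forall_mem_append.mpr ⟨List.forall_mem_cons.mpr ⟨Or.inl (h.absorb_left hc g), hL⟩,
        List.forall_mem_singleton.mpr (Or.inr hw.2.2)⟩
    · exact List.Sublist.cons_cons _ (List.sublist_append_right L [v.2])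

section Idempotent

variable {r q : A → Prop} {p : A}

/-- A leading idempotent that commutes with `B` can be dropped. -/
theorem FreePair.moment_cons_idempotent (h : P.FreePair r q) (hp : IsIdempotentElem p)
    (hpB : ∀ b : B, P.ι b * p = p * P.ι b) (hq : q p) {l : List A} (hl : ∀ a ∈ l, r a)
    (hne : l ≠ []) :
    P.moment (p :: interleave (l.map fun a => (a, p))) =
      P.moment (interleave (l.map fun a => (a, p))) := by
  have hw : ∀ v ∈ l.map (fun a => (a, p)), r v.1 ∧ q v.2 := by
    simp only [List.mem_map]
    rintro _ ⟨a, ha, rfl⟩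
    exact ⟨hl a ha, hq⟩
  have hw2 : ∀ v ∈ l.map (fun a => (a, p)), v.2 = p := by
    simp only [List.mem_map]
    rintro _ ⟨a, ha, rfl⟩
    rfl
  have hwne : l.map (fun a => (a, p)) ≠ [] := by simpa using hne
  generalize l.map (fun a => (a, p)) = w at hw hw2 hwne
  have hint : interleave w ≠ [] := by
    cases w with
    | nil => exact absurd rfl hwne
    | cons v w => simp
  -- The first irreducible factor of the gap behind `p` passes to the left of `p`, which commutes
  -- with `B`, and then out of the cumulant.
  have hsplit : ∀ (g L : List A), g ≠ [] → P.ucumulant (P.absorb p g :: L) =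
      splitSum (fun u v => P.irreducible u * P.ucumulant (P.absorb p v :: L)) g := by
    intro g L hg
    rw [absorb, P.moment_eq_splitSum_first hg]
    refine (map_splitSum ((P.ucumulant_balanced.add.headHom L).comp
      ((AddMonoidHom.mulLeft p).comp (P.ι : B →+ A))) _ g).trans ?_
    refine splitSum_congr fun u v _ => ?_
    rw [← P.ucumulant_balanced.left, absorb, ← mul_assoc, hpB, mul_assoc, ← map_mul]
    rfl
  -- An empty gap would put the first `a` into the block of the leading `p`, giving a mixed
  -- cumulant; so the gap may be taken nonempty.
  have e1 : P.moment (p :: interleave w) = gapSum P.absorb (fun g L =>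
      splitSum (fun u v => P.irreducible u * P.ucumulant (P.absorb p v :: L)) g)
        (interleave w) := by
    rw [moment_eq_chainSum, chainSum]
    cases w with
    | nil => exact absurd rfl hwne
    | cons v w =>
      rw [List.forall_mem_cons] at hw
      simp only [interleave_cons, gapSum.eq_2 _ _ v.1]
      refine gapSum_congr (fun c => r c ∨ q c) (fun c => r c ∨ q c)
        (List.forall_mem_cons.mpr ⟨Or.inr hw.1.2, interleave_mem hw.2⟩) h.absorb_or
        fun g L _ hL => ?_
      rw [hsplit _ _ (by simp), h.mixed' (P.absorb p [] :: P.absorb v.1 g :: L) _ _ ?_ (by simp)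
        (h.absorb_right hq []) (h.absorb_left hw.1.1 g)]
      · simp [splitSum]
      · exact List.forall_mem_cons.mpr ⟨Or.inr (h.absorb_right hq []),
          List.forall_mem_cons.mpr ⟨Or.inl (h.absorb_left hw.1.1 g), hL⟩⟩
  have e2 : ∀ u v, gapSum P.absorb (fun g L =>
      P.irreducible u * P.ucumulant (P.absorb p g :: L)) v =
        P.irreducible u * P.moment (p :: v) := by
    intro u v
    rw [moment_eq_chainSum]
    exact (map_gapSum (AddMonoidHom.mulLeft (P.irreducible u)) _ _ v).symm
  rw [e1, gapSum_splitSum_gap P.absorb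
    fun u v L => P.irreducible u * P.ucumulant (P.absorb p v :: L)]
  simp only [e2]
  -- Both moments are now sums over cuts. An irreducible left piece must end with an `a`, so the
  -- right piece begins with a `p`, which absorbs the additional `p` since `p * p = p`.
  rw [P.moment_eq_splitSum_first hint, splitSum_interleave, splitSum_interleave,
    h.irreducible_interleave hw, zero_mul, zero_mul]
  congr 1
  refine pivotSum_congr fun u v s e => ?_
  have hv : v.2 = p := hw2 v (by rw [← e]; simp)
  rw [h.irreducible_interleave fun v hv => hw v (by rw [← e]; simp [hv]), zero_mul, zero_mul, hv]
  congr 2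
  simp only [moment, List.prod_cons]
  rw [← mul_assoc, hp.eq]

/-- The word `a₁, b a₂, …, b a_n`. -/
def scaleTail (P : NCPSpace B A) (b : B) : List A → List A
  | [] => []
  | a :: l => a :: l.map fun c => P.ι b * c

/-- Each `b` moves across the tensor sign to the next letter; the last one leaves the cumulant on
the right. -/
theorem ucumulant_map_mul_right {b : B} (u : List A) (a : A) (l : List A) :
    P.ucumulant (u ++ (a :: l).map fun c => c * P.ι b) =
      P.ucumulant (u ++ P.scaleTail b (a :: l)) * b := by
  induction l generalizing u a with
  | nil => exact P.ucumulant_balanced.right u a b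
  | cons a' l ih =>
    have := ih (u ++ [a]) (P.ι b * a')
    simp only [scaleTail, List.map_cons, List.append_assoc, List.singleton_append] at this ⊢
    rw [← this, P.ucumulant_balanced.mid, mul_assoc]

theorem ucumulant_map_mul_left {b : B} {l : List A} (hl : l ≠ []) :
    P.ucumulant (l.map fun c => P.ι b * c) = b * P.ucumulant (P.scaleTail b l) := by
  cases l with
  | nil => exact absurd rfl hl
  | cons a l => exact P.ucumulant_balanced.left b a _

theorem cornerMk_mul_ι (hp : IsIdempotentElem p) (hpB : ∀ b : B, P.ι b * p = p * P.ι b)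
    (a : A) (b : B) :
    cornerMk hp a * cornerMk hp (P.ι b) = cornerMk hp (a * P.ι b) := by
  refine Subtype.ext ?_
  change (p * a * p) * (p * P.ι b * p) = p * (a * P.ι b) * p
  rw [← hpB b]
  simp only [mul_assoc, hp.eq]
  rw [← mul_assoc p (P.ι b) p, ← hpB b, mul_assoc, hp.eq]

theorem ι_mul_cornerMk (hp : IsIdempotentElem p) (hpB : ∀ b : B, P.ι b * p = p * P.ι b)
    (a : A) (b : B) :
    cornerMk hp (P.ι b) * cornerMk hp a = cornerMk hp (P.ι b * a) := by
  refine Subtype.ext ?_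
  change (p * P.ι b * p) * (p * a * p) = p * (P.ι b * a) * p
  rw [← hpB b]
  simp only [mul_assoc, hp.eq]
  rw [← mul_assoc p p, hp.eq, ← mul_assoc p (P.ι b), ← hpB b]
  simp only [mul_assoc]

variable (hp : IsIdempotentElem p) (hpB : ∀ b : B, P.ι b * p = p * P.ι b) {b₀ : Bˣ}
  (hb₀ : P.φ p = b₀) (hcentral : ∀ b : B, (b₀ : B) * b = b * b₀)

theorem prod_map_cornerMk {A : Type*} [Ring A] {p : A} (hp : IsIdempotentElem p) (l : List A) :
    cornerVal hp (l.map (cornerMk hp)).prod =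
      (p :: interleave (l.map fun a => (a, p))).prod := by
  induction l with
  | nil =>
    change p = _
    simp
  | cons a l ih =>
    have e : cornerVal hp ((a :: l).map (cornerMk hp)).prod =
        (p * a * p) * cornerVal hp (l.map (cornerMk hp)).prod := by
      rw [List.map_cons, List.prod_cons]
      rfl
    rw [e, ih]
    simp only [List.map_cons, interleave_cons, List.prod_cons, mul_assoc]
    rw [← mul_assoc p p, hp.eq]

theorem moment_cons_eq_mul_moment (l : List A) :
    P.moment (p :: interleave (l.map fun a => (a, p))) =
      b₀ * (P.compress hp hpB b₀ hb₀ hcentral).moment (l.map (cornerMk hp)) := by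
  have e : (P.compress hp hpB b₀ hb₀ hcentral).moment (l.map (cornerMk hp)) =
      ((b₀⁻¹ : Bˣ) : B) * P.φ (cornerVal hp (l.map (cornerMk hp)).prod) := rfl
  rw [e, prod_map_cornerMk, Units.mul_inv_cancel_left, moment]

/-- After the leading `p` is dropped, each letter of the first block is followed by a gap `p a p ⋯
p`, worth `b₀` times a compressed moment. Centrality lets the last of these factors cancel the one
relating `φ` to `φ_p`. -/
theorem FreePair.moment_compress (h : P.FreePair r q) (hq : q p) {l : List A}
    (hl : ∀ a ∈ l, r a) (hne : l ≠ []) :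
    (P.compress hp hpB b₀ hb₀ hcentral).moment (l.map (cornerMk hp)) =
      chainSum (fun a g =>
          a * P.ι ((P.compress hp hpB b₀ hb₀ hcentral).moment (g.map (cornerMk hp))))
        (fun L => P.ucumulant (P.scaleTail b₀ L)) l := by
  have e := moment_cons_eq_mul_moment hp hpB hb₀ hcentral
  have h1 := e l
  rw [h.moment_cons_idempotent hp hpB hq hl hne, h.moment_interleave, chainSum_map] at h1
  · refine (Units.mul_right_inj b₀).mp (h1.symm.trans ?_)
    rw [mul_chainSum]
    have e2 : (fun (a : A) (g : List A) =>
        P.absorb (a, p).1 ((a, p).2 :: interleave (g.map fun a => (a, p)))) = fun a g =>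
        (fun c => c * P.ι (b₀ : B)) (a * P.ι ((P.compress hp hpB b₀ hb₀ hcentral).moment
          (g.map (cornerMk hp)))) := by
      funext a g
      simp only [absorb]
      rw [e, hcentral, map_mul, mul_assoc]
    rw [e2, ← chainSum_comp (fun c => c * P.ι (b₀ : B)) fun (a : A) (g : List A) =>
      a * P.ι ((P.compress hp hpB b₀ hb₀ hcentral).moment (g.map (cornerMk hp)))]
    cases l with
    | nil => exact absurd rfl hne
    | cons a l =>
      simp only [chainSum]
      congr 1
      funext g L
      rw [hcentral]
      exact ucumulant_map_mul_right [] _ L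
  · simp only [List.mem_map]
    rintro _ ⟨a, ha, rfl⟩
    exact ⟨hl a ha, hq⟩

/-- The cumulants of the compressed space. -/
theorem FreePair.ucumulant_compress (h : P.FreePair r q) (hq : q p) {l : List A}
    (hl : ∀ a ∈ l, r a) :
    (P.compress hp hpB b₀ hb₀ hcentral).ucumulant (l.map (cornerMk hp)) =
      P.ucumulant (P.scaleTail b₀ l) := by
  by_cases hne : l = []
  · subst hne
    simp [scaleTail]
  refine eq_of_chainSum_eq
    (h := fun a g => a * P.ι ((P.compress hp hpB b₀ hb₀ hcentral).moment (g.map (cornerMk hp))))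
    (F := fun l => (P.compress hp hpB b₀ hb₀ hcentral).ucumulant (l.map (cornerMk hp)))
    (F' := fun l => P.ucumulant (P.scaleTail b₀ l)) r
    (fun a g ha _ => h.left_mul _ _ ha) (fun a _ => by simp) (fun l hne hl => ?_) hne hl
  rw [← h.moment_compress hp hpB hb₀ hcentral hq hl hne, moment_eq_chainSum, chainSum_map,
    chainSum_comp]
  congr 1
  funext a g
  exact (cornerMk_mul_ι hp hpB a _).symm

end Idempotent

end NCPSpace

/-! ### R-transforms of free families and of compressions -/

section Rename

variable {B κ κ' : Type*} [AddCommMonoid B] [Fintype κ] [DecidableEq κ'] {e : κ → κ'}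

theorem BSeries.rename_apply (he : Function.Injective e) (f : BSeries B κ) (n : ℕ)
    (w : Fin (n + 1) → κ) : f.rename e n (fun j => e (w j)) = f n w := by
  rw [BSeries.rename, Finset.sum_eq_single w]
  · intro w' hw' hne
    rw [Finset.mem_filter] at hw'
    exact absurd (funext fun j => he (congrFun hw'.2 j)) hne
  · intro h
    simp at h

theorem BSeries.rename_eq_zero (f : BSeries B κ) {n : ℕ} {w' : Fin (n + 1) → κ'} (j : Fin (n + 1))
    (h : ∀ i, e i ≠ w' j) : f.rename e n w' = 0 := by
  rw [BSeries.rename, Finset.sum_eq_zero]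
  intro w hw
  rw [Finset.mem_filter] at hw
  exact absurd (congrFun hw.2 j) (h (w j))

end Rename

namespace NCPSpace

variable {B A : Type*} [Ring B] [Algebra ℂ B] [Ring A] [Algebra ℂ A] {P : NCPSpace B A}

theorem rTransform_eq_ucumulant {κ : Type*} (x : κ → A) (b : Insertion B κ) (n : ℕ)
    (w : Fin (n + 1) → κ) :
    P.rTransform x b n w = P.ucumulant (List.ofFn (P.letters x b n w)) := by
  rw [rTransform, ucumulant, withUnit_of_ne_nil _ (by simp)]

theorem letters_mem {κ : Type*} {r : A → Prop} (hr : ∀ b a, r a → r (P.ι b * a)) {x : κ → A}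
    {n : ℕ} {w : Fin (n + 1) → κ} {j : Fin (n + 1)} (hx : r (x (w j))) (b : Insertion B κ) :
    r (P.letters x b n w j) := by
  induction j using Fin.cases with
  | zero => exact hx
  | succ j => exact hr _ _ hx

theorem ofFn_letters_mem {κ : Type*} {r : A → Prop} (hr : ∀ b a, r a → r (P.ι b * a)) {x : κ → A}
    (hx : ∀ i, r (x i)) (b : Insertion B κ) (n : ℕ) (w : Fin (n + 1) → κ) :
    ∀ c ∈ List.ofFn (P.letters x b n w), r c := by
  intro c hc
  rw [List.mem_ofFn] at hc
  obtain ⟨j, rfl⟩ := hc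
  exact letters_mem hr (hx _) b

theorem ι_mul_mem_adjoin (S : Set A) (b : B) (a : A)
    (ha : a ∈ Algebra.adjoin ℂ (S ∪ Set.range P.ι)) :
    P.ι b * a ∈ Algebra.adjoin ℂ (S ∪ Set.range P.ι) := mul_mem (ι_mem_adjoin S b) ha

theorem mem_adjoin_union {S : Set A} {a : A} (ha : a ∈ S) :
    a ∈ Algebra.adjoin ℂ (S ∪ Set.range P.ι) := Algebra.subset_adjoin (Or.inl ha)

theorem scaleTail_ofFn_letters {κ : Type*} (x : κ → A) (b : Insertion B κ) (n : ℕ)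
    (w : Fin (n + 1) → κ) (b₀ : B) :
    P.scaleTail b₀ (List.ofFn (P.letters x b n w)) =
      List.ofFn (P.letters x (fun n w j => b₀ * b n w j) n w) := by
  simp only [List.ofFn_succ, letters, Fin.cons_zero, Fin.cons_succ, scaleTail, List.map_ofFn,
    Function.comp_def, map_mul, mul_assoc]

/-! #### Sums of free families -/

theorem _root_.ListAdditive.head {A B : Type*} [AddCommMonoid A] [AddCommMonoid B]
    {F : List A → B} (hF : ListAdditive F) (a b : A) (l : List A) :
    F ((a + b) :: l) = F (a :: l) + F (b :: l) := hF [] a b l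

theorem _root_.ListAdditive.map_add_eq_zero {A B : Type*} [AddCommMonoid A] [AddCommMonoid B]
    {F : List A → B} (hF : ListAdditive F) (r : A → Prop)
    (h0 : ∀ L, (∀ c ∈ L, r c) → F L = 0) {w : List (A × A)} (hw : ∀ v ∈ w, r v.1 ∧ r v.2) :
    F (w.map fun v => v.1 + v.2) = 0 := by
  induction w generalizing F with
  | nil => exact h0 [] (by simp)
  | cons v w ih =>
    rw [List.forall_mem_cons] at hw
    rw [List.map_cons, hF.head]
    rw [ih (hF.cons v.1) (fun L hL => h0 _ (List.forall_mem_cons.mpr ⟨hw.1.1, hL⟩)) hw.2,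
      ih (hF.cons v.2) (fun L hL => h0 _ (List.forall_mem_cons.mpr ⟨hw.1.2, hL⟩)) hw.2, add_zero]

theorem _root_.ListAdditive.map_add_eq_map_fst {A B : Type*} [AddCommMonoid A] [AddCommMonoid B]
    {F : List A → B} (hF : ListAdditive F)
    {p q : A → Prop} (h0 : ∀ L, (∀ c ∈ L, p c ∨ q c) → (∃ c ∈ L, q c) → F L = 0)
    {w : List (A × A)} (hw : ∀ v ∈ w, p v.1 ∧ q v.2) :
    F (w.map fun v => v.1 + v.2) = F (w.map Prod.fst) := by
  induction w generalizing F with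
  | nil => rfl
  | cons v w ih =>
    rw [List.forall_mem_cons] at hw
    rw [List.map_cons, hF.head]
    rw [ih (hF.cons v.1) (fun L hL ⟨c, hc, hq⟩ => h0 _
        (List.forall_mem_cons.mpr ⟨Or.inl hw.1.1, hL⟩) ⟨c, List.mem_cons_of_mem _ hc, hq⟩) hw.2,
      (hF.cons v.2).map_add_eq_zero (fun c => p c ∨ q c) (fun L hL => h0 _
        (List.forall_mem_cons.mpr ⟨Or.inr hw.1.2, hL⟩) ⟨v.2, by simp, hw.1.2⟩)
        (fun v hv => ⟨Or.inl (hw.2 v hv).1, Or.inr (hw.2 v hv).2⟩), add_zero]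
    rfl

/-- Multilinear expansion leaves only the two pure terms: once the first letter is of one kind, any
later letter of the other kind gives zero. -/
theorem FreePair.ucumulant_map_add {p q : A → Prop} (h : P.FreePair p q) {w : List (A × A)}
    (hw0 : w ≠ []) (hw : ∀ v ∈ w, p v.1 ∧ q v.2) :
    P.ucumulant (w.map fun v => v.1 + v.2) =
      P.ucumulant (w.map Prod.fst) + P.ucumulant (w.map Prod.snd) := by
  cases w with
  | nil => exact absurd rfl hw0
  | cons v w =>
    rw [List.forall_mem_cons] at hw
    have hadd := P.ucumulant_balanced.add
    have e1 := (hadd.cons v.1).map_add_eq_map_fst (p := p) (q := q) (w := w)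
      (fun L hL ⟨c, hc, hq⟩ => h.mixed _ v.1 c (List.forall_mem_cons.mpr ⟨Or.inl hw.1.1, hL⟩)
        (List.Sublist.cons_cons _ (List.singleton_sublist.mpr hc)) hw.1.1 hq) hw.2
    have e2 := (hadd.cons v.2).map_add_eq_map_fst (p := q) (q := p) (w := w.map Prod.swap)
      (fun L hL ⟨c, hc, hq⟩ => h.mixed' _ v.2 c
        (List.forall_mem_cons.mpr ⟨Or.inr hw.1.2, fun c hc => (hL c hc).symm⟩)
        (List.Sublist.cons_cons _ (List.singleton_sublist.mpr hc)) hw.1.2 hq)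
      (by
        simp only [List.mem_map]
        rintro _ ⟨v, hv, rfl⟩
        exact ⟨(hw.2 v hv).2, (hw.2 v hv).1⟩)
    simp only [List.map_map, Function.comp_def, Prod.fst_swap, Prod.snd_swap] at e2
    simp only [add_comm (Prod.snd _)] at e2
    rw [List.map_cons, hadd.head]
    rw [e1, e2]
    rfl

theorem FreePair.rTransform_add {κ : Type*} {p q : A → Prop} (h : P.FreePair p q)
    (hp : ∀ b a, p a → p (P.ι b * a)) (hq : ∀ b a, q a → q (P.ι b * a)) {x y : κ → A}
    (hx : ∀ i, p (x i)) (hy : ∀ i, q (y i)) (b : Insertion B κ) :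
    P.rTransform (fun i => x i + y i) b = P.rTransform x b + P.rTransform y b := by
  funext n w
  rw [Pi.add_apply, Pi.add_apply]
  simp only [rTransform_eq_ucumulant]
  have e := h.ucumulant_map_add
    (w := List.ofFn fun j => (P.letters x b n w j, P.letters y b n w j)) (by simp) (by
      intro v hv
      rw [List.mem_ofFn] at hv
      obtain ⟨j, rfl⟩ := hv
      exact ⟨letters_mem hp (hx _) b, letters_mem hq (hy _) b⟩)
  simp only [List.map_ofFn, Function.comp_def] at e
  rw [← e]
  congr 2
  funext j
  induction j using Fin.cases with
  | zero => rfl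
  | succ j => exact mul_add _ _ _

theorem IsFree.rTransform_append_eq_zero {s t : ℕ} {x : Fin s → A} {y : Fin t → A}
    (h : P.IsFree ![Set.range x, Set.range y]) (b : Insertion B (Fin (s + t))) {n : ℕ}
    {w : Fin (n + 1) → Fin (s + t)} {j k : Fin (n + 1)} {u : Fin s} {v : Fin t}
    (hj : w j = Fin.castAdd t u) (hk : w k = Fin.natAdd s v) :
    P.rTransform (Fin.append x y) b n w = 0 := by
  refine h (n + 1) (fun j => Fin.addCases (fun _ => 0) (fun _ => 1) (w j)) _ (fun m => ?_)
    ⟨j, k, ?_⟩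
  · refine letters_mem (r := (· ∈ Algebra.adjoin ℂ (_ ∪ Set.range P.ι)))
      (ι_mul_mem_adjoin _) (mem_adjoin_union ?_) b
    generalize w m = i
    induction i using Fin.addCases with
    | left i => simp
    | right i => simp
  · simp [hj, hk]

/-! #### Compressions -/

section Idempotent

variable {r q : A → Prop} {p : A} (hp : IsIdempotentElem p)
  (hpB : ∀ b : B, P.ι b * p = p * P.ι b) {b₀ : Bˣ}
  (hb₀ : P.φ p = b₀) (hcentral : ∀ b : B, (b₀ : B) * b = b * b₀)

theorem letters_compress {κ : Type*} (x : κ → A) (b : Insertion B κ) (n : ℕ)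
    (w : Fin (n + 1) → κ) (j : Fin (n + 1)) :
    (P.compress hp hpB b₀ hb₀ hcentral).letters (fun i => cornerMk hp (x i)) b n w j =
      cornerMk hp (P.letters x b n w j) := by
  induction j using Fin.cases with
  | zero => rfl
  | succ j => exact ι_mul_cornerMk hp hpB _ _

theorem FreePair.rTransform_compress {κ : Type*} (h : P.FreePair r q) (hq : q p)
    (hr : ∀ b a, r a → r (P.ι b * a)) {x : κ → A} (hx : ∀ i, r (x i)) (b : Insertion B κ) :
    (P.compress hp hpB b₀ hb₀ hcentral).rTransform (fun i => cornerMk hp (x i)) b =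
      P.rTransform x (fun n w j => (b₀ : B) * b n w j) := by
  funext n w
  rw [rTransform_eq_ucumulant, rTransform_eq_ucumulant, ← scaleTail_ofFn_letters,
    ← h.ucumulant_compress hp hpB hb₀ hcentral hq (ofFn_letters_mem hr hx b n w), List.map_ofFn]
  congr 2
  funext j
  exact letters_compress hp hpB hb₀ hcentral x b n w j

theorem exists_map_cornerMk {A : Type*} [Ring A] {p : A} (hp : IsIdempotentElem p) {r : A → Prop}
    {l : List hp.Corner} (hl : ∀ c ∈ l, ∃ a, r a ∧ c = cornerMk hp a) :
    ∃ l' : List A, (∀ a ∈ l', r a) ∧ l = l'.map (cornerMk hp) := by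
  induction l with
  | nil => exact ⟨[], by simp, rfl⟩
  | cons c l ih =>
    rw [List.forall_mem_cons] at hl
    obtain ⟨a, ha, rfl⟩ := hl.1
    obtain ⟨l', hl', rfl⟩ := ih hl.2
    exact ⟨a :: l', List.forall_mem_cons.mpr ⟨ha, hl'⟩, rfl⟩

/-- The mixed cumulants of the compressions of free families vanish. -/
theorem FreePair.ucumulant_compress_eq_zero (h : P.FreePair r q) (hq : q p) {r₁ r₂ : A → Prop}
    (h₁ : ∀ a, r₁ a → r a) (h₂ : ∀ a, r₂ a → r a)
    (h₁' : ∀ b a, r₁ a → r₁ (P.ι b * a)) (h₂' : ∀ b a, r₂ a → r₂ (P.ι b * a))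
    (hmixed : ∀ l a b, (∀ c ∈ l, r₁ c ∨ r₂ c) → [a, b].Sublist l → r₁ a → r₂ b →
      P.ucumulant l = 0)
    {l : List hp.Corner} {a b : hp.Corner}
    (hl : ∀ c ∈ l, (∃ a, r₁ a ∧ c = cornerMk hp a) ∨ ∃ a, r₂ a ∧ c = cornerMk hp a)
    (hab : [a, b].Sublist l) (ha : ∃ a', r₁ a' ∧ a = cornerMk hp a')
    (hb : ∃ b', r₂ b' ∧ b = cornerMk hp b') :
    (P.compress hp hpB b₀ hb₀ hcentral).ucumulant l = 0 := by
  obtain ⟨a, ha, rfl⟩ := ha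
  obtain ⟨b, hb, rfl⟩ := hb
  obtain ⟨l₁, l', rfl, h1, hab'⟩ := List.cons_sublist_iff.mp hab
  obtain ⟨l₂, l₃, rfl⟩ := List.append_of_mem h1
  rw [List.singleton_sublist] at hab'
  obtain ⟨l₄, l₅, rfl⟩ := List.append_of_mem hab'
  have hl' : ∀ c ∈ l₂ ++ cornerMk hp a :: (l₃ ++ (l₄ ++ cornerMk hp b :: l₅)),
      ∃ a, (r₁ a ∨ r₂ a) ∧ c = cornerMk hp a := by
    intro c hc
    rcases hl c (by simpa using hc) with ⟨a, ha, e⟩ | ⟨a, ha, e⟩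
    · exact ⟨a, Or.inl ha, e⟩
    · exact ⟨a, Or.inr ha, e⟩
  simp only [List.forall_mem_append, List.forall_mem_cons] at hl'
  obtain ⟨k₂, hk₂, rfl⟩ := exists_map_cornerMk (r := fun a => r₁ a ∨ r₂ a) hp hl'.1
  obtain ⟨k₃, hk₃, rfl⟩ := exists_map_cornerMk (r := fun a => r₁ a ∨ r₂ a) hp hl'.2.2.1
  obtain ⟨k₄, hk₄, rfl⟩ := exists_map_cornerMk (r := fun a => r₁ a ∨ r₂ a) hp hl'.2.2.2.1
  obtain ⟨k₅, hk₅, rfl⟩ := exists_map_cornerMk (r := fun a => r₁ a ∨ r₂ a) hp hl'.2.2.2.2.2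
  obtain ⟨k, hk⟩ : ∃ k, k = k₂ ++ a :: (k₃ ++ (k₄ ++ b :: k₅)) := ⟨_, rfl⟩
  have hkr : ∀ c ∈ k, r₁ c ∨ r₂ c := by
    rw [hk]
    simp only [List.forall_mem_append, List.forall_mem_cons]
    exact ⟨hk₂, Or.inl ha, hk₃, hk₄, Or.inr hb, hk₅⟩
  have e : k₂.map (cornerMk hp) ++ cornerMk hp a :: k₃.map (cornerMk hp) ++
      (k₄.map (cornerMk hp) ++ cornerMk hp b :: k₅.map (cornerMk hp)) = k.map (cornerMk hp) := by
    simp [hk]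
  rw [e, h.ucumulant_compress hp hpB hb₀ hcentral hq fun c hc => (hkr c hc).elim (h₁ c) (h₂ c)]
  -- After multiplication by `b₀` every letter carries the factor `b₀`, so the word is a uniform
  -- image of `k` and the vanishing of mixed cumulants applies.
  refine (Units.mul_right_inj b₀).mp ?_
  rw [← ucumulant_map_mul_left (by simp [hk]), mul_zero]
  refine hmixed _ (P.ι b₀ * a) (P.ι b₀ * b) ?_ ?_ (h₁' _ _ ha) (h₂' _ _ hb)
  · simp only [List.mem_map]
    rintro _ ⟨c, hc, rfl⟩
    exact (hkr c hc).imp (h₁' _ _) (h₂' _ _)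
  · have : [a, b].Sublist k := by
      rw [hk]
      refine List.Sublist.trans ?_ (List.sublist_append_right _ _)
      refine List.Sublist.cons_cons _ (List.singleton_sublist.mpr ?_)
      simp
    exact this.map _

theorem FreePair.freePair_compress (h : P.FreePair r q) (hq : q p) {r₁ r₂ : A → Prop}
    (h₁ : ∀ a, r₁ a → r a) (h₂ : ∀ a, r₂ a → r a)
    (h₁' : ∀ b a, r₁ a → r₁ (P.ι b * a)) (h₂' : ∀ b a, r₂ a → r₂ (P.ι b * a))
    (h₁₂ : P.FreePair r₁ r₂) :
    (P.compress hp hpB b₀ hb₀ hcentral).FreePair (fun c => ∃ a, r₁ a ∧ c = cornerMk hp a)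
      (fun c => ∃ a, r₂ a ∧ c = cornerMk hp a) where
  left_mul := by
    rintro _ b ⟨a, ha, rfl⟩
    exact ⟨a * P.ι b, h₁₂.left_mul a b ha, cornerMk_mul_ι hp hpB a b⟩
  right_mul := by
    rintro _ b ⟨a, ha, rfl⟩
    exact ⟨a * P.ι b, h₁₂.right_mul a b ha, cornerMk_mul_ι hp hpB a b⟩
  mixed l a b hl hab ha hb := h.ucumulant_compress_eq_zero hp hpB hb₀ hcentral hq h₁ h₂ h₁' h₂'
    h₁₂.mixed hl hab ha hb
  mixed' l a b hl hab ha hb := h.ucumulant_compress_eq_zero hp hpB hb₀ hcentral hq h₂ h₁ h₂' h₁'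
    (fun l a b hl => h₁₂.mixed' l a b fun c hc => (hl c hc).symm) (fun c hc => (hl c hc).symm)
    hab ha hb

end Idempotent

/-- The R-transform of the products of two free families. -/
theorem FreePair.rTransform_mul {κ : Type*} {p q : A → Prop} (h : P.FreePair p q)
    (hp : ∀ b a, p a → p (P.ι b * a)) (hq : ∀ b a, q a → q (P.ι b * a)) {x y : κ → A}
    (hx : ∀ i, p (x i)) (hy : ∀ i, q (y i)) (b : Insertion B κ) :
    P.rTransform (fun i => x i * y i) b = P.boxedConv x y b (fun _ _ _ => 1) := by
  funext n w
  rw [rTransform_eq_ucumulant, boxedConv_eq_krewerasSum]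
  refine Eq.trans ?_ (h.ucumulant_map_mul
    (w := List.ofFn fun j => (P.letters x b n w j, P.letters y (fun _ _ _ => 1) n w j)) (by simp)
    (by
      intro v hv
      rw [List.mem_ofFn] at hv
      obtain ⟨j, rfl⟩ := hv
      exact ⟨letters_mem hp (hx _) b, letters_mem hq (hy (w j)) fun _ _ _ => 1⟩))
  rw [List.map_ofFn]
  congr 2
  funext j
  induction j using Fin.cases with
  | zero => rfl
  | succ j =>
    simp only [letters, Fin.cons_succ, Function.comp_apply, map_one, one_mul, mul_assoc]

end NCPSpace

namespace NCPSpace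

open BinaryTree

variable {B A : Type*} [Ring B] [Algebra ℂ B] [Ring A] [Algebra ℂ A] {P : NCPSpace B A}

/-! ### Boxed convolutions in a compressed space -/

/-- Every other letter of the word is multiplied by `b` from the left, beginning with the first
letter if `s` is true and with the second one otherwise. -/
def scaleAlternate (P : NCPSpace B A) (b : B) : Bool → List A → List A
  | _, [] => []
  | true, a :: l => P.ι b * a :: P.scaleAlternate b false l
  | false, a :: l => a :: P.scaleAlternate b true l

theorem take_scaleAlternate (b : B) (s : Bool) (n : ℕ) (l : List A) :
    (P.scaleAlternate b s l).take n = P.scaleAlternate b s (l.take n) := by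
  induction l generalizing s n with
  | nil => simp [scaleAlternate]
  | cons a l ih => cases n <;> cases s <;> simp [scaleAlternate, ih]

theorem drop_scaleAlternate (b : B) (s : Bool) (n : ℕ) (l : List A) :
    (P.scaleAlternate b s l).drop (2 * n + 1) =
      P.scaleAlternate b (!s) (l.drop (2 * n + 1)) := by
  have h1 : ∀ s l, (P.scaleAlternate b s l).drop 1 = P.scaleAlternate b (!s) (l.drop 1) := by
    intro s l
    cases l <;> cases s <;> simp [scaleAlternate]
  induction n with
  | zero => exact h1 s l
  | succ n ih =>
    have h2 : ∀ l : List A, l.drop (2 * (n + 1) + 1) = ((l.drop (2 * n + 1)).drop 1).drop 1 := by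
      intro l
      rw [List.drop_drop, List.drop_drop]
      rfl
    rw [h2, h2, ih, h1, h1, Bool.not_not]

theorem scaleAlternate_interleave (b : B) (w : List (A × A)) :
    P.scaleAlternate b true (interleave w) =
      interleave (w.map fun v => (P.ι b * v.1, v.2)) := by
  induction w with
  | nil => rfl
  | cons v w ih => simp [scaleAlternate, ih]

theorem outerLetters_mem {A B : Type*} [Ring A] {ι : B → A} {g : List A → B} {r : A → Prop}
    (hr : ∀ a b, r a → r (a * ι b)) (t : BinaryTree Unit) {l : List A} (hl : ∀ a ∈ l, r a) :
    ∀ a ∈ outerLetters ι g t l, r a := by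
  induction t generalizing l with
  | nil => simp [outerLetters]
  | node _ t₁ t₂ h₁ h₂ =>
    cases l with
    | nil => simp [outerLetters]
    | cons a l =>
      rw [List.forall_mem_cons] at hl
      rw [outerLetters, List.forall_mem_cons]
      exact ⟨hr _ _ hl.1, h₂ fun c hc => hl.2 c (List.mem_of_mem_drop hc)⟩

theorem outerLetters_ne_nil {A B : Type*} [Ring A] {ι : B → A} {g : List A → B}
    {t : BinaryTree Unit} (ht : t ≠ nil) {l : List A} (hl : l ≠ []) :
    outerLetters ι g t l ≠ [] := by
  cases t with
  | nil => exact absurd rfl ht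
  | node _ t₁ t₂ =>
    cases l with
    | nil => exact absurd rfl hl
    | cons a l => simp [outerLetters]

section Scaling

variable {r : A → Prop} {b₀ : B} {g : List A → B}

/-- The gaps of a doubled tree have odd length, so its outer block meets letters of one kind only,
and the two claims alternate with the depth. If the outer letters are scaled, the gaps keep their
compressed values. If not, each gap yields a factor `b₀`, which is central in `B` and moves in front
of the next outer letter; a next letter exists because the block reaches the end of the word. -/
theorem outerLetters_doubledTree_scaleAlternate (hcentral : ∀ b, b₀ * b = b * b₀)
    (hr : ∀ a b, r a → r (a * P.ι b))
    (hg : ∀ l, (∀ a ∈ l, r a) → g l = P.ucumulant (P.scaleTail b₀ l)) (t : BinaryTree Unit)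
    {l : List A} (hl : ∀ a ∈ l, r a) (hlen : l.length = (doubledTree t).numNodes) :
    outerLetters P.ι P.ucumulant (doubledTree t) (P.scaleAlternate b₀ true l) =
        (outerLetters P.ι g (doubledTree t) l).map (fun c => P.ι b₀ * c) ∧
      ∀ u, P.ucumulant
          (u ++ outerLetters P.ι P.ucumulant (doubledTree t) (P.scaleAlternate b₀ false l)) =
        P.ucumulant (u ++ P.scaleTail b₀ (outerLetters P.ι g (doubledTree t) l)) := by
  have hg0 : g [] = 1 := by rw [hg [] (by simp), scaleTail, ucumulant_nil]
  induction t generalizing l with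
  | nil =>
    obtain ⟨a, rfl⟩ := List.length_eq_one_iff.mp hlen
    simp [doubledTree, outerLetters, scaleAlternate, scaleTail, hg0]
  | node _ t₁ t₂ h₁ h₂ =>
    cases l with
    | nil => simp [doubledTree] at hlen
    | cons a l =>
      rw [List.forall_mem_cons] at hl
      have hn₁ := numNodes_doubledTree t₁
      have hn₂ := numNodes_doubledTree t₂
      simp only [doubledTree, numNodes, List.length_cons] at hlen
      have hl₁ : ∀ a ∈ l.take (doubledTree t₁).numNodes, r a :=
        fun c hc => hl.2 c (List.mem_of_mem_take hc)
      have hl₂ : ∀ a ∈ l.drop (doubledTree t₁).numNodes, r a :=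
        fun c hc => hl.2 c (List.mem_of_mem_drop hc)
      have hO₁ := outerLetters_mem (g := g) hr (doubledTree t₁) hl₁
      obtain ⟨e₁, e₁'⟩ := h₁ hl₁ (by rw [List.length_take]; omega)
      obtain ⟨e₂, e₂'⟩ := h₂ hl₂ (by rw [List.length_drop]; omega)
      have hd : ∀ s, (P.scaleAlternate b₀ s l).drop (doubledTree t₁).numNodes =
          P.scaleAlternate b₀ (!s) (l.drop (doubledTree t₁).numNodes) := by
        rw [hn₁]
        exact fun s => drop_scaleAlternate b₀ s _ l
      have hne₁ : outerLetters P.ι g (doubledTree t₁) (l.take (doubledTree t₁).numNodes) ≠ [] := by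
        refine outerLetters_ne_nil (by cases t₁ <;> simp [doubledTree])
          (List.ne_nil_of_length_pos ?_)
        rw [List.length_take]; omega
      have hne₂ : outerLetters P.ι g (doubledTree t₂) (l.drop (doubledTree t₁).numNodes) ≠ [] := by
        refine outerLetters_ne_nil (by cases t₂ <;> simp [doubledTree])
          (List.ne_nil_of_length_pos ?_)
        rw [List.length_drop]; omega
      constructor
      · simp only [doubledTree, scaleAlternate, outerLetters, take_scaleAlternate, hd,
          Bool.not_false, e₂, List.map_cons, mul_assoc]
        have := e₁' []
        simp only [List.nil_append] at this
        rw [this, hg _ hO₁]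
      · intro u
        simp only [doubledTree, scaleAlternate, outerLetters, take_scaleAlternate, hd,
          Bool.not_true, e₁, ucumulant_map_mul_left hne₁]
        rw [← hg _ hO₁, hcentral, map_mul, ← mul_assoc]
        have := e₂' (u ++ [a * P.ι (g (outerLetters P.ι g (doubledTree t₁)
          (l.take (doubledTree t₁).numNodes))) * P.ι b₀])
        simp only [List.append_assoc, List.singleton_append] at this
        rw [this]
        obtain ⟨c, l', hl'⟩ := List.exists_cons_of_ne_nil hne₂
        rw [hl', scaleTail, P.ucumulant_balanced.mid]
        rfl

theorem outerLetters_krewerasTree_scaleAlternate (hcentral : ∀ b, b₀ * b = b * b₀)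
    (hr : ∀ a b, r a → r (a * P.ι b))
    (hg : ∀ l, (∀ a ∈ l, r a) → g l = P.ucumulant (P.scaleTail b₀ l)) (t : BinaryTree Unit)
    {l : List A} (hl : ∀ a ∈ l, r a) (hlen : l.length = (krewerasTree t).numNodes) :
    outerLetters P.ι P.ucumulant (krewerasTree t) (P.scaleAlternate b₀ true l) =
        (outerLetters P.ι g (krewerasTree t) l).map (fun c => P.ι b₀ * c) := by
  induction t generalizing l with
  | nil => rfl
  | node _ t₁ t₂ _ h₂ =>
    cases l with
    | nil => simp [krewerasTree] at hlen
    | cons a l =>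
      rw [List.forall_mem_cons] at hl
      have hn₁ := numNodes_doubledTree t₁
      simp only [krewerasTree, numNodes, List.length_cons] at hlen
      have hl₁ : ∀ a ∈ l.take (doubledTree t₁).numNodes, r a :=
        fun c hc => hl.2 c (List.mem_of_mem_take hc)
      have e₁ := (outerLetters_doubledTree_scaleAlternate hcentral hr hg t₁ hl₁
        (by rw [List.length_take]; omega)).2 []
      have e₂ := h₂ (l := l.drop (doubledTree t₁).numNodes)
        (fun c hc => hl.2 c (List.mem_of_mem_drop hc)) (by rw [List.length_drop]; omega)
      have hd : (P.scaleAlternate b₀ false l).drop (doubledTree t₁).numNodes =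
          P.scaleAlternate b₀ true (l.drop (doubledTree t₁).numNodes) := by
        rw [hn₁]
        exact drop_scaleAlternate b₀ false _ l
      simp only [List.nil_append] at e₁
      simp only [krewerasTree, scaleAlternate, outerLetters, take_scaleAlternate, hd, e₂,
        List.map_cons, mul_assoc, e₁, hg _ (outerLetters_mem (g := g) hr (doubledTree t₁) hl₁)]

end Scaling

theorem krewerasSum_cons_left (b : B) (v : A × A) (w : List (A × A)) :
    krewerasSum P.ι P.ucumulant P.ucumulant ((P.ι b * v.1, v.2) :: w) =
      b * krewerasSum P.ι P.ucumulant P.ucumulant (v :: w) := by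
  rw [krewerasSum_eq_chainSum _ _ P.ucumulant_balanced.add,
    krewerasSum_eq_chainSum _ _ P.ucumulant_balanced.add, mul_chainSum]
  simp only [chainSum, mul_assoc, P.ucumulant_balanced.left]

section Idempotent

variable {r q : A → Prop} {p : A} (hp : IsIdempotentElem p)
  (hpB : ∀ b : B, P.ι b * p = p * P.ι b) {b₀ : Bˣ}
  (hb₀ : P.φ p = b₀) (hcentral : ∀ b : B, (b₀ : B) * b = b * b₀)

theorem outerLetters_map_cornerMk (t : BinaryTree Unit) (l : List A) :
    outerLetters (P.compress hp hpB b₀ hb₀ hcentral).ι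
        (P.compress hp hpB b₀ hb₀ hcentral).ucumulant t (l.map (cornerMk hp)) =
      (outerLetters P.ι (fun L => (P.compress hp hpB b₀ hb₀ hcentral).ucumulant
        (L.map (cornerMk hp))) t l).map (cornerMk hp) := by
  induction t generalizing l with
  | nil => rfl
  | node _ t₁ t₂ h₁ h₂ =>
    cases l with
    | nil => rfl
    | cons a l =>
      simp only [List.map_cons, outerLetters, ← List.map_take, ← List.map_drop, h₁, h₂]
      congr 1
      exact cornerMk_mul_ι hp hpB _ _

theorem FreePair.krewerasSum_scale (h : P.FreePair r q) (hq : q p) {w : List (A × A)}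
    (hw0 : w ≠ []) (hw : ∀ v ∈ w, r v.1 ∧ r v.2) :
    krewerasSum P.ι P.ucumulant P.ucumulant (w.map fun v => (P.ι b₀ * v.1, v.2)) =
      b₀ * krewerasSum (P.compress hp hpB b₀ hb₀ hcentral).ι
        (P.compress hp hpB b₀ hb₀ hcentral).ucumulant
        (P.compress hp hpB b₀ hb₀ hcentral).ucumulant
        (w.map fun v => (cornerMk hp v.1, cornerMk hp v.2)) := by
  have hl : ∀ c ∈ interleave w, r c := fun c hc => (interleave_mem hw c hc).elim id id
  have hg : ∀ l : List A, (∀ a ∈ l, r a) →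
      (P.compress hp hpB b₀ hb₀ hcentral).ucumulant (l.map (cornerMk hp)) =
        P.ucumulant (P.scaleTail b₀ l) :=
    fun l hl => h.ucumulant_compress hp hpB hb₀ hcentral hq hl
  have hint : interleave (w.map fun v => (cornerMk hp v.1, cornerMk hp v.2)) =
      (interleave w).map (cornerMk hp) := by
    simp [interleave, List.flatMap_def, List.map_flatten, Function.comp_def]
  simp only [krewerasSum, List.length_map, Finset.mul_sum]
  refine Finset.sum_congr rfl fun t ht => ?_
  rw [mem_treesOfNumNodesEq] at ht
  rw [hint, outerLetters_map_cornerMk,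
    hg _ (outerLetters_mem (fun a b => h.left_mul a b) _ hl), ← scaleAlternate_interleave,
    outerLetters_krewerasTree_scaleAlternate hcentral (fun a b => h.left_mul a b) hg t hl
      (by rw [length_interleave, numNodes_krewerasTree, ht]), ucumulant_map_mul_left]
  have hlen := List.length_pos_of_ne_nil hw0
  refine outerLetters_ne_nil ?_ (List.ne_nil_of_length_pos (by rw [length_interleave]; omega))
  rintro e
  have := numNodes_krewerasTree t
  rw [e, ht] at this
  simp [numNodes] at this
  exact hw0 this

/-- The boxed convolution in the compressed space, expressed in the original space. -/
theorem FreePair.boxedConv_compress {κ : Type*} (h : P.FreePair r q) (hq : q p)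
    (hr : ∀ b a, r a → r (P.ι b * a)) {x y : κ → A} (hx : ∀ i, r (x i)) (hy : ∀ i, r (y i))
    (b b' : Insertion B κ) :
    (P.compress hp hpB b₀ hb₀ hcentral).boxedConv (fun i => cornerMk hp (x i))
        (fun i => cornerMk hp (y i)) b b' =
      P.boxedConv x y (fun n w j => (b₀ : B) * b n w j) b' := by
  funext n w
  rw [boxedConv_eq_krewerasSum, boxedConv_eq_krewerasSum]
  -- Multiplication by `b₀` also scales the first `x`, which brings the right side to the uniform
  -- form of `krewerasSum_scale`.
  refine (Units.mul_right_inj b₀).mp ?_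
  have e1 := h.krewerasSum_scale hp hpB hb₀ hcentral hq
    (w := List.ofFn fun j => (P.letters x b n w j, P.letters y b' n w j)) (by simp) (by
      intro v hv
      rw [List.mem_ofFn] at hv
      obtain ⟨j, rfl⟩ := hv
      exact ⟨letters_mem hr (hx (w j)) b, letters_mem hr (hy (w j)) b'⟩)
  simp only [List.map_ofFn, Function.comp_def,
    ← letters_compress hp hpB hb₀ hcentral] at e1
  refine e1.symm.trans ?_
  rw [List.ofFn_succ, List.ofFn_succ]
  refine Eq.trans ?_ (krewerasSum_cons_left (b₀ : B) _ _)
  simp only [letters, Fin.cons_zero, Fin.cons_succ, map_mul, mul_assoc]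

end Idempotent

end NCPSpace

/-! ### The theorem on free compressions -/

theorem mainTheorem6 {B A : Type*} [Ring B] [Algebra ℂ B] [Ring A] [Algebra ℂ A]
    (P : NCPSpace B A) (s : ℕ) (x y : Fin s → A)
    (hxy : P.IsFree ![Set.range x, Set.range y])
    (p : A) (hp : IsIdempotentElem p)
    (hpB : ∀ b : B, P.ι b * p = p * P.ι b)
    (hpfree : P.IsFree ![{p}, Set.range x ∪ Set.range y])
    (b₀ : Bˣ) (hb₀ : P.φ p = b₀) (hcentral : ∀ b : B, (b₀ : B) * b = b * b₀) :
    let Q : NCPSpace B hp.Corner := P.compress hp hpB b₀ hb₀ hcentral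
    let px : Fin s → hp.Corner := fun i => cornerMk hp (x i)
    let py : Fin s → hp.Corner := fun i => cornerMk hp (y i)
    -- (1), trivial R-transform
    Q.trivialRTransform px = P.symmRTransform x (b₀ : B) ∧
    -- (1), R-transform with arbitrary inserted elements
    (∀ b : Insertion B (Fin s),
      Q.rTransform px b = P.rTransform x (fun n w j => (b₀ : B) * b n w j)) ∧
    -- (2)
    (∀ b : Insertion B (Fin (s + s)),
      Q.rTransform (Fin.append px py) b =
        (Q.rTransform px (fun n w => b n (fun j => Fin.castAdd s (w j)))).rename (Fin.castAdd s) +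
        (Q.rTransform py (fun n w => b n (fun j => Fin.natAdd s (w j)))).rename (Fin.natAdd s)) ∧
    -- (3)
    (∀ b : Insertion B (Fin s),
      Q.rTransform (fun i => px i + py i) b = Q.rTransform px b + Q.rTransform py b) ∧
    -- (4); by (1), the R-transform of `px` in `(pAp, φ_p)` is the one of `x` in `(A, φ)` with `b₀ b`
    -- inserted, and the last factor is the trivial R-transform of `y` in `(A, φ)`
    (∀ b : Insertion B (Fin s),
      Q.rTransform (fun i => px i * py i) b = Q.boxedConv px py b (fun _ _ _ => 1) ∧
      Q.rTransform (fun i => px i * py i) b =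
        P.boxedConv x y (fun n w j => (b₀ : B) * b n w j) (fun _ _ _ => 1)) := by
  intro Q px py
  have hpair := hxy.freePair
  have hcomp := hpfree.freePair.symm
  have hq : p ∈ Algebra.adjoin ℂ ({p} ∪ Set.range P.ι) :=
    NCPSpace.mem_adjoin_union (Set.mem_singleton p)
  have hx : ∀ i, x i ∈ Algebra.adjoin ℂ (Set.range x ∪ Set.range y ∪ Set.range P.ι) :=
    fun i => NCPSpace.mem_adjoin_union (Or.inl ⟨i, rfl⟩)
  have hy : ∀ i, y i ∈ Algebra.adjoin ℂ (Set.range x ∪ Set.range y ∪ Set.range P.ι) :=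
    fun i => NCPSpace.mem_adjoin_union (Or.inr ⟨i, rfl⟩)
  have hx' : ∀ i, x i ∈ Algebra.adjoin ℂ (Set.range x ∪ Set.range P.ι) :=
    fun i => NCPSpace.mem_adjoin_union ⟨i, rfl⟩
  have hy' : ∀ i, y i ∈ Algebra.adjoin ℂ (Set.range y ∪ Set.range P.ι) :=
    fun i => NCPSpace.mem_adjoin_union ⟨i, rfl⟩
  have hR : ∀ {κ : Type} {z : κ → A}
      (_ : ∀ i, z i ∈ Algebra.adjoin ℂ (Set.range x ∪ Set.range y ∪ Set.range P.ι))
      (b : Insertion B κ), Q.rTransform (fun i => cornerMk hp (z i)) b =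
        P.rTransform z (fun n w j => (b₀ : B) * b n w j) := fun hz b =>
    hcomp.rTransform_compress hp hpB hb₀ hcentral hq (NCPSpace.ι_mul_mem_adjoin _) hz b
  refine ⟨?_, hR hx, fun b => ?_, fun b => ?_, fun b => ?_⟩
  · rw [NCPSpace.trivialRTransform, NCPSpace.symmRTransform, hR hx]
    simp only [mul_one]
    rfl
  · have happend : Fin.append px py = fun i => cornerMk hp (Fin.append x y i) := by
      funext i
      induction i using Fin.addCases with
      | left i => simp [px]
      | right i => rw [Fin.append_right, Fin.append_right]
    funext n w
    rw [Pi.add_apply, Pi.add_apply]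
    have hside : ∀ i : Fin (s + s), (∃ u, i = Fin.castAdd s u) ∨ ∃ v, i = Fin.natAdd s v := by
      intro i
      induction i using Fin.addCases with
      | left i => exact Or.inl ⟨i, rfl⟩
      | right i => exact Or.inr ⟨i, rfl⟩
    have hne : ∀ u v : Fin s, Fin.castAdd s u ≠ Fin.natAdd s v := by
      intro u v e
      have := congrArg Fin.val e
      simp only [Fin.val_castAdd, Fin.val_natAdd] at this
      omega
    by_cases h1 : ∀ j, ∃ u, w j = Fin.castAdd s u
    · choose u hu using h1
      obtain rfl : w = fun j => Fin.castAdd s (u j) := funext hu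
      -- Words are nonempty, so letter `0` witnesses that a pure `x`-word has no coefficient in the
      -- `y`-series.
      rw [BSeries.rename_apply (Fin.castAdd_injective s s),
        BSeries.rename_eq_zero _ 0 fun i => (hne _ i).symm, add_zero]
      simp only [NCPSpace.rTransform, NCPSpace.letters, Fin.append_left]
    · by_cases h2 : ∀ j, ∃ v, w j = Fin.natAdd s v
      · choose v hv using h2
        obtain rfl : w = fun j => Fin.natAdd s (v j) := funext hv
        rw [BSeries.rename_apply (Fin.natAdd_injective s s),
          BSeries.rename_eq_zero _ 0 fun i => hne i _, zero_add]
        simp only [NCPSpace.rTransform, NCPSpace.letters, Fin.append_right]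
      · push Not at h1 h2
        obtain ⟨j, hj⟩ := h1
        obtain ⟨k, hk⟩ := h2
        obtain ⟨v, hv⟩ := (hside (w j)).resolve_left fun ⟨u, hu⟩ => hj u hu
        -- For a mixed word both renamed series vanish, and so does the left side, being by (1) a
        -- mixed cumulant of `x` and `y` in `A`.
        obtain ⟨u, hu⟩ := (hside (w k)).resolve_right fun ⟨u, hu⟩ => hk u hu
        rw [BSeries.rename_eq_zero _ j fun i => (hj i).symm,
          BSeries.rename_eq_zero _ k fun i => (hk i).symm, add_zero, happend, hR]
        · exact hxy.rTransform_append_eq_zero _ hu hv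
        · intro i
          induction i using Fin.addCases with
          | left i => simpa using hx i
          | right i => rw [Fin.append_right]; exact hy i
  · have hadd : (fun i => px i + py i) = fun i => cornerMk hp (x i + y i) := by
      funext i
      refine Subtype.ext ?_
      change p * x i * p + p * y i * p = p * (x i + y i) * p
      rw [mul_add, add_mul]
    rw [hadd, hR fun i => add_mem (hx i) (hy i), hR hx, hR hy]
    exact hpair.rTransform_add (NCPSpace.ι_mul_mem_adjoin _) (NCPSpace.ι_mul_mem_adjoin _) hx' hy' _
  · have hfree := hcomp.freePair_compress hp hpB hb₀ hcentral hq
      (fun a ha => Algebra.adjoin_mono (Set.union_subset_union_left _ Set.subset_union_left) ha)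
      (fun a ha => Algebra.adjoin_mono (Set.union_subset_union_left _ Set.subset_union_right) ha)
      (NCPSpace.ι_mul_mem_adjoin _) (NCPSpace.ι_mul_mem_adjoin _) hpair
    have hmul : Q.rTransform (fun i => px i * py i) b = Q.boxedConv px py b (fun _ _ _ => 1) := by
      refine hfree.rTransform_mul ?_ ?_ (fun i => ⟨x i, hx' i, rfl⟩) (fun i => ⟨y i, hy' i, rfl⟩) b
      · rintro b _ ⟨a, ha, rfl⟩
        exact ⟨P.ι b * a, NCPSpace.ι_mul_mem_adjoin _ b a ha, NCPSpace.ι_mul_cornerMk hp hpB a b⟩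
      · rintro b _ ⟨a, ha, rfl⟩
        exact ⟨P.ι b * a, NCPSpace.ι_mul_mem_adjoin _ b a ha, NCPSpace.ι_mul_cornerMk hp hpB a b⟩
    exact ⟨hmul, hmul.trans (hcomp.boxedConv_compress hp hpB hb₀ hcentral hq
      (NCPSpace.ι_mul_mem_adjoin _) hx hy b _)⟩
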